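/- **Setting.** A polygon is a connected open subset $D$ of a plane with $\partial D=\partial\overline D$ whose boundary is a finite union of straight segments (possibly infinite), the sides, any two of which have at most end points in common, each point common to more than one side lying on exactly two sides. A polyhedral domain is a connected open set $\mathbb P\subset\mathbb R^3$ (not necessarily bounded) with $\partial\mathbb P=\partial\overline{\mathbb P}=\bigcup_{k=1}^N\overline D_k$, where the faces $D_k$ are pairwise disjoint polygons lying in planes, and each side of a face is a side of exactly one other face. The sides of the faces are the edges of $\mathbb P$; assume that there is at least one. Let $\vartheta(p)$ be the distance from $p$ to the union $S$ of the edges, and $\mathbb P'=\overline{\mathbb P}\smallsetminus S$. The plane of each face is identified isometrically with $\mathbb R^2$. **Spaces.** For an open set $\Omega$, a weight $f>0$ on $\Omega$, $m\in\mathbb Z_{\ge0}$ and $a\in\mathbb R$, let $\mathcal K^m_a(\Omega;f)$ be the space of distributions $u$ on $\Omega$ with $f^{|\alpha|-a}\partial^\alpha u\in L^2(\Omega)$ for $|\alpha|\le m$, with norm $\big(\sum_{|\alpha|\le m}\|f^{|\alpha|-a}\partial^\alpha u\|_{L^2}^2\big)^{1/2}$, and let $\mathcal K^{-m}_{-a}(\Omega;f)$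 be the dual of the closure of $C_c^\infty(\Omega)$ in $\mathcal K^m_a(\Omega;f)$ (a space of distributions, the pairing extending $\int uv$). Put $H^m(\Omega)=\mathcal K^m_0(\Omega;1)$ and $\mathcal K^m_a(\mathbb P)=\mathcal K^m_a(\mathbb P;\vartheta)$, $m\in\mathbb Z$. For $m\ge0$ let $\mathcal K^m_a(\partial\mathbb P;\vartheta)=\bigoplus_k\mathcal K^m_a(D_k;\vartheta)$ (no compatibility conditions between faces), and let $\mathcal K^{-m}_{-a}(\partial\mathbb P;\vartheta)$ be the dual of $\mathcal K^{m}_{a}(\partial\mathbb P;\vartheta)$. Distributions on $\partial\mathbb P$ are families of distributions on the faces $D_k$. (If an edge of another face touches $D_k$ from inside, $D_k$ is replaced here by $D_k\smallsetminus S$.) **Partition of unity.** Let $\epsilon\in(0,1)$, let $(x_j)$ be a sequence in $\mathbb P'$ and $\phi_j\in C_c^\infty(\mathbb P')$ a partition of unity on $\mathbb P'$ ($\phi_j\ge0$, $\sum_j\phi_j=1$) such that, for constants $C_k$ and $\kappa$: (i) for each $j$, either $B(x_j,\epsilon\vartheta(x_j)/4)\subset\mathbb P$, or $x_j\in\partial\mathbb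 P$, $\vartheta(x_j)>0$ and $B(x_j,\epsilon\vartheta(x_j))$ intersects no face other than the one containing $x_j$; (ii) $\operatorname{supp}\phi_j\subset B(x_j,\epsilon\vartheta(x_j)/2)$ if $x_j\in\partial\mathbb P$, and $\operatorname{supp}\phi_j\subset B(x_j,\epsilon\vartheta(x_j)/8)$ otherwise; (iii) $\vartheta^k|\nabla^k\phi_j|\le C_k\epsilon^{-k}$ on $\mathbb P$ for all $k\ge0$ and all $j$; (iv) each point of $\mathbb P$ lies in at most $\kappa$ of the balls $B(x_j,\epsilon\vartheta(x_j))$. Let $\alpha_j(x)=x_j+\vartheta(x_j)(x-x_j)$ and $J=\{j: x_j\in\partial\mathbb P\}$. If $j\notin J$ let $\Omega_j=\mathbb R^3$; if $j\in J$ let $\Omega_j$ be the open half-space with $x_j\in\partial\Omega_j$ that coincides with $\mathbb P$ near $x_j$. Products $\phi_ju$ are extended by zero, and the norm of a distribution outside a space is $\infty$. Put $$\nu_{m,a}(u)^2=\sum_j\vartheta(x_j)^{3-2a}\|(\phi_ju)\circ\alpha_j\|^2_{H^m(\Omega_j)},\qquad \mu_{s,a}(v)^2=\sum_{j\in J}\vartheta(x_j)^{2-2a}\|(\phi_jv)\circ\alpha_j\|^2_{H^s(\mathbb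 R^2)}$$ for distributions $u$ on $\mathbb P$ and $v$ on $\partial\mathbb P$, where in the second sum only the restriction of $v$ to the face containing $x_j$ enters. **Proposition.** (1) For all $m\in\mathbb Z$, $a\in\mathbb R$ and all distributions $u$ on $\mathbb P$, we have $u\in\mathcal K^m_a(\mathbb P)$ if and only if $\nu_{m,a}(u)<\infty$; moreover $\nu_{m,a}$ is a norm on $\mathcal K^m_a(\mathbb P)$ equivalent to the given one. (2) For all $s\in\mathbb Z$, $a\in\mathbb R$ and all distributions $v$ on $\partial\mathbb P$, we have $v\in\mathcal K^s_a(\partial\mathbb P;\vartheta)$ if and only if $\mu_{s,a}(v)<\infty$; moreover $\mu_{s,a}$ is a norm on $\mathcal K^s_a(\partial\mathbb P;\vartheta)$ equivalent to the given one. Here, for $s<0$, an element of the dual space is identified with its restriction to test functions, and this identification is injective: a continuous linear form on $\mathcal K^{n}_{a}(\partial\mathbb P;\vartheta)$, $n\ge0$, that vanishes on all test functions on the faces is zero. -/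

import Mathlib

open Set Filter Topology MeasureTheory TopologicalSpace
open scoped ENNReal NNReal Distributions LineDeriv ContDiff

noncomputable section

/-- `d`-dimensional Euclidean space. -/
abbrev Euc (d : ℕ) : Type := EuclideanSpace ℝ (Fin d)

/-! ### Weighted Sobolev norms of distributions

Distributions are the elements of `𝓓'(Ω, ℂ)`.  The norms below take values in `[0, ∞]` and are
defined for an arbitrary map `T : 𝓓(Ω, ℝ) → ℂ`, so that they can be applied to distributions as
well as to functionals that are built from them. -/

section WeightedSobolev

variable {d : ℕ} {Ω : Opens (Euc d)}

/-- The classical derivative `∂^α g` of a test function, for a multi-index `α`. -/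
def testDeriv (α : Fin d → ℕ) (g : 𝓓(Ω, ℝ)) : 𝓓(Ω, ℝ) :=
  (List.finRange d).foldr
    (fun i h => (fun k : 𝓓(Ω, ℝ) => ∂_{(EuclideanSpace.single i (1 : ℝ) : Euc d)} k)^[α i] h) g

/-- The distributional derivative `∂^α T`, that is `g ↦ (-1)^|α| T (∂^α g)`. -/
def weakDeriv (α : Fin d → ℕ) (T : 𝓓(Ω, ℝ) → ℂ) : 𝓓(Ω, ℝ) → ℂ :=
  fun g => (-1) ^ (∑ i, α i) * T (testDeriv α g)

/-- `T` is given by the locally integrable function `f` on `Ω`. -/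
def IsRepBy (T : 𝓓(Ω, ℝ) → ℂ) (f : Euc d → ℂ) : Prop :=
  LocallyIntegrableOn f (Ω : Set (Euc d)) ∧
    ∀ g : 𝓓(Ω, ℝ), T g = ∫ x in (Ω : Set (Euc d)), ((g x : ℝ) : ℂ) * f x

/-- `‖w^s T‖²` in `L²(Ω)`; it is `∞` if `T` is not a locally integrable function
(the function is unique up to null sets). -/
def weightedL2Sq (w : Euc d → ℝ) (s : ℝ) (T : 𝓓(Ω, ℝ) → ℂ) : ℝ≥0∞ :=
  ⨅ (f : Euc d → ℂ) (_ : IsRepBy T f),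
    ∫⁻ x in (Ω : Set (Euc d)), ‖((w x ^ s : ℝ) : ℂ) * f x‖ₑ ^ 2

/-- The square of the norm of `𝒦^m_a(Ω; w)` for `m ≥ 0`: the sum of the `‖w^(|α|-a) ∂^α T‖²` in
`L²(Ω)` over all multi-indices `α` with `|α| ≤ m`. -/
def weightedSobolevSq (w : Euc d → ℝ) (m : ℕ) (a : ℝ) (T : 𝓓(Ω, ℝ) → ℂ) : ℝ≥0∞ :=
  ∑ k ∈ Finset.range (m + 1), ∑ α ∈ Finset.piAntidiag (Finset.univ : Finset (Fin d)) k,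
    weightedL2Sq w ((k : ℝ) - a) (weakDeriv α T)

/-- The complex linear extension of `T` to complex test functions. -/
def complexEval (T : 𝓓(Ω, ℝ) → ℂ) (f : 𝓓(Ω, ℂ)) : ℂ :=
  T (TestFunction.postcompCLM (𝕜 := ℝ) Complex.reCLM f) +
    Complex.I * T (TestFunction.postcompCLM (𝕜 := ℝ) Complex.imCLM f)

/-- A complex test function, viewed as a distribution. -/
def ofTest (f : 𝓓(Ω, ℂ)) : 𝓓(Ω, ℝ) → ℂ :=
  fun g => ∫ x in (Ω : Set (Euc d)), ((g x : ℝ) : ℂ) * f x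

/-- The norm of `𝒦^m_a(Ω; w)` for `m ∈ ℤ`.  For `m < 0` this space is the dual of the closure of
`C_c^∞(Ω)` in `𝒦^{-m}_{-a}(Ω; w)`, with the pairing that extends `∫ u v`; since `C_c^∞(Ω)` is
dense in that closure, the dual norm is a supremum over test functions
(the quotient is `0` for the zero test function). -/
def kondNorm (w : Euc d → ℝ) (m : ℤ) (a : ℝ) (T : 𝓓(Ω, ℝ) → ℂ) : ℝ≥0∞ :=
  match m with
  | Int.ofNat n => weightedSobolevSq w n a T ^ (1 / 2 : ℝ)
  | Int.negSucc n =>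
      ⨆ f : 𝓓(Ω, ℂ), ‖complexEval T f‖ₑ / weightedSobolevSq w (n + 1) (-a) (ofTest f) ^ (1 / 2 : ℝ)

/-- The norm of the usual Sobolev space `H^m(Ω)`, `m ∈ ℤ`; for `m < 0` this is the dual of
`H^{-m}_0(Ω)`. -/
def sobolevNorm (m : ℤ) (T : 𝓓(Ω, ℝ) → ℂ) : ℝ≥0∞ :=
  kondNorm (fun _ => 1) m 0 T

open Classical in
/-- The value of a distribution on a function `F` (zero if `F` is not a test function on `Ω`). -/
def evalFun (u : 𝓓'(Ω, ℂ)) (F : Euc d → ℝ) : ℂ :=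
  if h : ContDiff ℝ ∞ F ∧ HasCompactSupport F ∧ tsupport F ⊆ (Ω : Set (Euc d)) then
    u ⟨F, h.1, h.2.1, h.2.2⟩
  else 0

/-- The distribution `(φ u) ∘ α` on `Ω'`, where `α x = c + r (x - c)` is the dilation of center
`c` and ratio `r`, that is `g ↦ r^{-d} u (φ · (g ∘ α⁻¹))`.  Here `φ u` is extended by zero; this
is meaningful if `φ · (g ∘ α⁻¹)` is a test function on `Ω` for all test functions `g` on `Ω'`. -/
def dilatedProduct (u : 𝓓'(Ω, ℂ)) (φ : Euc d → ℝ) (c : Euc d) (r : ℝ) (Ω' : Opens (Euc d)) :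
    𝓓(Ω', ℝ) → ℂ :=
  fun g => ((r ^ d)⁻¹ : ℝ) * evalFun u (fun y => φ y * g (c + r⁻¹ • (y - c)))

theorem weightedL2Sq_add_lt_top {w : Euc d → ℝ} (hw : Measurable w) {s : ℝ}
    {T S : 𝓓(Ω, ℝ) → ℂ} (hT : weightedL2Sq w s T < ⊤) (hS : weightedL2Sq w s S < ⊤) :
    weightedL2Sq w s (T + S) < ⊤ := by
  simp only [weightedL2Sq, iInf_lt_iff] at hT hS
  obtain ⟨f, ⟨hf, hfT⟩, hfi⟩ := hT
  obtain ⟨g, ⟨hg, hgS⟩, hgi⟩ := hS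
  have key : ∀ (f : Euc d → ℂ), LocallyIntegrableOn f (Ω : Set (Euc d)) → ∀ h : 𝓓(Ω, ℝ),
      IntegrableOn (fun x => ((h x : ℝ) : ℂ) * f x) (Ω : Set (Euc d)) := by
    intro f hf h
    have := TestFunction.integrable_bilin (𝕜 := ℝ) (ContinuousLinearMap.lsmul ℝ ℝ) hf h
    simpa using this.integrableOn
  have hrep : IsRepBy (T + S) (f + g) := by
    refine ⟨hf.add hg, fun h => ?_⟩
    simp only [Pi.add_apply, hfT, hgS, mul_add]
    exact (integral_add (key f hf h) (key g hg h)).symm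
  refine lt_of_le_of_lt (iInf₂_le (f + g) hrep) ?_
  · have hm : AEMeasurable (fun x => 2 * ‖((w x ^ s : ℝ) : ℂ) * f x‖ₑ ^ 2)
        (volume.restrict (Ω : Set (Euc d))) := by
      have h1 : AEMeasurable f (volume.restrict (Ω : Set (Euc d))) :=
        (hf.aestronglyMeasurable).aemeasurable
      have h2 : Measurable (fun x => ((w x ^ s : ℝ) : ℂ)) :=
        Complex.measurable_ofReal.comp (hw.pow_const s)
      exact (((h2.aemeasurable.mul h1).enorm).pow_const 2).const_mul 2
    calc _ ≤ ∫⁻ x in (Ω : Set (Euc d)), (2 * ‖((w x ^ s : ℝ) : ℂ) * f x‖ₑ ^ 2 +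
            2 * ‖((w x ^ s : ℝ) : ℂ) * g x‖ₑ ^ 2) := by
          refine lintegral_mono fun x => ?_
          simp only [Pi.add_apply, mul_add]
          refine (pow_le_pow_left₀ zero_le (enorm_add_le _ _) 2).trans ?_
          have := ENNReal.rpow_add_le_mul_rpow_add_rpow
            ‖((w x ^ s : ℝ) : ℂ) * f x‖ₑ ‖((w x ^ s : ℝ) : ℂ) * g x‖ₑ (p := 2) (by norm_num)
          norm_num at this
          simpa only [mul_add, enorm_mul] using this
      _ < ⊤ := by
          rw [lintegral_add_left' hm, lintegral_const_mul' _ _ (by simp),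
            lintegral_const_mul' _ _ (by simp)]
          exact ENNReal.add_lt_top.2
            ⟨ENNReal.mul_lt_top (by simp) hfi, ENNReal.mul_lt_top (by simp) hgi⟩

theorem weightedL2Sq_smul_lt_top {w : Euc d → ℝ} {s : ℝ} (c : ℂ)
    {T : 𝓓(Ω, ℝ) → ℂ} (hT : weightedL2Sq w s T < ⊤) : weightedL2Sq w s (c • T) < ⊤ := by
  simp only [weightedL2Sq, iInf_lt_iff] at hT
  obtain ⟨f, ⟨hf, hfT⟩, hfi⟩ := hT
  have hrep : IsRepBy (c • T) (c • f) := by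
    refine ⟨hf.smul c, fun h => ?_⟩
    simp only [Pi.smul_apply, smul_eq_mul, hfT, mul_left_comm _ c]
    exact (integral_const_mul c _).symm
  refine lt_of_le_of_lt (iInf₂_le (c • f) hrep) ?_
  · simp only [Pi.smul_apply, smul_eq_mul, mul_left_comm _ c, enorm_mul c, mul_pow]
    rw [lintegral_const_mul' _ _ (by simp)]
    exact ENNReal.mul_lt_top (by simp) hfi

theorem weightedSobolevSq_lt_top {w : Euc d → ℝ} {m : ℕ} {a : ℝ} {T : 𝓓(Ω, ℝ) → ℂ} :
    weightedSobolevSq w m a T < ⊤ ↔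
      ∀ k ∈ Finset.range (m + 1), ∀ α ∈ Finset.piAntidiag (Finset.univ : Finset (Fin d)) k,
        weightedL2Sq w ((k : ℝ) - a) (weakDeriv α T) < ⊤ := by
  simp only [weightedSobolevSq, ENNReal.sum_lt_top]

theorem weightedSobolevSq_add_lt_top {w : Euc d → ℝ} (hw : Measurable w) {m : ℕ} {a : ℝ}
    {T S : 𝓓(Ω, ℝ) → ℂ} (hT : weightedSobolevSq w m a T < ⊤)
    (hS : weightedSobolevSq w m a S < ⊤) : weightedSobolevSq w m a (T + S) < ⊤ := by
  rw [weightedSobolevSq_lt_top] at *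
  intro k hk α hα
  have : weakDeriv α (T + S) = weakDeriv α T + weakDeriv α S := by
    funext g; simp [weakDeriv, mul_add]
  rw [this]
  exact weightedL2Sq_add_lt_top hw (hT k hk α hα) (hS k hk α hα)

theorem weightedSobolevSq_smul_lt_top {w : Euc d → ℝ} {m : ℕ} {a : ℝ} (c : ℂ)
    {T : 𝓓(Ω, ℝ) → ℂ} (hT : weightedSobolevSq w m a T < ⊤) :
    weightedSobolevSq w m a (c • T) < ⊤ := by
  rw [weightedSobolevSq_lt_top] at *
  intro k hk α hα
  have : weakDeriv α (c • T) = c • weakDeriv α T := by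
    funext g; simp [weakDeriv, mul_left_comm]
  rw [this]
  exact weightedL2Sq_smul_lt_top c (hT k hk α hα)

theorem weightedSobolevSq_zero_lt_top {w : Euc d → ℝ} {m : ℕ} {a : ℝ} :
    weightedSobolevSq w m a (0 : 𝓓(Ω, ℝ) → ℂ) < ⊤ := by
  rw [weightedSobolevSq_lt_top]
  intro k hk α hα
  have h0 : weakDeriv α (0 : 𝓓(Ω, ℝ) → ℂ) = 0 := by funext g; simp [weakDeriv]
  rw [h0]
  refine lt_of_le_of_lt (iInf₂_le (0 : Euc d → ℂ) ⟨?_, fun h => by simp⟩) (by simp)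
  exact locallyIntegrableOn_zero

end WeightedSobolev

/-! ### Polygons and polyhedral domains -/

/-- Straight segments, possibly infinite: closed segments `[A, B]` with `A ≠ B`, closed half-lines
and lines.  These are exactly the closed convex subsets of lines with more than one point;
their end points are their extreme points. -/
def IsStraightSegment (s : Set (Euc 2)) : Prop :=
  IsClosed s ∧ Convex ℝ s ∧ Collinear ℝ s ∧ s.Nontrivial

/-- A polygon in the plane, with its sides. -/
structure PolygonalDomain where
  carrier : Opens (Euc 2)
  isConnected : IsConnected (carrier : Set (Euc 2))
  sides : Set (Set (Euc 2))
  finite_sides : sides.Finite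
  straight : ∀ s ∈ sides, IsStraightSegment s
  frontier_eq : frontier (carrier : Set (Euc 2)) = ⋃ s ∈ sides, s
  frontier_closure : frontier (closure (carrier : Set (Euc 2))) = frontier (carrier : Set (Euc 2))
  /-- Two sides have at most end points in common. -/
  inter_sides : ∀ s ∈ sides, ∀ t ∈ sides, s ≠ t → s ∩ t ⊆ s.extremePoints ℝ ∩ t.extremePoints ℝ
  /-- Each vertex (a point common to more than one side) belongs to exactly two sides. -/
  vertex_sides : ∀ s ∈ sides, ∀ t ∈ sides, s ≠ t → ∀ p ∈ s ∩ t, ∀ r ∈ sides, p ∈ r → r = s ∨ r = t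

/-- A polyhedral domain in `ℝ³`.  The `j`-th (open) face is the image of the polygon `face j`
under `chart j`, which identifies the plane of that face isometrically with `ℝ²`. -/
structure PolyhedralDomain where
  carrier : Opens (Euc 3)
  isConnected : IsConnected (carrier : Set (Euc 3))
  N : ℕ
  face : Fin N → PolygonalDomain
  chart : Fin N → (Euc 2 →ᵃⁱ[ℝ] Euc 3)
  frontier_closure : frontier (closure (carrier : Set (Euc 3))) = frontier (carrier : Set (Euc 3))
  frontier_eq : frontier (carrier : Set (Euc 3)) =
    ⋃ j, closure (chart j '' ((face j).carrier : Set (Euc 2)))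
  disjoint_faces : ∀ j k, j ≠ k → Disjoint (chart j '' ((face j).carrier : Set (Euc 2)))
    (chart k '' ((face k).carrier : Set (Euc 2)))
  /-- A side of a face is a side of exactly one other face. -/
  side_shared : ∀ j, ∀ s ∈ (face j).sides,
    ∃! k, k ≠ j ∧ ∃ t ∈ (face k).sides, chart k '' t = chart j '' s

namespace PolyhedralDomain

variable (P : PolyhedralDomain)

/-- The `j`-th open face, as a subset of `ℝ³`. -/
def faceSet (j : Fin P.N) : Set (Euc 3) := P.chart j '' ((P.face j).carrier : Set (Euc 2))

/-- The union of the edges, i.e. of the sides of the faces. -/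
def sing : Set (Euc 3) := ⋃ j, ⋃ s ∈ (P.face j).sides, P.chart j '' s

/-- The distance `ϑ` to the union of the edges. -/
def theta (p : Euc 3) : ℝ := Metric.infDist p P.sing

/-- The closure of the domain without its edges. -/
def prime : Set (Euc 3) := closure (P.carrier : Set (Euc 3)) \ P.sing

/-- The norm of `𝒦^m_a(P) = 𝒦^m_a(P; ϑ)`. -/
def domainNorm (m : ℤ) (a : ℝ) (u : 𝓓'(P.carrier, ℂ)) : ℝ≥0∞ := kondNorm P.theta m a u

/-- `n` is the inner unit normal of `P` at a boundary point `x` at which `P` is locally a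
half-space. -/
def IsInnerNormal (x n : Euc 3) : Prop :=
  ‖n‖ = 1 ∧ ∀ᶠ y in 𝓝 x, (y ∈ P.carrier ↔ 0 < inner ℝ n (y - x))

open Classical in
/-- The open half-space with boundary point `x` that agrees with `P` near `x`, if `x` lies on the
boundary away from the edges; the whole space `ℝ³` if `x ∈ P`. -/
def model (x : Euc 3) : Opens (Euc 3) :=
  if h : ∃ n, P.IsInnerNormal x n then
    ⟨{y | 0 < inner ℝ h.choose (y - x)}, isOpen_lt (by fun_prop) (by fun_prop)⟩
  else ⊤

/-- A sequence of points `x j ∈ P'` with a smooth partition of unity `φ j ∈ C_c^∞(P')` on `P'`,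
adapted to the distance `ϑ` to the edges, with parameter `ε`.  The functions on `P'` are written
as restrictions of smooth functions on `ℝ³`, whose values outside of `P'` play no role. -/
structure IsAdaptedPartition (ε : ℝ) (x : ℕ → Euc 3) (φ : ℕ → Euc 3 → ℝ) : Prop where
  mem : ∀ j, x j ∈ P.prime
  smooth : ∀ j, ContDiff ℝ ∞ (φ j)
  nonneg : ∀ j, ∀ p ∈ P.prime, 0 ≤ φ j p
  sum_eq_one : ∀ p ∈ P.prime, HasSum (fun j => φ j p) 1
  balls : ∀ j, Metric.ball (x j) (ε * P.theta (x j) / 4) ⊆ P.carrier ∨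
    (x j ∈ frontier (P.carrier : Set (Euc 3)) ∧ 0 < P.theta (x j) ∧
      ∃ i, x j ∈ P.faceSet i ∧
        ∀ k, k ≠ i → Disjoint (Metric.ball (x j) (ε * P.theta (x j))) (P.faceSet k))
  support_bdry : ∀ j, x j ∈ frontier (P.carrier : Set (Euc 3)) →
    tsupport (φ j) ⊆ Metric.ball (x j) (ε * P.theta (x j) / 2)
  support_int : ∀ j, x j ∉ frontier (P.carrier : Set (Euc 3)) →
    tsupport (φ j) ⊆ Metric.ball (x j) (ε * P.theta (x j) / 8)
  /-- `ϑ^k |∇^k φ j| ≤ C k ε^{-k}` on `P`, for all `k`. -/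
  deriv_bound : ∃ C : ℕ → ℝ, ∀ k j, ∀ p ∈ P.carrier,
    P.theta p ^ k * ‖iteratedFDeriv ℝ k (φ j) p‖ ≤ C k * (ε ^ k)⁻¹
  /-- Every point of `P` belongs to at most `κ` of the balls `B(x j, ε ϑ(x j))`. -/
  overlap : ∃ κ : ℕ, ∀ p ∈ P.carrier,
    {j | p ∈ Metric.ball (x j) (ε * P.theta (x j))}.encard ≤ κ

/-- `ν_{m,a}(u)`, the square root of `∑ j, ϑ(x j)^(3-2a) ‖(φ j u) ∘ α j‖²`, where the norm is that
of `H^m(ℝ³)` if `x j` is in the interior and that of `H^m` of a half-space if `x j` is on the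
boundary; `α j` is the dilation of center `x j` and ratio `ϑ(x j)`. -/
def nu (x : ℕ → Euc 3) (φ : ℕ → Euc 3 → ℝ) (m : ℤ) (a : ℝ) (u : 𝓓'(P.carrier, ℂ)) : ℝ≥0∞ :=
  (∑' j, ENNReal.ofReal (P.theta (x j) ^ (3 - 2 * a)) *
    sobolevNorm m (dilatedProduct u (φ j) (x j) (P.theta (x j)) (P.model (x j))) ^ 2) ^ (1 / 2 : ℝ)

/-! ### The boundary -/

theorem continuous_theta : Continuous P.theta := Metric.continuous_infDist_pt _

/-- The weight `ϑ` on the `j`-th face, in the coordinates of its plane. -/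
def faceTheta (j : Fin P.N) (q : Euc 2) : ℝ := P.theta (P.chart j q)

theorem continuous_faceTheta (j : Fin P.N) : Continuous (P.faceTheta j) :=
  P.continuous_theta.comp (P.chart j).continuous

/-- The `j`-th open face in the coordinates of its plane (without the points of edges of other
faces, in case such an edge touches this face from inside). -/
def faceRegion (j : Fin P.N) : Opens (Euc 2) :=
  ⟨{q | q ∈ (P.face j).carrier ∧ 0 < P.faceTheta j q},
    (P.face j).carrier.isOpen.inter (isOpen_lt continuous_const (P.continuous_faceTheta j))⟩

/-- Distributions on the boundary: one distribution on each open face. -/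
abbrev BdryDistr : Type := ∀ j : Fin P.N, 𝓓'(P.faceRegion j, ℂ)

/-- The norm of `𝒦^n_a(∂P; ϑ)` for `n ≥ 0`, the direct sum of the `𝒦^n_a(D_j; ϑ)`. -/
def bdryNormNat (n : ℕ) (a : ℝ) (u : P.BdryDistr) : ℝ≥0∞ :=
  (∑ j, weightedSobolevSq (P.faceTheta j) n a (u j)) ^ (1 / 2 : ℝ)

theorem bdryNormNat_lt_top {n : ℕ} {a : ℝ} {u : P.BdryDistr} :
    P.bdryNormNat n a u < ⊤ ↔ ∀ j, weightedSobolevSq (P.faceTheta j) n a (u j) < ⊤ := by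
  rw [bdryNormNat, ENNReal.rpow_lt_top_iff_of_pos (by norm_num), ENNReal.sum_lt_top]
  simp

/-- The space `𝒦^n_a(∂P; ϑ)` for `n ≥ 0`. -/
def bdrySpace (n : ℕ) (a : ℝ) : Submodule ℂ P.BdryDistr where
  carrier := {u | P.bdryNormNat n a u < ⊤}
  add_mem' {u v} hu hv := by
    simp only [mem_ofPred_eq, bdryNormNat_lt_top] at *
    exact fun j => weightedSobolevSq_add_lt_top (P.continuous_faceTheta j).measurable (hu j) (hv j)
  zero_mem' := by
    simp only [mem_ofPred_eq, bdryNormNat_lt_top]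
    exact fun j => weightedSobolevSq_zero_lt_top
  smul_mem' c u hu := by
    simp only [mem_ofPred_eq, bdryNormNat_lt_top] at *
    exact fun j => weightedSobolevSq_smul_lt_top c (hu j)

/-- The operator norm of a linear form on `𝒦^n_a(∂P; ϑ)` (infinite if it is not continuous). -/
def dualNorm {n : ℕ} {a : ℝ} (l : P.bdrySpace n a →ₗ[ℂ] ℂ) : ℝ≥0∞ :=
  ⨆ v : P.bdrySpace n a, ‖l v‖ₑ / P.bdryNormNat n a v

/-- The restriction of the linear form `l` to test functions is `u`: if `v` is the function on the
boundary that is given by the test function `g` on the `j`-th face and by zero on the other faces,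
then `l v = u j g`. -/
def RestrictsTo {n : ℕ} {a : ℝ} (l : P.bdrySpace n a →ₗ[ℂ] ℂ) (u : P.BdryDistr) : Prop :=
  ∀ (j : Fin P.N) (g : 𝓓(P.faceRegion j, ℝ)) (v : P.bdrySpace n a),
    (∀ h : 𝓓(P.faceRegion j, ℝ), (v : P.BdryDistr) j h =
      ∫ q in (P.faceRegion j : Set (Euc 2)), ((h q : ℝ) : ℂ) * ((g q : ℝ) : ℂ)) →
    (∀ k, k ≠ j → (v : P.BdryDistr) k = 0) → l v = u j g

/-- The norm of `𝒦^s_a(∂P; ϑ)` for `s ∈ ℤ`.  For `s < 0` this space is the dual of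
`𝒦^{-s}_{-a}(∂P; ϑ)`, whose elements are viewed as distributions. -/
def bdryNorm (s : ℤ) (a : ℝ) (u : P.BdryDistr) : ℝ≥0∞ :=
  match s with
  | Int.ofNat n => P.bdryNormNat n a u
  | Int.negSucc n =>
      ⨅ (l : P.bdrySpace (n + 1) (-a) →ₗ[ℂ] ℂ) (_ : P.RestrictsTo l u), P.dualNorm l

open Classical in
/-- `μ_{s,a}(u)`, the square root of the sum of `ϑ(x j)^(2-2a) ‖(φ j u) ∘ α j‖²_{H^s(ℝ²)}` over all
`j` with `x j ∈ ∂P`; the plane of the face that contains `x j` is identified with `ℝ²`. -/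
def mu (x : ℕ → Euc 3) (φ : ℕ → Euc 3 → ℝ) (s : ℤ) (a : ℝ) (u : P.BdryDistr) : ℝ≥0∞ :=
  (∑' j, ∑ k, if h : ∃ c ∈ (P.face k).carrier, P.chart k c = x j then
      ENNReal.ofReal (P.theta (x j) ^ (2 - 2 * a)) *
        sobolevNorm s (dilatedProduct (u k) (φ j ∘ P.chart k) h.choose (P.theta (x j)) ⊤) ^ 2
    else 0) ^ (1 / 2 : ℝ)

end PolyhedralDomain

/-- `N` is a norm (where finite) on the space of all `u ∈ V` with `N₀ u < ∞`, equivalent to the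
norm `N₀` of that space, and `N u = ∞` for all other `u ∈ V`. -/
structure DescribesNorm {V : Type*} [AddCommGroup V] [Module ℂ V] (N₀ N : V → ℝ≥0∞) : Prop where
  lt_top_iff : ∀ u, N₀ u < ⊤ ↔ N u < ⊤
  eq_zero_iff : ∀ u, N u = 0 ↔ u = 0
  add_le : ∀ u v, N (u + v) ≤ N u + N v
  smul_eq : ∀ (c : ℂ) u, N (c • u) = ‖c‖ₑ * N u
  equiv : ∃ C : ℝ≥0, ∀ u, N u ≤ C * N₀ u ∧ N₀ u ≤ C * N u

end

/-! The weight `ϑ` is 1-Lipschitz and `ε < 1`, so on the ball of radius `ε ϑ(x j)` about `x j` it is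
comparable to the constant `r j = ϑ(x j)`. For a constant weight `r`, a dilation of ratio `r` turns
the weighted norm into the unweighted one up to the factor `r^(d-2a)` in the squares; this is the
origin of the powers in `nu` (`d = 3`) and `mu` (`d = 2`), see `sobolevNorm_dilate`. Hence both
quantities are `ℓ²` sums of norms of `φ j u` with frozen weights, and what remains is a statement on
partitions of unity. It is proved once, for a `LocalCover`, as `LocalCover.exists_equiv`, and
applied to the domain (`IsAdaptedPartition.cover`) and to every face
(`IsAdaptedPartition.faceCover`).

For order `m ≥ 0`, the Leibniz formula, the scale-invariant bounds on the derivatives of the cut-off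
functions and the finite overlap give two estimates with constants independent of `j`: localization
is bounded (`tsum_pull_le`), and so is the synthesis of a function from local pieces
(`le_tsum_pull`). The second one is applied to `u = ∑ ψ j (φ j u)`, where `ψ j = 1` on the support
of `φ j`.

For `m < 0` the two estimates change roles by duality. From `u(f) = ∑ (φ j u)(ψ j f)` and
Cauchy-Schwarz, boundedness of localization controls the global norm (`kondNorm_neg_le`).
Conversely, nearly extremal local test functions `f j` are combined into one test function `∑ b j φ
j f j`, whose norm is controlled by synthesis (`sum_dualQuot_le`, `locNorm_neg_le`).

The geometric input is `exists_innerNormal`: around a center on a face, the domain is a half-space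
on the whole ball of radius `ε ϑ(x j)`, not just near the center.

On the boundary, negative order refers to the dual of the whole space and not of the closure of the
test functions. The Hahn-Banach theorem identifies the two norms up to a constant
(`bdryNorm_neg_le`). Uniqueness of the extension is the density of test functions: on faces all
models are full planes, so cutting off and mollifying suffices (`LocalCover.exists_test_approx`). -/

noncomputable section

/-! ### Test functions: derivatives and multiplication by cut-off functions -/

section TestFunctions

variable {d : ℕ} {Ω Ω₁ Ω₂ : Opens (Euc d)} {F : Type*} [NormedAddCommGroup F]
  [NormedSpace ℝ F]

/-- The `i`-th standard basis vector. -/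
abbrev stdVec (i : Fin d) : Euc d := EuclideanSpace.single i (1 : ℝ)

theorem coe_lineDeriv (v : Euc d) (g : 𝓓(Ω, F)) :
    ((∂_{v} g : 𝓓(Ω, F)) : Euc d → F) = fun x => fderiv ℝ g x v := by
  funext x
  rw [TestFunction.lineDerivOp_eq_lineDerivCLM ℝ, TestFunction.lineDerivCLM_eq_fderivCLM,
    TestFunction.fderivCLM_apply_of_le _ le_top]

theorem TestFunction.differentiable' (g : 𝓓(Ω, F)) : Differentiable ℝ g :=
  g.contDiff.differentiable (by simp)

theorem lineDeriv_comm (v w : Euc d) (g : 𝓓(Ω, F)) :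
    (∂_{v} (∂_{w} g : 𝓓(Ω, F)) : 𝓓(Ω, F)) = ∂_{w} (∂_{v} g : 𝓓(Ω, F)) := by
  ext x
  have h2 : DifferentiableAt ℝ (fderiv ℝ g) x :=
    ((g.contDiff.fderiv_right (m := ∞) (by simp)).differentiable (by simp)) x
  have key : ∀ a b : Euc d, fderiv ℝ (fun y => fderiv ℝ g y b) x a = fderiv ℝ (fderiv ℝ g) x a b := by
    intro a b
    rw [fderiv_clm_apply h2 (differentiableAt_const b)]
    simp
  simp only [coe_lineDeriv, key]
  exact (g.contDiff.contDiffAt.isSymmSndFDerivAt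
    (by simpa using WithTop.coe_le_coe.2 (le_top : (2 : ℕ∞) ≤ ⊤))) v w

/-- Since the operators commute, an additional factor can be moved to the innermost position. Stated
abstractly because it serves real test functions (`testDeriv`) as well as complex ones
(`multiDeriv`). -/
theorem foldr_iterate_add_single {X : Type*} (D : Fin d → X → X)
    (hD : ∀ i j, Function.Commute (D i) (D j)) (α : Fin d → ℕ) (i : Fin d) (l : List (Fin d))
    (hl : l.Nodup) (g : X) :
    l.foldr (fun j h => (D j)^[(α + Pi.single i 1 : Fin d → ℕ) j] h) g =
      l.foldr (fun j h => (D j)^[α j] h) (if i ∈ l then D i g else g) := by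
  induction l with
  | nil => simp
  | cons j l ih =>
    rw [List.nodup_cons] at hl
    have ih := ih hl.2
    have comm : ∀ (l : List (Fin d)) (g : X),
        l.foldr (fun j h => (D j)^[α j] h) (D i g) = D i (l.foldr (fun j h => (D j)^[α j] h) g) := by
      intro l
      induction l with
      | nil => simp
      | cons k l ih => intro g; simp only [List.foldr_cons, ih]
                       exact (hD k i).iterate_left _ _
    simp only [List.foldr_cons, ih]
    by_cases hij : i = j
    · subst hij
      simp only [hl.1, if_false, List.mem_cons_self, if_true, comm]
      simp [Function.iterate_succ_apply]
    · have : (α + Pi.single i 1 : Fin d → ℕ) j = α j := by simp [Ne.symm hij]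
      simp [this, hij]

theorem testDeriv_zero (g : 𝓓(Ω, ℝ)) : testDeriv 0 g = g := by
  unfold testDeriv
  induction List.finRange d with
  | nil => rfl
  | cons i l ih => simp only [List.foldr_cons, ih]; rfl

/-- Together with `multiIndex_induction` this replaces the definition by a fold in all later
arguments. -/
theorem testDeriv_add_single (α : Fin d → ℕ) (i : Fin d) (g : 𝓓(Ω, ℝ)) :
    testDeriv (α + Pi.single i 1) g = testDeriv α (∂_{stdVec i} g : 𝓓(Ω, ℝ)) := by
  have := foldr_iterate_add_single
    (fun (i : Fin d) (k : 𝓓(Ω, ℝ)) => (∂_{stdVec i} k : 𝓓(Ω, ℝ)))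
    (fun i j g => lineDeriv_comm _ _ g) α i (List.finRange d) (List.nodup_finRange d) g
  simpa [testDeriv] using this

/-- Multi-indices can be built up by adding one derivative at a time. -/
theorem multiIndex_induction {p : (Fin d → ℕ) → Prop} (zero : p 0)
    (step : ∀ α i, p α → p (α + Pi.single i 1)) (α : Fin d → ℕ) : p α := by
  induction hn : ∑ i, α i generalizing α with
  | zero =>
    have : α = 0 := by
      funext i
      exact Finset.sum_eq_zero_iff.1 hn i (Finset.mem_univ i)
    exact this ▸ zero
  | succ n ih =>
    obtain ⟨i, hi⟩ : ∃ i, α i ≠ 0 := by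
      by_contra! h
      simp [h] at hn
    have hα : α = (α - Pi.single i 1) + Pi.single i 1 := by
      funext j
      by_cases hj : j = i
      · subst hj; simp; omega
      · simp [hj]
    rw [hα]
    refine step _ _ (ih _ ?_)
    rw [hα] at hn
    simp only [Pi.add_apply, Finset.sum_add_distrib, Finset.sum_pi_single', Finset.mem_univ,
      if_true] at hn
    omega

theorem sum_add_single (α : Fin d → ℕ) (i : Fin d) :
    ∑ j, (α + Pi.single i 1 : Fin d → ℕ) j = (∑ j, α j) + 1 := by
  simp [Finset.sum_add_distrib]

theorem weakDeriv_zero (T : 𝓓(Ω, ℝ) → ℂ) : weakDeriv 0 T = T := by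
  funext g; simp [weakDeriv, testDeriv_zero]

theorem weakDeriv_add_single (α : Fin d → ℕ) (i : Fin d) (T : 𝓓(Ω, ℝ) → ℂ) (g : 𝓓(Ω, ℝ)) :
    weakDeriv (α + Pi.single i 1) T g = - weakDeriv α T (∂_{stdVec i} g : 𝓓(Ω, ℝ)) := by
  simp only [weakDeriv, testDeriv_add_single, sum_add_single, pow_succ]
  ring

theorem testDeriv_add (α : Fin d → ℕ) (f g : 𝓓(Ω, ℝ)) :
    testDeriv α (f + g) = testDeriv α f + testDeriv α g := by
  induction α using multiIndex_induction generalizing f g with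
  | zero => simp [testDeriv_zero]
  | step α i ih => simp only [testDeriv_add_single, LineDeriv.lineDerivOp_add, ih]

theorem testDeriv_smul (α : Fin d → ℕ) (c : ℝ) (g : 𝓓(Ω, ℝ)) :
    testDeriv α (c • g) = c • testDeriv α g := by
  induction α using multiIndex_induction generalizing g with
  | zero => simp [testDeriv_zero]
  | step α i ih => simp only [testDeriv_add_single, LineDeriv.lineDerivOp_smul, ih]

theorem weakDeriv_linear (α : Fin d → ℕ) (T : 𝓓(Ω, ℝ) →ₗ[ℝ] ℂ) :
    ∃ S : 𝓓(Ω, ℝ) →ₗ[ℝ] ℂ, weakDeriv α T = S := by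
  refine ⟨{ toFun := weakDeriv α T, map_add' := ?_, map_smul' := ?_ }, rfl⟩
  · intro f g; simp [weakDeriv, testDeriv_add, mul_add]
  · intro c g; simp [weakDeriv, testDeriv_smul, mul_left_comm]

/-- A smooth function `η` with `supp η ∩ Ω₁ ⊆ Ω₂`, so that multiplication with `η` maps test
functions on `Ω₁` to test functions on `Ω₂`. -/
structure Cutoff (Ω₁ Ω₂ : Opens (Euc d)) where
  toFun : Euc d → ℝ
  smooth : ContDiff ℝ ∞ toFun
  supp : ∀ y ∈ tsupport toFun, y ∈ Ω₁ → y ∈ Ω₂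

namespace Cutoff

variable (η : Cutoff Ω₁ Ω₂)

/-- Multiplication of test functions with a cut-off function. -/
def mul : 𝓓(Ω₁, F) →ₗ[ℝ] 𝓓(Ω₂, F) where
  toFun g :=
    { toFun := fun y => η.toFun y • g y
      contDiff' := η.smooth.smul g.contDiff
      hasCompactSupport' := g.hasCompactSupport.smul_left
      tsupport_subset' := fun y hy => η.supp y (tsupport_smul_subset_left _ _ hy)
        (g.tsupport_subset (tsupport_smul_subset_right _ _ hy)) }
  map_add' f g := by ext y; exact smul_add (η.toFun y) (f y) (g y)
  map_smul' c g := by ext y; exact smul_comm (η.toFun y) c (g y)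

@[simp] theorem mul_apply (g : 𝓓(Ω₁, F)) (y : Euc d) : η.mul g y = η.toFun y • g y := rfl

/-- The partial derivatives of a cut-off function. -/
def deriv (i : Fin d) : Cutoff Ω₁ Ω₂ where
  toFun := fun y => fderiv ℝ η.toFun y (stdVec i)
  smooth := (η.smooth.fderiv_right (m := ∞) (by simp)).clm_apply contDiff_const
  supp := fun y hy => η.supp y (tsupport_fderiv_apply_subset ℝ _ hy)

theorem tsupport_deriv (i : Fin d) : tsupport (η.deriv i).toFun ⊆ tsupport η.toFun :=
  tsupport_fderiv_apply_subset ℝ _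

/-- Iterated partial derivatives of a cut-off function. -/
def derivs : List (Fin d) → Cutoff Ω₁ Ω₂
  | [] => η
  | i :: L => (derivs L).deriv i

theorem tsupport_derivs (L : List (Fin d)) : tsupport (η.derivs L).toFun ⊆ tsupport η.toFun := by
  induction L with
  | nil => exact subset_rfl
  | cons i L ih => exact ((η.derivs L).tsupport_deriv i).trans ih

theorem lineDeriv_mul (i : Fin d) (g : 𝓓(Ω₁, F)) :
    (∂_{stdVec i} (η.mul g) : 𝓓(Ω₂, F)) = (η.deriv i).mul g + η.mul (∂_{stdVec i} g : 𝓓(Ω₁, F)) := by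
  ext y
  have h1 : DifferentiableAt ℝ η.toFun y := (η.smooth.differentiable (by simp)) y
  have : fderiv ℝ (η.mul g) y = fderiv ℝ (fun y => η.toFun y • g y) y := rfl
  simp only [coe_lineDeriv, this, fderiv_fun_smul h1 (g.differentiable' y)]
  simp [coe_lineDeriv, deriv, add_comm]

/-- The functional `η T` on `Ω₁`, for a functional `T` on `Ω₂`. -/
def pull (T : 𝓓(Ω₂, ℝ) →ₗ[ℝ] ℂ) : 𝓓(Ω₁, ℝ) →ₗ[ℝ] ℂ := T ∘ₗ η.mul

@[simp] theorem pull_apply (T : 𝓓(Ω₂, ℝ) →ₗ[ℝ] ℂ) (g : 𝓓(Ω₁, ℝ)) :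
    η.pull T g = T (η.mul g) := rfl

end Cutoff

/-- The Leibniz formula for weak derivatives. -/
theorem exists_leibniz (α : Fin d → ℕ) :
    ∃ S : List (List (Fin d) × (Fin d → ℕ)),
      (∀ p ∈ S, p.1.length + ∑ i, p.2 i = ∑ i, α i) ∧
      ∀ (Ω₁ Ω₂ : Opens (Euc d)) (η : Cutoff Ω₁ Ω₂) (T : 𝓓(Ω₂, ℝ) →ₗ[ℝ] ℂ) (g : 𝓓(Ω₁, ℝ)),
        weakDeriv α (η.pull T) g =
          (S.map fun p => weakDeriv p.2 T ((η.derivs p.1).mul g)).sum := by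
  induction α using multiIndex_induction with
  | zero =>
    refine ⟨[([], 0)], by simp, fun Ω₁ Ω₂ η T g => ?_⟩
    simp [weakDeriv_zero, Cutoff.derivs]
  | step α i ih =>
    obtain ⟨S, hS, h⟩ := ih
    -- The new derivative falls either on `T` or on the cut-off function. Equal terms are kept as
    -- repeated list entries, so no binomial coefficients occur. The list depends on `α` only, which
    -- makes the later constants uniform in the cut-off function.
    refine ⟨S.map (fun p => (p.1, p.2 + Pi.single i 1)) ++ S.map (fun p => (i :: p.1, p.2)),
      ?_, fun Ω₁ Ω₂ η T g => ?_⟩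
    · intro p hp
      rw [List.mem_append, List.mem_map, List.mem_map] at hp
      rcases hp with ⟨q, hq, rfl⟩ | ⟨q, hq, rfl⟩
      · simp only [sum_add_single, ← hS q hq]; ring
      · simp only [sum_add_single, ← hS q hq, List.length_cons]; ring
    · rw [weakDeriv_add_single, h, List.map_append, List.sum_append, List.map_map, List.map_map]
      clear hS h
      induction S with
      | nil => simp
      | cons p S ih =>
        simp only [List.map_cons, List.sum_cons, neg_add, ih, Function.comp_apply]
        obtain ⟨W, hW⟩ := weakDeriv_linear p.2 T
        have h1 := (η.derivs p.1).lineDeriv_mul i g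
        rw [weakDeriv_add_single, hW, h1, map_add]
        simp only [Cutoff.derivs]
        ring

end TestFunctions

/-! ### Extended seminorms -/

/-- Seminorms with values in `[0, ∞]`. -/
structure IsESeminorm {V : Type*} [AddCommGroup V] [Module ℂ V] (N : V → ℝ≥0∞) : Prop where
  add_le : ∀ u v, N (u + v) ≤ N u + N v
  smul_le : ∀ (c : ℂ) u, N (c • u) ≤ ‖c‖ₑ * N u

namespace IsESeminorm

variable {V W : Type*} [AddCommGroup V] [Module ℂ V] [AddCommGroup W] [Module ℂ W]

theorem smul_eq {N : V → ℝ≥0∞} (h : IsESeminorm N) (c : ℂ) (u : V) : N (c • u) = ‖c‖ₑ * N u := by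
  refine le_antisymm (h.smul_le c u) ?_
  rcases eq_or_ne c 0 with rfl | hc
  · simp
  · have h1 := h.smul_le c⁻¹ (c • u)
    rw [inv_smul_smul₀ hc] at h1
    calc ‖c‖ₑ * N u ≤ ‖c‖ₑ * (‖c⁻¹‖ₑ * N (c • u)) := by gcongr
      _ = N (c • u) := by
        rw [← mul_assoc, ← enorm_mul, mul_inv_cancel₀ hc]; simp

theorem map_zero {N : V → ℝ≥0∞} (h : IsESeminorm N) : N 0 = 0 := by
  simpa using h.smul_eq 0 0

theorem comp {N : V → ℝ≥0∞} (h : IsESeminorm N) (A : W →ₗ[ℂ] V) :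
    IsESeminorm (fun u => N (A u)) where
  add_le u v := by simpa using h.add_le (A u) (A v)
  smul_le c u := by simpa using h.smul_le c (A u)

theorem iSup {ι : Sort*} {N : ι → V → ℝ≥0∞} (h : ∀ i, IsESeminorm (N i)) :
    IsESeminorm (fun u => ⨆ i, N i u) where
  add_le u v := iSup_le fun i => ((h i).add_le u v).trans
    (add_le_add (le_iSup (fun i => N i u) i) (le_iSup (fun i => N i v) i))
  smul_le c u := iSup_le fun i => ((h i).smul_le c u).trans
    (mul_le_mul_right (le_iSup (fun i => N i u) i) _)

theorem div_const {N : V → ℝ≥0∞} (h : IsESeminorm N) (a : ℝ≥0∞) :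
    IsESeminorm (fun u => N u / a) where
  add_le u v := by
    rw [← ENNReal.add_div]; exact ENNReal.div_le_div_right (h.add_le u v) _
  smul_le c u := by
    rw [← mul_div_assoc]; exact ENNReal.div_le_div_right (h.smul_le c u) _

end IsESeminorm

theorem rpow_half_sq (a : ℝ≥0∞) : (a ^ (1 / 2 : ℝ)) ^ 2 = a := by
  rw [← ENNReal.rpow_natCast, ← ENNReal.rpow_mul]; norm_num

theorem sq_rpow_half (a : ℝ≥0∞) : (a ^ 2) ^ (1 / 2 : ℝ) = a := by
  rw [← ENNReal.rpow_natCast, ← ENNReal.rpow_mul]; norm_num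

theorem rpow_half_le_iff {a b : ℝ≥0∞} : a ^ (1 / 2 : ℝ) ≤ b ↔ a ≤ b ^ 2 := by
  constructor
  · intro h
    calc a = (a ^ (1 / 2 : ℝ)) ^ 2 := (rpow_half_sq a).symm
      _ ≤ b ^ 2 := by gcongr
  · intro h
    calc a ^ (1 / 2 : ℝ) ≤ (b ^ 2) ^ (1 / 2 : ℝ) := by gcongr
      _ = b := sq_rpow_half b

/-- Minkowski's inequality in `L²`. -/
theorem lintegral_minkowski {X : Type*} [MeasurableSpace X] {μ : Measure X} {f g : X → ℝ≥0∞}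
    (hf : AEMeasurable f μ) (hg : AEMeasurable g μ) :
    (∫⁻ x, (f x + g x) ^ 2 ∂μ) ^ (1 / 2 : ℝ) ≤
      (∫⁻ x, f x ^ 2 ∂μ) ^ (1 / 2 : ℝ) + (∫⁻ x, g x ^ 2 ∂μ) ^ (1 / 2 : ℝ) := by
  have := ENNReal.lintegral_Lp_add_le hf hg (p := 2) (by norm_num)
  simpa using this

/-- Minkowski's inequality in `ℓ²`. -/
theorem tsum_minkowski {ι : Type*} (f g : ι → ℝ≥0∞) :
    (∑' i, (f i + g i) ^ 2) ^ (1 / 2 : ℝ) ≤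
      (∑' i, f i ^ 2) ^ (1 / 2 : ℝ) + (∑' i, g i ^ 2) ^ (1 / 2 : ℝ) := by
  let _ : MeasurableSpace ι := ⊤
  have := lintegral_minkowski (μ := Measure.count) (f := f) (g := g)
    (measurable_from_top.aemeasurable) (measurable_from_top.aemeasurable)
  simpa [lintegral_count] using this

/-- The Cauchy-Schwarz inequality in `ℓ²`. -/
theorem tsum_cauchySchwarz {ι : Type*} (f g : ι → ℝ≥0∞) :
    ∑' i, f i * g i ≤ (∑' i, f i ^ 2) ^ (1 / 2 : ℝ) * (∑' i, g i ^ 2) ^ (1 / 2 : ℝ) := by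
  let _ : MeasurableSpace ι := ⊤
  have := ENNReal.lintegral_mul_le_Lp_mul_Lq (μ := Measure.count) (f := f) (g := g)
    (p := 2) (q := 2) ⟨by norm_num, by norm_num, by norm_num⟩
    (measurable_from_top.aemeasurable) (measurable_from_top.aemeasurable)
  simpa [lintegral_count] using this

theorem IsESeminorm.l2 {V : Type*} [AddCommGroup V] [Module ℂ V] {ι : Type*}
    {N : ι → V → ℝ≥0∞} (h : ∀ i, IsESeminorm (N i)) (b : ι → ℝ≥0∞) :
    IsESeminorm (fun u => (∑' i, b i * N i u ^ 2) ^ (1 / 2 : ℝ)) where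
  add_le u v := by
    have key : ∀ u, ∑' i, b i * N i u ^ 2 = ∑' i, (b i ^ (1 / 2 : ℝ) * N i u) ^ 2 := by
      intro u; simp only [mul_pow, rpow_half_sq]
    simp only [key]
    refine le_trans ?_ (tsum_minkowski _ _)
    gcongr with i
    rw [← mul_add]
    gcongr
    exact (h i).add_le u v
  smul_le c u := by
    rw [rpow_half_le_iff, mul_pow, rpow_half_sq, ← ENNReal.tsum_mul_left]
    refine ENNReal.tsum_le_tsum fun i => ?_
    calc b i * N i (c • u) ^ 2 ≤ b i * (‖c‖ₑ * N i u) ^ 2 := by gcongr; exact (h i).smul_le c u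
      _ = _ := by ring

theorem IsESeminorm.l2_finset {V : Type*} [AddCommGroup V] [Module ℂ V] {ι : Type*}
    {N : ι → V → ℝ≥0∞} (h : ∀ i, IsESeminorm (N i)) (s : Finset ι) :
    IsESeminorm (fun u => (∑ i ∈ s, N i u ^ 2) ^ (1 / 2 : ℝ)) := by
  have := IsESeminorm.l2 (ι := s) (N := fun i => N i) (fun i => h i) (fun _ => 1)
  simp only [one_mul] at this
  convert this using 4 with u
  exact (Finset.tsum_subtype s (fun i => N i u ^ 2)).symm

/-! ### Functionals represented by functions -/

section Rep

variable {d : ℕ} {Ω Ω₁ Ω₂ : Opens (Euc d)}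

theorem LocallyIntegrableOn.integrable_test_mul {f : Euc d → ℂ}
    (hf : LocallyIntegrableOn f (Ω : Set (Euc d))) (g : 𝓓(Ω, ℝ)) :
    Integrable (fun x => ((g x : ℝ) : ℂ) * f x) := by
  have := TestFunction.integrable_bilin (𝕜 := ℝ) (ContinuousLinearMap.lsmul ℝ ℝ) hf g
  simpa using this

theorem setIntegral_test_mul (g : 𝓓(Ω, ℝ)) (f : Euc d → ℂ) :
    ∫ x in (Ω : Set (Euc d)), ((g x : ℝ) : ℂ) * f x = ∫ x, ((g x : ℝ) : ℂ) * f x := by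
  refine setIntegral_eq_integral_of_forall_compl_eq_zero fun x hx => ?_
  have : g x = 0 := image_eq_zero_of_notMem_tsupport fun h => hx (g.tsupport_subset h)
  simp [this]

namespace IsRepBy

variable {T S : 𝓓(Ω, ℝ) → ℂ} {f g : Euc d → ℂ}

/-- The fundamental lemma of the calculus of variations, applied to `f - g`. -/
theorem ae_unique (hf : IsRepBy T f) (hg : IsRepBy T g) :
    ∀ᵐ x ∂volume.restrict (Ω : Set (Euc d)), f x = g x := by
  rw [ae_restrict_iff' Ω.isOpen.measurableSet]
  have := Ω.isOpen.ae_eq_zero_of_integral_contDiff_smul_eq_zero (μ := volume) (hf.1.sub hg.1) ?_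
  · filter_upwards [this] with x hx hxΩ
    exact sub_eq_zero.1 (hx hxΩ)
  · intro h h1 h2 h3
    let h' : 𝓓(Ω, ℝ) := ⟨h, h1, h2, h3⟩
    have e1 := hf.2 h'
    rw [hg.2 h', setIntegral_test_mul, setIntegral_test_mul] at e1
    have e2 := integral_sub (LocallyIntegrableOn.integrable_test_mul hf.1 h')
      (LocallyIntegrableOn.integrable_test_mul hg.1 h')
    rw [e1, sub_self] at e2
    rw [← e2]
    refine integral_congr_ae (Eventually.of_forall fun x => ?_)
    simp [h', mul_sub]

theorem congr_ae (hf : IsRepBy T f)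
    (h : ∀ᵐ x ∂volume.restrict (Ω : Set (Euc d)), f x = g x) : IsRepBy T g := by
  refine ⟨fun x hx => ?_, fun k => ?_⟩
  · obtain ⟨s, hs, hi⟩ := hf.1 x hx
    refine ⟨s ∩ Ω, inter_mem hs self_mem_nhdsWithin, ?_⟩
    refine (hi.mono_set inter_subset_left).congr_fun_ae ?_
    exact ae_mono (Measure.restrict_mono inter_subset_right le_rfl) h
  · rw [hf.2 k]
    refine integral_congr_ae ?_
    filter_upwards [h] with x hx
    rw [hx]

theorem add (hT : IsRepBy T f) (hS : IsRepBy S g) : IsRepBy (T + S) (f + g) := by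
  refine ⟨hT.1.add hS.1, fun h => ?_⟩
  simp only [Pi.add_apply, hT.2, hS.2, setIntegral_test_mul]
  rw [← integral_add (LocallyIntegrableOn.integrable_test_mul hT.1 h)
      (LocallyIntegrableOn.integrable_test_mul hS.1 h)]
  simp only [mul_add]

theorem smul (hT : IsRepBy T f) (c : ℂ) : IsRepBy (c • T) (c • f) := by
  refine ⟨hT.1.smul c, fun h => ?_⟩
  simp only [Pi.smul_apply, smul_eq_mul, hT.2, mul_left_comm _ c]
  exact (integral_const_mul c _).symm

theorem zero : IsRepBy (0 : 𝓓(Ω, ℝ) → ℂ) 0 :=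
  ⟨locallyIntegrableOn_zero, fun h => by simp⟩

theorem pull {T : 𝓓(Ω₂, ℝ) → ℂ} (hT : IsRepBy T f) (η : Cutoff Ω₁ Ω₂) :
    IsRepBy (fun g => T (η.mul g)) (fun y => ((η.toFun y : ℝ) : ℂ) * f y) := by
  refine ⟨?_, fun h => ?_⟩
  · rw [locallyIntegrableOn_iff Ω₁.isOpen.isLocallyClosed]
    intro K hK hKc
    -- `f` is only controlled on `Ω₂`. The part of `K` inside the support of `η` is a compact subset
    -- of `Ω₂`, and on the rest of `K` the product vanishes.
    have hc : IsCompact (K ∩ tsupport η.toFun) := hKc.inter_right (isClosed_tsupport _)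
    have h1 : IntegrableOn f (K ∩ tsupport η.toFun) :=
      hT.1.integrableOn_compact_subset (fun y hy => η.supp y hy.2 (hK hy.1)) hc
    have h2 : IntegrableOn (fun y => ((η.toFun y : ℝ) : ℂ) * f y) (K ∩ tsupport η.toFun) :=
      h1.continuousOn_mul
        (Complex.continuous_ofReal.comp η.smooth.continuous).continuousOn hc
    have h3 : IntegrableOn (fun y => ((η.toFun y : ℝ) : ℂ) * f y) (K \ tsupport η.toFun) := by
      refine integrableOn_zero.congr_fun (fun y hy => ?_)
        (hKc.measurableSet.diff (isClosed_tsupport _).measurableSet)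
      simp [image_eq_zero_of_notMem_tsupport hy.2]
    have := h2.union h3
    rwa [inter_union_sdiff] at this
  · simp only [hT.2, setIntegral_test_mul]
    refine integral_congr_ae (Eventually.of_forall fun x => ?_)
    simp; ring

theorem list_sum {ι : Type*} {T : ι → 𝓓(Ω, ℝ) → ℂ} {f : ι → Euc d → ℂ} (l : List ι)
    (h : ∀ i ∈ l, IsRepBy (T i) (f i)) :
    IsRepBy (fun g => (l.map fun i => T i g).sum) (fun y => (l.map fun i => f i y).sum) := by
  induction l with
  | nil => exact zero
  | cons i l ih =>
    simp only [List.map_cons, List.sum_cons]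
    exact (h i List.mem_cons_self).add (ih fun j hj => h j (List.mem_cons_of_mem i hj))

end IsRepBy

/-- Any two representatives agree almost everywhere, so the infimum runs over a single value. -/
theorem weightedL2Sq_eq {T : 𝓓(Ω, ℝ) → ℂ} {f : Euc d → ℂ} (h : IsRepBy T f) (w : Euc d → ℝ)
    (s : ℝ) : weightedL2Sq w s T =
      ∫⁻ x in (Ω : Set (Euc d)), ‖((w x ^ s : ℝ) : ℂ) * f x‖ₑ ^ 2 := by
  refine le_antisymm (iInf₂_le f h) (le_iInf₂ fun g hg => le_of_eq ?_)
  refine lintegral_congr_ae ?_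
  filter_upwards [h.ae_unique hg] with x hx
  rw [hx]

theorem exists_rep_of_weightedL2Sq_lt_top {T : 𝓓(Ω, ℝ) → ℂ} {w : Euc d → ℝ} {s : ℝ}
    (h : weightedL2Sq w s T < ⊤) : ∃ f, IsRepBy T f := by
  simp only [weightedL2Sq, iInf_lt_iff] at h
  obtain ⟨f, hf, -⟩ := h
  exact ⟨f, hf⟩

theorem isESeminorm_weightedL2 {w : Euc d → ℝ} (hw : Measurable w) (s : ℝ) :
    IsESeminorm (fun T : 𝓓(Ω, ℝ) → ℂ => weightedL2Sq w s T ^ (1 / 2 : ℝ)) where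
  add_le T S := by
    by_cases hT : weightedL2Sq w s T < ⊤
    swap
    · rw [not_lt_top_iff] at hT; simp [hT]
    by_cases hS : weightedL2Sq w s S < ⊤
    swap
    · rw [not_lt_top_iff] at hS; simp [hS]
    obtain ⟨f, hf⟩ := exists_rep_of_weightedL2Sq_lt_top hT
    obtain ⟨g, hg⟩ := exists_rep_of_weightedL2Sq_lt_top hS
    have meas : ∀ f : Euc d → ℂ, LocallyIntegrableOn f (Ω : Set (Euc d)) →
        AEMeasurable (fun x => ‖((w x ^ s : ℝ) : ℂ) * f x‖ₑ)
          (volume.restrict (Ω : Set (Euc d))) := fun f hf =>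
      ((Complex.measurable_ofReal.comp (hw.pow_const s)).aemeasurable.mul
        hf.aestronglyMeasurable.aemeasurable).enorm
    rw [weightedL2Sq_eq (hf.add hg), weightedL2Sq_eq hf, weightedL2Sq_eq hg]
    refine le_trans ?_ (lintegral_minkowski (meas f hf.1) (meas g hg.1))
    gcongr with x
    simp only [Pi.add_apply, mul_add]
    exact enorm_add_le _ _
  smul_le c T := by
    rcases eq_or_ne c 0 with rfl | hc
    · have : weightedL2Sq w s (0 : 𝓓(Ω, ℝ) → ℂ) = 0 := by
        rw [weightedL2Sq_eq IsRepBy.zero]; simp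
      simp [this]
    by_cases hT : weightedL2Sq w s T < ⊤
    swap
    · rw [not_lt_top_iff] at hT; simp [hT, ENNReal.mul_top, hc]
    obtain ⟨f, hf⟩ := exists_rep_of_weightedL2Sq_lt_top hT
    rw [weightedL2Sq_eq (hf.smul c), weightedL2Sq_eq hf, rpow_half_le_iff, mul_pow, rpow_half_sq,
      ← lintegral_const_mul' _ _ (by simp)]
    gcongr with x
    simp only [Pi.smul_apply, smul_eq_mul, mul_left_comm _ c, enorm_mul c, mul_pow]
    exact le_rfl

/-- The multi-indices of order at most `m`. -/
def multiIndices (d m : ℕ) : Finset (Fin d → ℕ) :=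
  (Finset.range (m + 1)).biUnion fun k => Finset.piAntidiag Finset.univ k

theorem mem_multiIndices {m : ℕ} {α : Fin d → ℕ} : α ∈ multiIndices d m ↔ ∑ i, α i ≤ m := by
  simp [multiIndices]

theorem weightedSobolevSq_eq_sum (w : Euc d → ℝ) (m : ℕ) (a : ℝ) (T : 𝓓(Ω, ℝ) → ℂ) :
    weightedSobolevSq w m a T =
      ∑ α ∈ multiIndices d m, weightedL2Sq w (((∑ i, α i : ℕ) : ℝ) - a) (weakDeriv α T) := by
  rw [multiIndices, Finset.sum_biUnion]
  · refine Finset.sum_congr rfl fun k _ => Finset.sum_congr rfl fun α hα => ?_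
    rw [Finset.mem_piAntidiag] at hα
    rw [hα.1]
  · intro k _ l _ hkl
    rw [Function.onFun, Finset.disjoint_left]
    intro α h1 h2
    rw [Finset.mem_piAntidiag] at h1 h2
    exact hkl (h1.1.symm.trans h2.1)

/-- `f α` represents the weak derivative `∂^α T`, for all `|α| ≤ m`. -/
def HasWeakDerivs (m : ℕ) (T : 𝓓(Ω, ℝ) → ℂ) (f : (Fin d → ℕ) → Euc d → ℂ) : Prop :=
  ∀ α ∈ multiIndices d m, IsRepBy (weakDeriv α T) (f α)

/-- The sum of the integrals of `|w^(|α|-a) f α|²` over `A`. -/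
def energy (w : Euc d → ℝ) (m : ℕ) (a : ℝ) (A : Set (Euc d)) (f : (Fin d → ℕ) → Euc d → ℂ) :
    ℝ≥0∞ :=
  ∑ α ∈ multiIndices d m,
    ∫⁻ x in A, ‖((w x ^ (((∑ i, α i : ℕ) : ℝ) - a) : ℝ) : ℂ) * f α x‖ₑ ^ 2

theorem HasWeakDerivs.weightedSobolevSq_eq {m : ℕ} {T : 𝓓(Ω, ℝ) → ℂ}
    {f : (Fin d → ℕ) → Euc d → ℂ} (h : HasWeakDerivs m T f) (w : Euc d → ℝ) (a : ℝ) :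
    weightedSobolevSq w m a T = energy w m a Ω f := by
  rw [weightedSobolevSq_eq_sum, energy]
  exact Finset.sum_congr rfl fun α hα => weightedL2Sq_eq (h α hα) w _

theorem exists_hasWeakDerivs {w : Euc d → ℝ} {m : ℕ} {a : ℝ} {T : 𝓓(Ω, ℝ) → ℂ}
    (h : weightedSobolevSq w m a T < ⊤) : ∃ f, HasWeakDerivs m T f := by
  rw [weightedSobolevSq_eq_sum, ENNReal.sum_lt_top] at h
  choose f hf using fun α (hα : α ∈ multiIndices d m) =>
    exists_rep_of_weightedL2Sq_lt_top (h α hα)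
  classical
  exact ⟨fun α => if hα : α ∈ multiIndices d m then f α hα else 0,
    fun α hα => by simpa [hα] using hf α hα⟩

/-- The weak derivative as a complex linear map. -/
def weakDerivₗ (α : Fin d → ℕ) : (𝓓(Ω, ℝ) → ℂ) →ₗ[ℂ] (𝓓(Ω, ℝ) → ℂ) where
  toFun := weakDeriv α
  map_add' T S := by funext g; simp [weakDeriv, mul_add]
  map_smul' c T := by funext g; simp [weakDeriv, mul_left_comm]

theorem isESeminorm_weightedSobolev {w : Euc d → ℝ} (hw : Measurable w) (m : ℕ) (a : ℝ) :
    IsESeminorm (fun T : 𝓓(Ω, ℝ) → ℂ => weightedSobolevSq w m a T ^ (1 / 2 : ℝ)) := by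
  have := IsESeminorm.l2_finset (fun α : Fin d → ℕ =>
    (isESeminorm_weightedL2 (Ω := Ω) hw (((∑ i, α i : ℕ) : ℝ) - a)).comp (weakDerivₗ α))
    (multiIndices d m)
  simp only [rpow_half_sq] at this
  simp only [weightedSobolevSq_eq_sum]
  exact this

theorem isESeminorm_kondNorm {w : Euc d → ℝ} (hw : Measurable w) (m : ℤ) (a : ℝ) :
    IsESeminorm (fun T : 𝓓(Ω, ℝ) → ℂ => kondNorm w m a T) := by
  cases m with
  | ofNat n => exact isESeminorm_weightedSobolev hw n a
  | negSucc n =>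
    refine IsESeminorm.iSup fun f => IsESeminorm.div_const ?_ _
    have h : ∀ (c : ℂ) (T : 𝓓(Ω, ℝ) → ℂ), complexEval (c • T) f = c * complexEval T f := by
      intro c T; simp [complexEval]; ring
    have h' : ∀ (S T : 𝓓(Ω, ℝ) → ℂ), complexEval (S + T) f = complexEval S f + complexEval T f := by
      intro S T; simp [complexEval]; ring
    refine ⟨fun S T => ?_, fun c T => ?_⟩
    · simp only [h']; exact enorm_add_le _ _
    · simp only [h, enorm_mul]; exact le_rfl

end Rep

/-! ### Test functions as distributions -/

section OfTest

variable {d : ℕ} {Ω Ω₁ Ω₂ : Opens (Euc d)}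

/-- The classical derivative `∂^α f` of a complex test function. -/
def multiDeriv (α : Fin d → ℕ) (f : 𝓓(Ω, ℂ)) : 𝓓(Ω, ℂ) :=
  (List.finRange d).foldr
    (fun i h => (fun k : 𝓓(Ω, ℂ) => ∂_{(EuclideanSpace.single i (1 : ℝ) : Euc d)} k)^[α i] h) f

theorem multiDeriv_zero (f : 𝓓(Ω, ℂ)) : multiDeriv 0 f = f := by
  unfold multiDeriv
  induction List.finRange d with
  | nil => rfl
  | cons i l ih => simp only [List.foldr_cons, ih]; rfl

theorem multiDeriv_add_single (α : Fin d → ℕ) (i : Fin d) (f : 𝓓(Ω, ℂ)) :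
    multiDeriv (α + Pi.single i 1) f = multiDeriv α (∂_{stdVec i} f : 𝓓(Ω, ℂ)) := by
  have := foldr_iterate_add_single
    (fun (i : Fin d) (k : 𝓓(Ω, ℂ)) => (∂_{stdVec i} k : 𝓓(Ω, ℂ)))
    (fun i j g => lineDeriv_comm _ _ g) α i (List.finRange d) (List.nodup_finRange d) f
  simpa [multiDeriv] using this

theorem multiDeriv_lineDeriv (α : Fin d → ℕ) (i : Fin d) (f : 𝓓(Ω, ℂ)) :
    multiDeriv α (∂_{stdVec i} f : 𝓓(Ω, ℂ)) = ∂_{stdVec i} (multiDeriv α f) := by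
  induction α using multiIndex_induction generalizing f with
  | zero => simp only [multiDeriv_zero]
  | step α j ih => simp only [multiDeriv_add_single, lineDeriv_comm (stdVec j), ih]

theorem isRepBy_ofTest (f : 𝓓(Ω, ℂ)) : IsRepBy (ofTest f) f :=
  ⟨(f.continuous.locallyIntegrable).locallyIntegrableOn _, fun _ => rfl⟩

theorem ofTest_lineDeriv (i : Fin d) (f : 𝓓(Ω, ℂ)) (g : 𝓓(Ω, ℝ)) :
    ofTest (∂_{stdVec i} f : 𝓓(Ω, ℂ)) g = - ofTest f (∂_{stdVec i} g : 𝓓(Ω, ℝ)) := by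
  have hd : ∀ x, fderiv ℝ (fun x => ((g x : ℝ) : ℂ)) x (stdVec i) =
      ((fderiv ℝ g x (stdVec i) : ℝ) : ℂ) := by
    intro x
    have h1 := (Complex.ofRealCLM.hasFDerivAt (x := g x)).comp x (g.differentiable' x).hasFDerivAt
    have h2 : fderiv ℝ (fun x => ((g x : ℝ) : ℂ)) x = Complex.ofRealCLM.comp (fderiv ℝ g x) :=
      h1.fderiv
    rw [h2]; rfl
  have i1 : Integrable (fun x => ((g x : ℝ) : ℂ) * fderiv ℝ f x (stdVec i)) := by
    have := LocallyIntegrableOn.integrable_test_mul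
      (isRepBy_ofTest (∂_{stdVec i} f : 𝓓(Ω, ℂ))).1 g
    simpa [coe_lineDeriv] using this
  have i2 : Integrable (fun x => fderiv ℝ (fun x => ((g x : ℝ) : ℂ)) x (stdVec i) * f x) := by
    have := LocallyIntegrableOn.integrable_test_mul (isRepBy_ofTest f).1 (∂_{stdVec i} g : 𝓓(Ω, ℝ))
    simpa only [hd, coe_lineDeriv] using this
  have key := integral_mul_fderiv_eq_neg_fderiv_mul_of_integrable (μ := volume)
    (f := fun x => ((g x : ℝ) : ℂ)) (g := f) (v := stdVec i) i2 i1
    (LocallyIntegrableOn.integrable_test_mul (isRepBy_ofTest f).1 g)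
    (fun x _ => (Complex.ofRealCLM.differentiableAt).comp x (g.differentiable' x))
    (fun x _ => f.differentiable' x)
  simp only [hd] at key
  rw [ofTest, ofTest, setIntegral_test_mul, setIntegral_test_mul]
  simpa only [coe_lineDeriv] using key

theorem weakDeriv_ofTest (α : Fin d → ℕ) (f : 𝓓(Ω, ℂ)) :
    weakDeriv α (ofTest f) = ofTest (multiDeriv α f) := by
  induction α using multiIndex_induction with
  | zero => rw [weakDeriv_zero, multiDeriv_zero]
  | step α i ih =>
    funext g
    rw [weakDeriv_add_single, ih, multiDeriv_add_single, multiDeriv_lineDeriv, ofTest_lineDeriv]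

theorem hasWeakDerivs_ofTest (m : ℕ) (f : 𝓓(Ω, ℂ)) :
    HasWeakDerivs m (ofTest f) (fun α => multiDeriv α f) := by
  intro α _
  rw [weakDeriv_ofTest]
  exact isRepBy_ofTest _

theorem exists_distribution_isRepBy (Ω : Opens (Euc d)) {f : Euc d → ℂ}
    (hf : LocallyIntegrableOn f (Ω : Set (Euc d))) :
    ∃ u : 𝓓'(Ω, ℂ), IsRepBy u f := by
  refine ⟨TestFunction.integralAgainstBilinCLM (𝕜 := ℝ) (ContinuousLinearMap.lsmul ℝ ℝ) volume f,
    hf, fun g => ?_⟩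
  refine (TestFunction.integralAgainstBilinCLM_eq_integral hf).trans ?_
  rw [setIntegral_test_mul]
  simp

/-- A complex test function, viewed as an element of the space of distributions. -/
def ofTestDistr (f : 𝓓(Ω, ℂ)) : 𝓓'(Ω, ℂ) :=
  (exists_distribution_isRepBy Ω (isRepBy_ofTest f).1).choose

theorem coe_ofTestDistr (f : 𝓓(Ω, ℂ)) : (ofTestDistr f : 𝓓(Ω, ℝ) → ℂ) = ofTest f := by
  funext g
  have := (exists_distribution_isRepBy Ω (isRepBy_ofTest f).1).choose_spec.2 g
  exact this

/-- A distribution as a linear map. -/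
def Distribution.toLin (u : 𝓓'(Ω, ℂ)) : 𝓓(Ω, ℝ) →ₗ[ℝ] ℂ where
  toFun := u
  map_add' f g := map_add u f g
  map_smul' c g := map_smul u c g

@[simp] theorem Distribution.coe_toLin (u : 𝓓'(Ω, ℂ)) : (Distribution.toLin u : 𝓓(Ω, ℝ) → ℂ) = u :=
  rfl

/-- A complex test function, viewed as a linear functional. -/
def ofTestLin (f : 𝓓(Ω, ℂ)) : 𝓓(Ω, ℝ) →ₗ[ℝ] ℂ := Distribution.toLin (ofTestDistr f)

@[simp] theorem coe_ofTestLin (f : 𝓓(Ω, ℂ)) : (ofTestLin f : 𝓓(Ω, ℝ) → ℂ) = ofTest f :=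
  coe_ofTestDistr f

theorem ofTest_add (f g : 𝓓(Ω, ℂ)) : ofTest (f + g) = ofTest f + ofTest g := by
  funext h
  have := ((isRepBy_ofTest f).add (isRepBy_ofTest g)).2 h
  rw [this]; rfl

theorem ofTest_smul (c : ℂ) (f : 𝓓(Ω, ℂ)) : ofTest (c • f) = c • ofTest f := by
  funext h
  have := ((isRepBy_ofTest f).smul c).2 h
  rw [this]; rfl

/-- `ofTest` as a linear map. -/
def ofTestₗ : 𝓓(Ω, ℂ) →ₗ[ℂ] (𝓓(Ω, ℝ) → ℂ) where
  toFun := ofTest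
  map_add' := ofTest_add
  map_smul' := ofTest_smul

/-- Multiplication by a real function is symmetric for the pairing `∫ f g`. Two cut-offs with the
same function are needed, as functionals are carried in the direction opposite to test functions. -/
theorem Cutoff.pull_ofTest (η : Cutoff Ω₁ Ω₂) (η' : Cutoff Ω₂ Ω₁) (h : η.toFun = η'.toFun)
    (f : 𝓓(Ω₂, ℂ)) : η.pull (ofTestLin f) = ofTestLin (η'.mul f) := by
  ext g
  rw [Cutoff.pull_apply, coe_ofTestLin, coe_ofTestLin, ofTest, ofTest, setIntegral_test_mul,
    setIntegral_test_mul]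
  refine integral_congr_ae (Eventually.of_forall fun x => ?_)
  simp [h]; ring

section complexEval

variable (T : 𝓓(Ω, ℝ) →ₗ[ℝ] ℂ)

theorem complexEval_add (f g : 𝓓(Ω, ℂ)) :
    complexEval T (f + g) = complexEval T f + complexEval T g := by
  simp only [complexEval, map_add]; ring

theorem complexEval_smul (c : ℂ) (f : 𝓓(Ω, ℂ)) : complexEval T (c • f) = c * complexEval T f := by
  have h1 : TestFunction.postcompCLM (𝕜 := ℝ) Complex.reCLM (c • f) =
      c.re • TestFunction.postcompCLM (𝕜 := ℝ) Complex.reCLM f -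
        c.im • TestFunction.postcompCLM (𝕜 := ℝ) Complex.imCLM f := by
    ext x; exact Complex.mul_re c (f x)
  have h2 : TestFunction.postcompCLM (𝕜 := ℝ) Complex.imCLM (c • f) =
      c.re • TestFunction.postcompCLM (𝕜 := ℝ) Complex.imCLM f +
        c.im • TestFunction.postcompCLM (𝕜 := ℝ) Complex.reCLM f := by
    ext x; exact Complex.mul_im c (f x)
  simp only [complexEval, h1, h2, map_add, map_sub, map_smul, Complex.real_smul]
  conv_rhs => rw [← Complex.re_add_im c]
  ring_nf
  simp; ring

/-- `complexEval` as a linear map. -/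
def complexEvalₗ : 𝓓(Ω, ℂ) →ₗ[ℂ] ℂ where
  toFun := complexEval T
  map_add' := complexEval_add T
  map_smul' := complexEval_smul T

@[simp] theorem complexEvalₗ_apply (f : 𝓓(Ω, ℂ)) : complexEvalₗ T f = complexEval T f := rfl

theorem complexEval_ofReal (g : 𝓓(Ω, ℝ)) :
    complexEval T (TestFunction.postcompCLM (𝕜 := ℝ) Complex.ofRealCLM g) = T g := by
  have e1 : TestFunction.postcompCLM (𝕜 := ℝ) Complex.reCLM
      (TestFunction.postcompCLM (𝕜 := ℝ) Complex.ofRealCLM g) = g := by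
    ext x; simp
  have e2 : TestFunction.postcompCLM (𝕜 := ℝ) Complex.imCLM
      (TestFunction.postcompCLM (𝕜 := ℝ) Complex.ofRealCLM g) = 0 := by
    ext x; simp
  simp [complexEval, e1, e2]

theorem complexEval_pull (T : 𝓓(Ω₂, ℝ) →ₗ[ℝ] ℂ) (η : Cutoff Ω₁ Ω₂) (f : 𝓓(Ω₁, ℂ)) :
    complexEval (η.pull T) f = complexEval T (η.mul f) := by
  have h1 : TestFunction.postcompCLM (𝕜 := ℝ) Complex.reCLM (η.mul f) =
      η.mul (TestFunction.postcompCLM (𝕜 := ℝ) Complex.reCLM f) := by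
    ext x
    simp
  have h2 : TestFunction.postcompCLM (𝕜 := ℝ) Complex.imCLM (η.mul f) =
      η.mul (TestFunction.postcompCLM (𝕜 := ℝ) Complex.imCLM f) := by
    ext x
    simp
  simp only [complexEval, h1, h2, Cutoff.pull_apply]

end complexEval

/-- On the compact support of the test function the weight is continuous and bounded away from zero,
so each integrand is bounded with support of finite measure. -/
theorem weightedSobolevSq_ofTest_lt_top {w : Euc d → ℝ} (hw : Continuous w)
    (hpos : ∀ x ∈ Ω, 0 < w x) (m : ℕ) (a : ℝ) (f : 𝓓(Ω, ℂ)) :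
    weightedSobolevSq w m a (ofTest f) < ⊤ := by
  rw [(hasWeakDerivs_ofTest m f).weightedSobolevSq_eq, energy, ENNReal.sum_lt_top]
  intro α _
  generalize (((∑ i, α i : ℕ) : ℝ) - a) = s
  set g := multiDeriv α f
  have hK : IsCompact (tsupport g) := g.hasCompactSupport
  have hc : ContinuousOn (fun x => ((w x ^ s : ℝ) : ℂ) * g x) (tsupport g) := by
    refine ContinuousOn.mul ?_ g.continuous.continuousOn
    exact Complex.continuous_ofReal.comp_continuousOn (hw.continuousOn.rpow_const
      fun x hx => Or.inl (hpos x (g.tsupport_subset hx)).ne')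
  obtain ⟨C, hC⟩ := hK.exists_bound_of_continuousOn hc
  calc _ ≤ ∫⁻ x in (Ω : Set (Euc d)), (tsupport g).indicator (fun _ => ENNReal.ofReal C ^ 2) x := by
        refine lintegral_mono fun x => ?_
        by_cases hx : x ∈ tsupport g
        · simp only [indicator_of_mem hx]
          gcongr
          rw [← ofReal_norm]
          exact ENNReal.ofReal_le_ofReal (hC x hx)
        · simp [image_eq_zero_of_notMem_tsupport hx]
    _ ≤ ∫⁻ x, (tsupport g).indicator (fun _ => ENNReal.ofReal C ^ 2) x :=
        setLIntegral_le_lintegral _ _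
    _ = ENNReal.ofReal C ^ 2 * volume (tsupport g) := by
        rw [lintegral_indicator hK.measurableSet, setLIntegral_const]
    _ < ⊤ := ENNReal.mul_lt_top (by simp) hK.measure_lt_top

theorem eq_zero_of_weightedL2Sq_eq_zero {w : Euc d → ℝ} (hw : Measurable w)
    (hpos : ∀ x ∈ Ω, 0 < w x) {s : ℝ} {T : 𝓓(Ω, ℝ) → ℂ} (h : weightedL2Sq w s T = 0) : T = 0 := by
  obtain ⟨f, hf⟩ := exists_rep_of_weightedL2Sq_lt_top (h.trans_lt ENNReal.zero_lt_top)
  rw [weightedL2Sq_eq hf, lintegral_eq_zero_iff'] at h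
  · have h0 : ∀ᵐ x ∂volume.restrict (Ω : Set (Euc d)), f x = 0 := by
      filter_upwards [h, ae_restrict_mem Ω.isOpen.measurableSet] with x hx hxΩ
      have := (Real.rpow_pos_of_pos (hpos x hxΩ) s).ne'
      simpa [this] using hx
    funext g
    rw [hf.2 g]
    refine integral_eq_zero_of_ae ?_
    filter_upwards [h0] with x hx
    simp [hx]
  · exact (((Complex.measurable_ofReal.comp (hw.pow_const s)).aemeasurable.mul
      hf.1.aestronglyMeasurable.aemeasurable).enorm).pow_const 2

theorem eq_zero_of_weightedSobolevSq_eq_zero {w : Euc d → ℝ} (hw : Measurable w)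
    (hpos : ∀ x ∈ Ω, 0 < w x) {m : ℕ} {a : ℝ} {T : 𝓓(Ω, ℝ) → ℂ}
    (h : weightedSobolevSq w m a T = 0) : T = 0 := by
  rw [weightedSobolevSq_eq_sum, Finset.sum_eq_zero_iff] at h
  have := h 0 (mem_multiIndices.2 (by simp))
  rw [weakDeriv_zero] at this
  exact eq_zero_of_weightedL2Sq_eq_zero hw hpos this

theorem ofTest_injective : Function.Injective (ofTest : 𝓓(Ω, ℂ) → 𝓓(Ω, ℝ) → ℂ) := by
  have key : ∀ f : 𝓓(Ω, ℂ), ofTest f = 0 → f = 0 := by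
    intro f hf
    have h1 := (isRepBy_ofTest f).ae_unique (hf ▸ IsRepBy.zero)
    rw [ae_restrict_iff' Ω.isOpen.measurableSet] at h1
    have h2 : (f : Euc d → ℂ) =ᵐ[volume] fun _ => 0 := by
      filter_upwards [h1] with x hx
      by_cases hxΩ : x ∈ (Ω : Set (Euc d))
      · exact hx hxΩ
      · exact image_eq_zero_of_notMem_tsupport fun h => hxΩ (f.tsupport_subset h)
    have := (Continuous.ae_eq_iff_eq volume f.continuous continuous_const).1 h2
    ext x; exact congrFun this x
  intro f g hfg
  refine sub_eq_zero.1 (key _ ?_)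
  have h := map_sub (ofTestₗ (Ω := Ω)) f g
  have : ofTest f - ofTest g = 0 := sub_eq_zero.2 hfg
  exact h.trans this

/-- Duality estimate for the norms of negative order. -/
theorem enorm_complexEval_le {w : Euc d → ℝ} (hw : Continuous w) (hpos : ∀ x ∈ Ω, 0 < w x)
    (n : ℕ) (a : ℝ) (T : 𝓓(Ω, ℝ) →ₗ[ℝ] ℂ) (f : 𝓓(Ω, ℂ)) :
    ‖complexEval T f‖ₑ ≤ kondNorm w (Int.negSucc n) a T *
      weightedSobolevSq w (n + 1) (-a) (ofTest f) ^ (1 / 2 : ℝ) := by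
  have hlt := weightedSobolevSq_ofTest_lt_top hw hpos (n + 1) (-a) f
  by_cases h0 : weightedSobolevSq w (n + 1) (-a) (ofTest f) = 0
  -- A vanishing denominator forces `f = 0`, so the quotient convention does no harm.
  · have h1 : ofTest f = ofTest 0 := by
      rw [eq_zero_of_weightedSobolevSq_eq_zero hw.measurable hpos h0]
      exact (map_zero ofTestₗ).symm
    have h2 : complexEval T (0 : 𝓓(Ω, ℂ)) = 0 := map_zero (complexEvalₗ T)
    rw [ofTest_injective h1, h2]
    simp
  · have h1 : weightedSobolevSq w (n + 1) (-a) (ofTest f) ^ (1 / 2 : ℝ) ≠ 0 := by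
      simp [h0]
    have h2 : weightedSobolevSq w (n + 1) (-a) (ofTest f) ^ (1 / 2 : ℝ) ≠ ⊤ := by
      simp [hlt.ne]
    rw [← ENNReal.div_le_iff h1 h2]
    exact le_iSup (fun f : 𝓓(Ω, ℂ) => ‖complexEval T f‖ₑ /
      weightedSobolevSq w (n + 1) (-a) (ofTest f) ^ (1 / 2 : ℝ)) f

theorem eq_zero_of_kondNorm_eq_zero {w : Euc d → ℝ} (hw : Continuous w) (hpos : ∀ x ∈ Ω, 0 < w x)
    {m : ℤ} {a : ℝ} {T : 𝓓(Ω, ℝ) →ₗ[ℝ] ℂ} (h : kondNorm w m a T = 0) : T = 0 := by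
  cases m with
  | ofNat n =>
    have : weightedSobolevSq w n a T = 0 := by
      rw [← rpow_half_sq (weightedSobolevSq w n a T)]
      exact (congrArg (· ^ 2) h).trans (by simp)
    exact DFunLike.coe_injective (eq_zero_of_weightedSobolevSq_eq_zero hw.measurable hpos this)
  | negSucc n =>
    ext g
    have h1 := enorm_complexEval_le hw hpos n a T
      (TestFunction.postcompCLM (𝕜 := ℝ) Complex.ofRealCLM g)
    rw [h, zero_mul, nonpos_iff_eq_zero, enorm_eq_zero] at h1
    rwa [complexEval_ofReal] at h1

end OfTest

/-! ### Dilations -/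

section Dilation

variable {d : ℕ} {M : Opens (Euc d)} {F : Type*} [NormedAddCommGroup F] [NormedSpace ℝ F]

/-- `M` is invariant under the dilations with center `c`. -/
def DilationInvariant (c : Euc d) (M : Opens (Euc d)) : Prop :=
  ∀ p ∈ M, ∀ t : ℝ, 0 < t → c + t • (p - c) ∈ M

/-- The test function `y ↦ g (c + r⁻¹ (y - c))`. -/
def dilTest {c : Euc d} (hM : DilationInvariant c M) {r : ℝ} (hr : 0 < r) :
    𝓓(M, F) →ₗ[ℝ] 𝓓(M, F) where
  toFun g :=
    { toFun := fun y => g (c + r⁻¹ • (y - c))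
      contDiff' := g.contDiff.comp (by fun_prop)
      hasCompactSupport' := by
        have e : Euc d ≃ₜ Euc d :=
          (Homeomorph.subRight c).trans ((Homeomorph.smulOfNeZero r⁻¹ (inv_pos.2 hr).ne').trans
            (Homeomorph.addLeft c))
        exact g.hasCompactSupport.comp_homeomorph ((Homeomorph.subRight c).trans
          ((Homeomorph.smulOfNeZero r⁻¹ (inv_pos.2 hr).ne').trans (Homeomorph.addLeft c)))
      tsupport_subset' := by
        intro y hy
        have h1 : c + r⁻¹ • (y - c) ∈ tsupport g :=
          tsupport_comp_subset_preimage g (f := fun y => c + r⁻¹ • (y - c)) (by fun_prop) hy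
        have h2 := hM _ (g.tsupport_subset h1) r hr
        rwa [add_sub_cancel_left, smul_inv_smul₀ hr.ne', add_sub_cancel] at h2 }
  map_add' f g := rfl
  map_smul' t g := rfl

variable {c : Euc d} (hM : DilationInvariant c M) {r : ℝ} (hr : 0 < r)

theorem dilTest_apply (g : 𝓓(M, F)) (y : Euc d) :
    dilTest hM hr g y = g (c + r⁻¹ • (y - c)) := rfl

theorem dilTest_dilTest_inv (g : 𝓓(M, F)) :
    dilTest hM hr (dilTest hM (inv_pos.2 hr) g) = g := by
  ext y
  rw [dilTest_apply, dilTest_apply, inv_inv, add_sub_cancel_left, smul_inv_smul₀ hr.ne',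
    add_sub_cancel]

theorem lineDeriv_dilTest (v : Euc d) (g : 𝓓(M, F)) :
    (∂_{v} (dilTest hM hr g) : 𝓓(M, F)) = r⁻¹ • dilTest hM hr (∂_{v} g : 𝓓(M, F)) := by
  ext y
  have h1 : HasFDerivAt (fun y : Euc d => c + r⁻¹ • (y - c))
      (r⁻¹ • ContinuousLinearMap.id ℝ (Euc d)) y :=
    (((hasFDerivAt_id y).sub_const c).const_smul r⁻¹).const_add c
  have h2 : HasFDerivAt (fun y => g (c + r⁻¹ • (y - c))) _ y :=
    HasFDerivAt.comp (g := g) y (g.differentiable' (c + r⁻¹ • (y - c))).hasFDerivAt h1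
  have h3 : HasFDerivAt (dilTest hM hr g) _ y := h2
  simp only [coe_lineDeriv, h3.fderiv]
  change _ = r⁻¹ • (∂_{v} g : 𝓓(M, F)) (c + r⁻¹ • (y - c))
  rw [coe_lineDeriv]
  simp

theorem testDeriv_dilTest (α : Fin d → ℕ) (g : 𝓓(M, ℝ)) :
    testDeriv α (dilTest hM hr g) = (r ^ (∑ i, α i))⁻¹ • dilTest hM hr (testDeriv α g) := by
  induction α using multiIndex_induction generalizing g with
  | zero => simp [testDeriv_zero]
  | step α i ih =>
    rw [testDeriv_add_single, testDeriv_add_single, lineDeriv_dilTest, testDeriv_smul, ih,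
      smul_smul, sum_add_single, pow_succ, mul_inv_rev]

/-- The functional `T ∘ α`, where `α y = c + r (y - c)`. -/
def dilate (T : 𝓓(M, ℝ) → ℂ) : 𝓓(M, ℝ) → ℂ :=
  fun g => (((r ^ d)⁻¹ : ℝ) : ℂ) * T (dilTest hM hr g)

theorem dilate_inv_dilate (T : 𝓓(M, ℝ) → ℂ) : dilate hM (inv_pos.2 hr) (dilate hM hr T) = T := by
  funext g
  have h : ((r⁻¹ ^ d)⁻¹ : ℝ) * (r ^ d)⁻¹ = 1 := by
    rw [inv_pow, inv_inv, mul_inv_cancel₀ (pow_pos hr d).ne']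
  simp only [dilate, dilTest_dilTest_inv, ← mul_assoc, ← Complex.ofReal_mul, h]
  simp

theorem weakDeriv_dilate (T : 𝓓(M, ℝ) →ₗ[ℝ] ℂ) (α : Fin d → ℕ) :
    weakDeriv α (dilate hM hr T) =
      ((r ^ (∑ i, α i) : ℝ) : ℂ) • dilate hM hr (weakDeriv α T) := by
  funext g
  have h : ((r ^ (∑ i, α i) : ℝ) : ℂ) ≠ 0 := by
    exact_mod_cast (pow_pos hr _).ne'
  simp only [weakDeriv, dilate, Pi.smul_apply, smul_eq_mul, testDeriv_dilTest, map_smul,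
    Complex.real_smul, Complex.ofReal_inv]
  field_simp

theorem integral_comp_dilation {c : Euc d} {r : ℝ} (hr : 0 < r) (f : Euc d → ℂ) :
    ∫ y, f (c + r • (y - c)) = (((r ^ d)⁻¹ : ℝ) : ℂ) * ∫ y, f y := by
  rw [integral_sub_right_eq_self (fun y => f (c + r • y)) c,
    Measure.integral_comp_smul volume (fun y => f (c + y)) r, integral_add_left_eq_self f c,
    finrank_euclideanSpace_fin, abs_of_pos (inv_pos.2 (pow_pos hr d)), Complex.real_smul]

theorem lintegral_comp_dilation {c : Euc d} {r : ℝ} (hr : 0 < r) (f : Euc d → ℝ≥0∞) :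
    ∫⁻ y, f (c + r • (y - c)) = ENNReal.ofReal ((r ^ d)⁻¹) * ∫⁻ y, f y := by
  rw [lintegral_sub_right_eq_self (fun y => f (c + r • y)) c]
  have h1 := (Homeomorph.smulOfNeZero r hr.ne').measurableEmbedding.lintegral_map
    (μ := (volume : Measure (Euc d))) (fun y => f (c + y))
  have h2 := Measure.map_addHaar_smul (volume : Measure (Euc d)) hr.ne'
  have h3 : (⇑(Homeomorph.smulOfNeZero r hr.ne') : Euc d → Euc d) = (r • ·) := rfl
  rw [h3] at h1
  rw [← h1, h2, lintegral_smul_measure, lintegral_add_left_eq_self f c, finrank_euclideanSpace_fin,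
    abs_of_pos (inv_pos.2 (pow_pos hr d)), smul_eq_mul]

theorem isRepBy_dilate {T : 𝓓(M, ℝ) → ℂ} {f : Euc d → ℂ} (h : IsRepBy T f) :
    IsRepBy (dilate hM hr T) (fun y => f (c + r • (y - c))) := by
  have hmem : ∀ y, y ∈ M → c + r • (y - c) ∈ M := fun y hy => hM y hy r hr
  refine ⟨?_, fun g => ?_⟩
  · rw [locallyIntegrableOn_iff M.isOpen.isLocallyClosed]
    intro K hK hKc
    set A : Euc d ≃ₜ Euc d := (Homeomorph.subRight c).trans
      ((Homeomorph.smulOfNeZero r hr.ne').trans (Homeomorph.addLeft c)) with hA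
    have hAapp : ∀ y, A y = c + r • (y - c) := fun y => rfl
    have hc : IsCompact (A '' K) := hKc.image A.continuous
    have h1 : IntegrableOn f (A '' K) := h.1.integrableOn_compact_subset (by
      rintro _ ⟨y, hy, rfl⟩
      exact hmem y (hK hy)) hc
    have h2 : Measure.map A volume = ENNReal.ofReal ((r ^ d)⁻¹) • volume := by
      ext s hs
      have := lintegral_comp_dilation (c := c) hr (s.indicator 1)
      rw [lintegral_indicator_one hs] at this
      rw [Measure.map_apply A.continuous.measurable hs, Measure.smul_apply, smul_eq_mul, ← this,
        ← lintegral_indicator_one (A.continuous.measurable hs)]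
      rfl
    have h3 : IntegrableOn f (A '' K) (Measure.map A volume) := by
      rw [h2, IntegrableOn, Measure.restrict_smul]
      exact Integrable.smul_measure h1 (by simp)
    rw [A.measurableEmbedding.integrableOn_map_iff, A.injective.preimage_image] at h3
    exact h3
  · rw [dilate, h.2, setIntegral_test_mul, setIntegral_test_mul, ← integral_comp_dilation (c := c) hr]
    refine integral_congr_ae (Eventually.of_forall fun y => ?_)
    simp only [dilTest_apply, add_sub_cancel_left, inv_smul_smul₀ hr.ne', add_sub_cancel]

theorem weightedL2Sq_eq_top {Ω : Opens (Euc d)} {T : 𝓓(Ω, ℝ) → ℂ} (h : ¬ ∃ f, IsRepBy T f)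
    (w : Euc d → ℝ) (s : ℝ) : weightedL2Sq w s T = ⊤ := by
  by_contra h1
  exact h (exists_rep_of_weightedL2Sq_lt_top (lt_top_iff_ne_top.2 h1))

/-- The exponent `t` is arbitrary because powers of the weight one are one. -/
theorem weightedL2Sq_const {Ω : Opens (Euc d)} {r : ℝ} (hr : 0 < r) (s t : ℝ)
    (T : 𝓓(Ω, ℝ) → ℂ) :
    weightedL2Sq (fun _ => r) s T = ENNReal.ofReal (r ^ (2 * s)) * weightedL2Sq (fun _ => 1) t T := by
  by_cases h : ∃ f, IsRepBy T f
  · obtain ⟨f, hf⟩ := h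
    rw [weightedL2Sq_eq hf, weightedL2Sq_eq hf, ← lintegral_const_mul' _ _ (by simp)]
    refine lintegral_congr fun x => ?_
    have : ‖((r ^ s : ℝ) : ℂ)‖ₑ ^ 2 = ENNReal.ofReal (r ^ (2 * s)) := by
      rw [← ofReal_norm, Complex.norm_real, Real.norm_of_nonneg (Real.rpow_nonneg hr.le s),
        ← ENNReal.ofReal_pow (Real.rpow_nonneg hr.le s), mul_comm 2 s, Real.rpow_mul hr.le]
      simp
    rw [enorm_mul, mul_pow, this]
    simp
  · rw [weightedL2Sq_eq_top h, weightedL2Sq_eq_top h, ENNReal.mul_top]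
    simpa using Real.rpow_pos_of_pos hr _

theorem weightedL2Sq_dilate (s : ℝ) (T : 𝓓(M, ℝ) → ℂ) :
    weightedL2Sq (fun _ => 1) s (dilate hM hr T) =
      ENNReal.ofReal ((r ^ d)⁻¹) * weightedL2Sq (fun _ => 1) s T := by
  by_cases h : ∃ f, IsRepBy T f
  · obtain ⟨f, hf⟩ := h
    rw [weightedL2Sq_eq hf, weightedL2Sq_eq (isRepBy_dilate hM hr hf)]
    simp only [Real.one_rpow, Complex.ofReal_one, one_mul]
    rw [← lintegral_indicator M.isOpen.measurableSet, ← lintegral_indicator M.isOpen.measurableSet,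
      ← lintegral_comp_dilation (c := c) hr]
    refine lintegral_congr fun y => ?_
    have hiff : y ∈ (M : Set (Euc d)) ↔ c + r • (y - c) ∈ (M : Set (Euc d)) := by
      refine ⟨fun hy => hM y hy r hr, fun hy => ?_⟩
      have := hM _ hy r⁻¹ (inv_pos.2 hr)
      rwa [add_sub_cancel_left, inv_smul_smul₀ hr.ne', add_sub_cancel] at this
    by_cases hy : y ∈ (M : Set (Euc d))
    · rw [indicator_of_mem hy, indicator_of_mem (hiff.1 hy)]
    · rw [indicator_of_notMem hy, indicator_of_notMem (fun h => hy (hiff.2 h))]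
  -- If `T` is not a function, neither is its dilation, as the inverse dilation would recover a
  -- representative of `T`; both sides are infinite.
  · have h' : ¬ ∃ f, IsRepBy (dilate hM hr T) f := by
      rintro ⟨f, hf⟩
      have := isRepBy_dilate hM (inv_pos.2 hr) hf
      rw [dilate_inv_dilate] at this
      exact h ⟨_, this⟩
    rw [weightedL2Sq_eq_top h, weightedL2Sq_eq_top h', ENNReal.mul_top]
    simpa using pow_pos hr d

/-- The chain rule contributes `r^(2|α|)` and the change of variables `r^(-d)`; with the prefactor
`r^(d-2a)` this gives `r^(2(|α|-a))`, the square of the constant weight in the term of order `|α|`.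
-/
theorem weightedSobolevSq_dilate (T : 𝓓(M, ℝ) →ₗ[ℝ] ℂ) (n : ℕ) (a : ℝ) :
    ENNReal.ofReal (r ^ ((d : ℝ) - 2 * a)) *
      weightedSobolevSq (fun _ => 1) n 0 (dilate hM hr T) =
      weightedSobolevSq (fun _ => r) n a T := by
  rw [weightedSobolevSq_eq_sum, weightedSobolevSq_eq_sum, Finset.mul_sum]
  refine Finset.sum_congr rfl fun α _ => ?_
  have hsmul := (isESeminorm_weightedL2 (Ω := M) (w := fun _ => 1) measurable_const
    (((∑ i, α i : ℕ) : ℝ) - 0)).smul_eq ((r ^ (∑ i, α i) : ℝ) : ℂ) (dilate hM hr (weakDeriv α T))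
  have hsmul2 := congrArg (· ^ 2) hsmul
  simp only [mul_pow, rpow_half_sq] at hsmul2
  have e1 : ‖((r ^ (∑ i, α i) : ℝ) : ℂ)‖ₑ ^ 2 = ENNReal.ofReal ((r ^ (∑ i, α i)) ^ 2) := by
    rw [← ofReal_norm, Complex.norm_real, Real.norm_of_nonneg (by positivity),
      ← ENNReal.ofReal_pow (by positivity)]
  rw [weakDeriv_dilate, hsmul2, weightedL2Sq_dilate, e1, ← mul_assoc, ← mul_assoc,
    ← ENNReal.ofReal_mul (by positivity), ← ENNReal.ofReal_mul (by positivity),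
    weightedL2Sq_const hr _ (((∑ i, α i : ℕ) : ℝ) - 0)]
  congr 2
  rw [← Real.rpow_natCast r d, ← Real.rpow_natCast r, ← Real.rpow_natCast _ 2, ← Real.rpow_mul hr.le,
    ← Real.rpow_neg hr.le, ← Real.rpow_add hr, ← Real.rpow_add hr]
  congr 1
  push_cast
  ring

theorem dilate_ofTest (f : 𝓓(M, ℂ)) :
    dilate hM hr (ofTest (dilTest hM hr f)) = ofTest f := by
  funext g
  have h := (isRepBy_dilate hM hr (isRepBy_ofTest (dilTest hM hr f))).2 g
  rw [h, ofTest]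
  simp only [dilTest_apply, add_sub_cancel_left, inv_smul_smul₀ hr.ne', add_sub_cancel]

/-- Behaviour of the Sobolev norms under dilations. -/
theorem sobolevNorm_dilate (T : 𝓓(M, ℝ) →ₗ[ℝ] ℂ) (m : ℤ) (a : ℝ) :
    ENNReal.ofReal (r ^ ((d : ℝ) - 2 * a)) * sobolevNorm m (dilate hM hr T) ^ 2 =
      kondNorm (fun _ => r) m a T ^ 2 := by
  cases m with
  | ofNat n =>
    change _ * (weightedSobolevSq _ n 0 _ ^ (1 / 2 : ℝ)) ^ 2 = (weightedSobolevSq _ n a _ ^ _) ^ 2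
    rw [rpow_half_sq, rpow_half_sq, weightedSobolevSq_dilate]
  | negSucc n =>
    have hk : (ENNReal.ofReal (r ^ ((d : ℝ) / 2 - a))) ^ 2 = ENNReal.ofReal (r ^ ((d : ℝ) - 2 * a)) := by
      rw [← ENNReal.ofReal_pow (by positivity), ← Real.rpow_natCast, ← Real.rpow_mul hr.le]
      congr 2; push_cast; ring
    rw [← hk, ← mul_pow]
    congr 1
    change _ * (⨆ f : 𝓓(M, ℂ), _) = ⨆ f : 𝓓(M, ℂ), _
    rw [ENNReal.mul_iSup]
    -- Dilation permutes the test functions, so the two suprema can be compared term by term after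
    -- reindexing.
    have hsurj : Function.Surjective (dilTest (F := ℂ) hM hr) := fun f =>
      ⟨_, dilTest_dilTest_inv hM hr f⟩
    refine hsurj.iSup_congr _ fun f => ?_
    have h1 := weightedSobolevSq_dilate hM hr (ofTestLin (dilTest hM hr f)) (n + 1) (-a)
    rw [coe_ofTestLin, dilate_ofTest] at h1
    have h2 : complexEval (dilate hM hr T) f =
        (((r ^ d)⁻¹ : ℝ) : ℂ) * complexEval T (dilTest hM hr f) := by
      have e1 : TestFunction.postcompCLM (𝕜 := ℝ) Complex.reCLM (dilTest hM hr f) =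
          dilTest hM hr (TestFunction.postcompCLM (𝕜 := ℝ) Complex.reCLM f) := rfl
      have e2 : TestFunction.postcompCLM (𝕜 := ℝ) Complex.imCLM (dilTest hM hr f) =
          dilTest hM hr (TestFunction.postcompCLM (𝕜 := ℝ) Complex.imCLM f) := rfl
      simp only [complexEval, dilate, e1, e2]
      ring
    have h3 : ‖(((r ^ d)⁻¹ : ℝ) : ℂ)‖ₑ = ENNReal.ofReal ((r ^ d)⁻¹) := by
      rw [← ofReal_norm, Complex.norm_real, Real.norm_of_nonneg (by positivity)]
    have h4 : ENNReal.ofReal (r ^ ((d : ℝ) - 2 * -a)) ^ (1 / 2 : ℝ) =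
        ENNReal.ofReal (r ^ ((d : ℝ) / 2 + a)) := by
      rw [ENNReal.ofReal_rpow_of_nonneg (by positivity) (by norm_num), ← Real.rpow_mul hr.le]
      congr 2; ring
    have hp : 0 < r ^ ((d : ℝ) / 2 + a) := by positivity
    -- The Jacobian turns the exponent `d/2 - a` into `-(d/2 + a)`, which is what the denominator
    -- produces, since the dual norm has weight exponent `-a`.
    have h5 : ENNReal.ofReal (r ^ ((d : ℝ) / 2 - a)) * ENNReal.ofReal ((r ^ d)⁻¹) =
        (ENNReal.ofReal (r ^ ((d : ℝ) / 2 + a)))⁻¹ := by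
      rw [← ENNReal.ofReal_mul (by positivity), ← ENNReal.ofReal_inv_of_pos hp,
        ← Real.rpow_natCast r d, ← Real.rpow_neg hr.le, ← Real.rpow_neg hr.le, ← Real.rpow_add hr]
      congr 2; ring
    have h6 : (ENNReal.ofReal (r ^ ((d : ℝ) / 2 + a)) ≠ 0) := by simpa using hp
    have h7 : (ENNReal.ofReal (r ^ ((d : ℝ) / 2 + a)) ≠ ⊤) := by simp
    rw [← h1, h2, enorm_mul, h3, ENNReal.mul_rpow_of_nonneg _ _ (by norm_num), h4, neg_zero]
    generalize ENNReal.ofReal (r ^ ((d : ℝ) / 2 + a)) = A at *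
    rw [ENNReal.div_eq_inv_mul, ENNReal.div_eq_inv_mul, ENNReal.mul_inv (Or.inl h6)
      (Or.inl h7), ← h5]
    ring

end Dilation

/-! ### Energy estimates for products and for locally finite sums -/

section Energy

variable {d : ℕ} {Ω Ω₁ Ω₂ : Opens (Euc d)}

/-- The terms of the Leibniz formula for `∂^α`. -/
def leibnizTerms (α : Fin d → ℕ) : List (List (Fin d) × (Fin d → ℕ)) := (exists_leibniz α).choose

theorem leibnizTerms_order {α : Fin d → ℕ} {p : List (Fin d) × (Fin d → ℕ)}
    (hp : p ∈ leibnizTerms α) : p.1.length + ∑ i, p.2 i = ∑ i, α i :=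
  (exists_leibniz α).choose_spec.1 p hp

theorem mem_multiIndices_of_mem_leibnizTerms {m : ℕ} {α : Fin d → ℕ} (hα : α ∈ multiIndices d m)
    {p : List (Fin d) × (Fin d → ℕ)} (hp : p ∈ leibnizTerms α) : p.2 ∈ multiIndices d m := by
  rw [mem_multiIndices] at *
  have := leibnizTerms_order hp
  omega

namespace Cutoff

/-- The functions that represent the weak derivatives of `η T`, if the weak derivatives of `T` are
represented by `f`. -/
def leibniz (η : Cutoff Ω₁ Ω₂) (f : (Fin d → ℕ) → Euc d → ℂ) (α : Fin d → ℕ) (y : Euc d) : ℂ :=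
  ((leibnizTerms α).map fun p => (((η.derivs p.1).toFun y : ℝ) : ℂ) * f p.2 y).sum

theorem derivs_apply_eq_zero (η : Cutoff Ω₁ Ω₂) (L : List (Fin d)) {y : Euc d}
    (hy : y ∉ tsupport η.toFun) : (η.derivs L).toFun y = 0 :=
  image_eq_zero_of_notMem_tsupport fun h => hy (η.tsupport_derivs L h)

theorem leibniz_eq_zero (η : Cutoff Ω₁ Ω₂) (f : (Fin d → ℕ) → Euc d → ℂ) (α : Fin d → ℕ)
    {y : Euc d} (hy : y ∉ tsupport η.toFun) : η.leibniz f α y = 0 := by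
  simp [leibniz, η.derivs_apply_eq_zero _ hy]

end Cutoff

theorem HasWeakDerivs.pull {m : ℕ} {T : 𝓓(Ω₂, ℝ) →ₗ[ℝ] ℂ} {f : (Fin d → ℕ) → Euc d → ℂ}
    (h : HasWeakDerivs m T f) (η : Cutoff Ω₁ Ω₂) : HasWeakDerivs m (η.pull T) (η.leibniz f) := by
  intro α hα
  have h1 := (exists_leibniz α).choose_spec.2 Ω₁ Ω₂ η T
  have h2 : weakDeriv α (η.pull T) = fun g => ((leibnizTerms α).map fun p =>
    weakDeriv p.2 T ((η.derivs p.1).mul g)).sum := funext h1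
  rw [h2]
  exact IsRepBy.list_sum (leibnizTerms α) fun p hp =>
    (h p.2 (mem_multiIndices_of_mem_leibnizTerms hα hp)).pull (η.derivs p.1)

theorem enorm_list_sum_le {X : Type*} (l : List X) (F : X → ℂ) :
    ‖(l.map F).sum‖ₑ ≤ (l.map fun p => ‖F p‖ₑ).sum := by
  induction l with
  | nil => simp
  | cons p l ih =>
    simp only [List.map_cons, List.sum_cons]
    exact (enorm_add_le _ _).trans (by gcongr)

theorem enorm_ofReal_of_nonneg {t : ℝ} (ht : 0 ≤ t) : ‖((t : ℝ) : ℂ)‖ₑ = ENNReal.ofReal t := by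
  rw [← ofReal_norm, Complex.norm_real, Real.norm_of_nonneg ht]

/-- The constant in `energy_leibniz_le`. -/
def leibnizConst (d m : ℕ) (C : List (Fin d) → ℝ) : ℝ≥0 :=
  ∑ α ∈ multiIndices d m, (((leibnizTerms α).map fun p => (C p.1).toNNReal).sum) ^ 2

theorem HasWeakDerivs.aemeasurable {m : ℕ} {T : 𝓓(Ω, ℝ) → ℂ} {f : (Fin d → ℕ) → Euc d → ℂ}
    (h : HasWeakDerivs m T f) {α : Fin d → ℕ} (hα : α ∈ multiIndices d m) :
    AEMeasurable (f α) (volume.restrict (Ω : Set (Euc d))) :=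
  (h α hα).1.aestronglyMeasurable.aemeasurable

theorem aemeasurable_weighted {w : Euc d → ℝ} (hw : Measurable w) (s : ℝ) {f : Euc d → ℂ}
    {μ : Measure (Euc d)} (hf : AEMeasurable f μ) :
    AEMeasurable (fun x => ‖((w x ^ s : ℝ) : ℂ) * f x‖ₑ ^ 2) μ :=
  (((Complex.measurable_ofReal.comp (hw.pow_const s)).aemeasurable.mul hf).enorm).pow_const 2

theorem energy_mono {w : Euc d → ℝ} {m : ℕ} {a : ℝ} {A B : Set (Euc d)} (h : A ⊆ B)
    (f : (Fin d → ℕ) → Euc d → ℂ) : energy w m a A f ≤ energy w m a B f :=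
  Finset.sum_le_sum fun _ _ => lintegral_mono_set h

theorem energy_eq_of_subset {w : Euc d → ℝ} {m : ℕ} {a : ℝ} {A B : Set (Euc d)}
    (hB : MeasurableSet B) (hA : MeasurableSet A)
    {f : (Fin d → ℕ) → Euc d → ℂ} (h : ∀ α, ∀ x ∈ A \ B, f α x = 0) :
    energy w m a A f = energy w m a (A ∩ B) f := by
  refine Finset.sum_congr rfl fun α _ => ?_
  rw [← lintegral_indicator hA, ← lintegral_indicator (hA.inter hB)]
  refine lintegral_congr fun x => ?_
  by_cases hx : x ∈ A
  · by_cases hx' : x ∈ B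
    · rw [indicator_of_mem hx, indicator_of_mem (show x ∈ A ∩ B from ⟨hx, hx'⟩)]
    · rw [indicator_of_mem hx, indicator_of_notMem (fun h => hx' h.2), h α x ⟨hx, hx'⟩]
      simp
  · rw [indicator_of_notMem hx, indicator_of_notMem (fun h => hx h.1)]

/-- In each Leibniz term the orders add up to `|α|`, so `r^(|α|-a)` splits into `r^|L|`, absorbed by
the scale-invariant bound on the cut-off function, and the weight `r^(|β|-a)` that belongs to `f β`.
The constant is therefore independent of `r`. -/
theorem energy_leibniz_le (m : ℕ) (a : ℝ) (C : List (Fin d) → ℝ) {r : ℝ} (hr : 0 < r) (η : Cutoff Ω₁ Ω₂)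
    (hη : ∀ (L : List (Fin d)), ∀ y ∈ Ω₁, r ^ L.length * |(η.derivs L).toFun y| ≤ C L)
    {T : 𝓓(Ω₂, ℝ) → ℂ} {f : (Fin d → ℕ) → Euc d → ℂ} (hf : HasWeakDerivs m T f) :
    energy (fun _ => r) m a Ω₁ (η.leibniz f) ≤
      leibnizConst d m C * energy (fun _ => r) m a (Ω₁ ∩ tsupport η.toFun) f := by
  set G : Euc d → ℝ≥0∞ := fun y => ∑ β ∈ multiIndices d m,
    ‖((r ^ (((∑ i, β i : ℕ) : ℝ) - a) : ℝ) : ℂ) * f β y‖ₑ ^ 2 with hG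
  have hmeas : MeasurableSet ((Ω₁ : Set (Euc d)) ∩ tsupport η.toFun) :=
    Ω₁.isOpen.measurableSet.inter (isClosed_tsupport _).measurableSet
  -- Each weighted `f β y` is bounded by the root of the full sum `G y`, which allows all Leibniz
  -- terms to be estimated by the same function.
  have point : ∀ α ∈ multiIndices d m, ∀ y ∈ Ω₁,
      ‖((r ^ (((∑ i, α i : ℕ) : ℝ) - a) : ℝ) : ℂ) * η.leibniz f α y‖ₑ ≤
        ((leibnizTerms α).map fun p => ENNReal.ofReal (C p.1)).sum *
          G y ^ (1 / 2 : ℝ) := by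
    intro α hα y hy
    have e1 : ((r ^ (((∑ i, α i : ℕ) : ℝ) - a) : ℝ) : ℂ) * η.leibniz f α y =
        ((leibnizTerms α).map fun p => ((r ^ (((∑ i, α i : ℕ) : ℝ) - a) : ℝ) : ℂ) *
          ((((η.derivs p.1).toFun y : ℝ) : ℂ) * f p.2 y)).sum := by
      rw [Cutoff.leibniz, List.sum_map_mul_left]
    rw [e1]
    refine (enorm_list_sum_le _ _).trans ?_
    rw [← List.sum_map_mul_right]
    refine List.sum_le_sum fun p hp => ?_
    have hord := leibnizTerms_order hp
    have e2 : r ^ (((∑ i, α i : ℕ) : ℝ) - a) =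
        r ^ p.1.length * r ^ (((∑ i, p.2 i : ℕ) : ℝ) - a) := by
      rw [← hord, ← Real.rpow_natCast r p.1.length, ← Real.rpow_add hr]
      push_cast; congr 1; ring
    have e3 : ((r ^ (((∑ i, α i : ℕ) : ℝ) - a) : ℝ) : ℂ) *
          ((((η.derivs p.1).toFun y : ℝ) : ℂ) * f p.2 y) =
        ((r ^ p.1.length * (η.derivs p.1).toFun y : ℝ) : ℂ) *
          (((r ^ (((∑ i, p.2 i : ℕ) : ℝ) - a) : ℝ) : ℂ) * f p.2 y) := by
      rw [e2]; push_cast; ring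
    rw [e3, enorm_mul]
    gcongr
    · rw [← ofReal_norm, Complex.norm_real, Real.norm_eq_abs, abs_mul,
        abs_of_pos (pow_pos hr _)]
      exact ENNReal.ofReal_le_ofReal (hη p.1 y hy)
    · rw [← sq_rpow_half ‖_‖ₑ]
      gcongr
      exact Finset.single_le_sum
        (f := fun β => ‖((r ^ (((∑ i, β i : ℕ) : ℝ) - a) : ℝ) : ℂ) * f β y‖ₑ ^ 2)
        (fun _ _ => zero_le) (mem_multiIndices_of_mem_leibnizTerms hα hp)
  have hsum : ∫⁻ y in (Ω₁ : Set (Euc d)) ∩ tsupport η.toFun, G y =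
      energy (fun _ => r) m a (Ω₁ ∩ tsupport η.toFun) f := by
    rw [energy, hG, lintegral_finsetSum']
    intro β hβ
    refine aemeasurable_weighted measurable_const _ ((hf.aemeasurable hβ).mono_measure ?_)
    exact Measure.restrict_mono (fun y hy => η.supp y hy.2 hy.1) le_rfl
  have main : ∀ α ∈ multiIndices d m,
      ∫⁻ y in (Ω₁ : Set (Euc d)),
        ‖((r ^ (((∑ i, α i : ℕ) : ℝ) - a) : ℝ) : ℂ) * η.leibniz f α y‖ₑ ^ 2 ≤
      ((leibnizTerms α).map fun p => ENNReal.ofReal (C p.1)).sum ^ 2 *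
        ∫⁻ y in (Ω₁ : Set (Euc d)) ∩ tsupport η.toFun, G y := by
    intro α hα
    have hfin : ((leibnizTerms α).map fun p => ENNReal.ofReal (C p.1)).sum ≠ ⊤ := by
      induction leibnizTerms α with
      | nil => simp
      | cons p l ih => simpa using ih
    rw [← lintegral_const_mul' _ _ (by simp [hfin]), ← lintegral_indicator Ω₁.isOpen.measurableSet,
      ← lintegral_indicator hmeas]
    refine lintegral_mono fun y => ?_
    by_cases hy : y ∈ (Ω₁ : Set (Euc d))
    · by_cases hy' : y ∈ tsupport η.toFun
      · rw [indicator_of_mem hy,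
          indicator_of_mem (show y ∈ (Ω₁ : Set (Euc d)) ∩ tsupport η.toFun from ⟨hy, hy'⟩),
          ← rpow_half_sq (G y), ← mul_pow]
        gcongr
        exact point α hα y hy
      · rw [indicator_of_mem hy, η.leibniz_eq_zero f α hy']
        simp
    · rw [indicator_of_notMem hy]; exact zero_le
  rw [hsum] at main
  rw [leibnizConst, ENNReal.ofNNReal_finsetSum, Finset.sum_mul]
  refine Finset.sum_le_sum fun α hα => (main α hα).trans_eq ?_
  congr 1
  rw [ENNReal.coe_pow]
  congr 1
  induction leibnizTerms α with
  | nil => simp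
  | cons p l ih => rw [List.map_cons, List.sum_cons, ih]; simp [ENNReal.ofReal]

/-- The constant in `energy_le_of_comparable`. -/
def weightConst (l : ℝ) (m : ℕ) (a : ℝ) : ℝ≥0 := ((l ^ ((m : ℝ) + |a|)) ^ 2).toNNReal

theorem rpow_le_of_comparable {l u v s t : ℝ} (hl : 1 ≤ l) (hu : 0 < u) (hv : 0 < v)
    (h1 : u ≤ l * v) (h2 : v ≤ l * u) (hst : |s| ≤ t) : u ^ s ≤ l ^ t * v ^ s := by
  have hl0 : 0 < l := by linarith
  rcases le_total 0 s with hs | hs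
  · calc u ^ s ≤ (l * v) ^ s := Real.rpow_le_rpow hu.le h1 hs
      _ = l ^ s * v ^ s := Real.mul_rpow hl0.le hv.le
      _ ≤ l ^ t * v ^ s := by
        gcongr
        exact (le_abs_self s).trans hst
  · have h3 : l⁻¹ * v ≤ u := by rwa [inv_mul_le_iff₀ hl0]
    calc u ^ s ≤ (l⁻¹ * v) ^ s := Real.rpow_le_rpow_of_nonpos (by positivity) h3 hs
      _ = l ^ (-s) * v ^ s := by
        rw [Real.mul_rpow (by positivity) hv.le, Real.inv_rpow hl0.le, Real.rpow_neg hl0.le]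
      _ ≤ l ^ t * v ^ s := by
        gcongr
        exact (neg_le_abs s).trans hst

/-- All exponents `|α| - a` have absolute value at most `m + |a|`, so one power of `l` serves for
both signs. -/
theorem energy_le_of_comparable {l : ℝ} (hl : 1 ≤ l) {w v : Euc d → ℝ} (m : ℕ) (a : ℝ)
    {A : Set (Euc d)} (hA : MeasurableSet A) (hw : ∀ x ∈ A, 0 < w x) (hv : ∀ x ∈ A, 0 < v x)
    (h1 : ∀ x ∈ A, w x ≤ l * v x) (h2 : ∀ x ∈ A, v x ≤ l * w x) (f : (Fin d → ℕ) → Euc d → ℂ) :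
    energy w m a A f ≤ weightConst l m a * energy v m a A f := by
  rw [energy, energy, Finset.mul_sum]
  refine Finset.sum_le_sum fun α hα => ?_
  rw [← lintegral_const_mul' _ _ (by simp)]
  refine setLIntegral_mono' hA fun x hx => ?_
  set s := (((∑ i, α i : ℕ) : ℝ) - a)
  have hs : |s| ≤ (m : ℝ) + |a| := by
    refine (abs_sub _ _).trans ?_
    rw [mem_multiIndices] at hα
    have : ((∑ i, α i : ℕ) : ℝ) ≤ m := by exact_mod_cast hα
    rw [abs_of_nonneg (by positivity)]
    linarith
  have key := rpow_le_of_comparable hl (hw x hx) (hv x hx) (h1 x hx) (h2 x hx) hs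
  have hl0 : 0 ≤ l := by linarith
  rw [enorm_mul, enorm_mul, mul_pow, mul_pow, ← mul_assoc]
  gcongr
  rw [enorm_ofReal_of_nonneg (Real.rpow_nonneg (hw x hx).le _),
    enorm_ofReal_of_nonneg (Real.rpow_nonneg (hv x hx).le _), weightConst,
    ← ENNReal.ofReal, ENNReal.ofReal_pow (by positivity), ← mul_pow,
    ← ENNReal.ofReal_mul (by positivity)]
  gcongr

theorem tsupport_testDeriv (α : Fin d → ℕ) (g : 𝓓(Ω, ℝ)) :
    tsupport (testDeriv α g) ⊆ tsupport g := by
  induction α using multiIndex_induction generalizing g with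
  | zero => rw [testDeriv_zero]
  | step α i ih =>
    rw [testDeriv_add_single]
    refine (ih _).trans ?_
    rw [coe_lineDeriv]
    exact tsupport_fderiv_apply_subset ℝ _

theorem enorm_sum_sq_le {ι : Type*} (s : Finset ι) (F : ι → ℂ) :
    ‖∑ i ∈ s, F i‖ₑ ^ 2 ≤ s.card * ∑ i ∈ s, ‖F i‖ₑ ^ 2 := by
  have h1 := ENNReal.inner_le_Lp_mul_Lq s (fun _ => 1) (fun i => ‖F i‖ₑ) (p := 2) (q := 2)
    ⟨by norm_num, by norm_num, by norm_num⟩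
  have h2 : ‖∑ i ∈ s, F i‖ₑ ≤
      ((s.card : ℝ≥0∞)) ^ (1 / 2 : ℝ) * (∑ i ∈ s, ‖F i‖ₑ ^ 2) ^ (1 / 2 : ℝ) := by
    refine (enorm_sum_le _ _).trans ?_
    simpa using h1
  calc _ ≤ (((s.card : ℝ≥0∞)) ^ (1 / 2 : ℝ) * (∑ i ∈ s, ‖F i‖ₑ ^ 2) ^ (1 / 2 : ℝ)) ^ 2 := by
        gcongr
    _ = _ := by rw [mul_pow, rpow_half_sq, rpow_half_sq]

/-- A functional is the locally finite sum of the functionals `T j`, which are supported in the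
sets `Z j`. -/
structure IsLocallyFiniteSum {ι : Type*} (Z : ι → Set (Euc d)) (T : 𝓓(Ω, ℝ) → ℂ)
    (S : ι → 𝓓(Ω, ℝ) → ℂ) : Prop where
  finite : ∀ K ⊆ (Ω : Set (Euc d)), IsCompact K → {j | (Z j ∩ K).Nonempty}.Finite
  eq_sum : ∀ (g : 𝓓(Ω, ℝ)) (s : Finset ι), (∀ j, (Z j ∩ tsupport g).Nonempty → j ∈ s) →
    T g = ∑ j ∈ s, S j g

theorem tsum_eq_sum_of_support {ι : Type*} {Z : ι → Set (Euc d)} {f : ι → Euc d → ℂ}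
    (hf : ∀ j, ∀ x ∉ Z j, f j x = 0) {x : Euc d} {s : Finset ι} (hs : ∀ j, x ∈ Z j → j ∈ s) :
    ∑' j, f j x = ∑ j ∈ s, f j x :=
  tsum_eq_sum fun j hj => hf j x fun h => hj (hs j h)

/-- Only finitely many summands are seen on a compact set, and differentiation does not enlarge the
support of a test function; hence one finite set of indices works for `g` and for all its
derivatives. -/
theorem IsLocallyFiniteSum.hasWeakDerivs {ι : Type*} {Z : ι → Set (Euc d)} {T : 𝓓(Ω, ℝ) → ℂ}
    {S : ι → 𝓓(Ω, ℝ) → ℂ} (h : IsLocallyFiniteSum Z T S) {m : ℕ}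
    {f : ι → (Fin d → ℕ) → Euc d → ℂ} (hS : ∀ j, HasWeakDerivs m (S j) (f j))
    (hf : ∀ j α, ∀ x ∉ Z j, f j α x = 0) :
    HasWeakDerivs m T (fun α x => ∑' j, f j α x) := by
  intro α hα
  refine ⟨?_, fun g => ?_⟩
  · rw [locallyIntegrableOn_iff Ω.isOpen.isLocallyClosed]
    intro K hK hKc
    have hi : IntegrableOn (fun x => ∑ j ∈ (h.finite K hK hKc).toFinset, f j α x) K :=
      integrable_finsetSum _ fun j _ => (hS j α hα).1.integrableOn_compact_subset hK hKc
    refine hi.congr_fun (fun x hx => ?_) hKc.measurableSet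
    refine (tsum_eq_sum_of_support (fun j => hf j α) fun j hj => ?_).symm
    exact (h.finite K hK hKc).mem_toFinset.2 ⟨x, hj, hx⟩
  · have hfin := h.finite (tsupport g) g.tsupport_subset g.hasCompactSupport
    set s := hfin.toFinset with hs
    have hmem : ∀ j, (Z j ∩ tsupport g).Nonempty → j ∈ s := fun j hj => hfin.mem_toFinset.2 hj
    have e1 : weakDeriv α T g = ∑ j ∈ s, weakDeriv α (S j) g := by
      simp only [weakDeriv]
      rw [h.eq_sum (testDeriv α g) s, Finset.mul_sum]
      intro j hj
      exact hmem j (hj.mono (inter_subset_inter_right _ (tsupport_testDeriv α g)))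
    rw [e1, Finset.sum_congr rfl fun j _ => (hS j α hα).2 g]
    simp only [setIntegral_test_mul]
    rw [← integral_finsetSum _ fun j _ =>
      LocallyIntegrableOn.integrable_test_mul (hS j α hα).1 g]
    refine integral_congr_ae (Eventually.of_forall fun x => ?_)
    simp only [← Finset.mul_sum]
    by_cases hx : x ∈ tsupport g
    · rw [tsum_eq_sum_of_support (fun j => hf j α) fun j hj => hmem j ⟨x, hj, hx⟩]
    · simp [image_eq_zero_of_notMem_tsupport hx]

/-- At every point at most `κ` terms are nonzero, so the Cauchy-Schwarz inequality for the sum costs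
only the factor `κ`. -/
theorem energy_tsum_le {ι : Type*} [Countable ι] {Z : ι → Set (Euc d)}
    {S : ι → 𝓓(Ω, ℝ) → ℂ} {m : ℕ} {a : ℝ} {w : Euc d → ℝ} (hw : Measurable w)
    {f : ι → (Fin d → ℕ) → Euc d → ℂ} (hS : ∀ j, HasWeakDerivs m (S j) (f j))
    (hf : ∀ j α, ∀ x ∉ Z j, f j α x = 0) {κ : ℕ} (hκ : ∀ x ∈ Ω, {j | x ∈ Z j}.encard ≤ κ) :
    energy w m a Ω (fun α x => ∑' j, f j α x) ≤ κ * ∑' j, energy w m a Ω (f j) := by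
  simp only [energy]
  rw [Summable.tsum_finsetSum fun _ _ => ENNReal.summable, Finset.mul_sum]
  refine Finset.sum_le_sum fun α hα => ?_
  rw [← lintegral_tsum fun j => aemeasurable_weighted hw _ ((hS j).aemeasurable hα),
    ← lintegral_const_mul' _ _ (by simp)]
  refine setLIntegral_mono' Ω.isOpen.measurableSet fun x hx => ?_
  have hfin : {j | x ∈ Z j}.Finite := finite_of_encard_le_coe (hκ x hx)
  have hcard : (hfin.toFinset.card : ℝ≥0∞) ≤ κ := by
    have := hκ x hx
    rw [hfin.encard_eq_coe_toFinset_card] at this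
    exact_mod_cast this
  rw [tsum_eq_sum_of_support (fun j => hf j α) fun j hj => hfin.mem_toFinset.2 hj, Finset.mul_sum]
  refine (enorm_sum_sq_le _ _).trans ?_
  gcongr
  exact ENNReal.sum_le_tsum _

end Energy

/-! ### Localization -/

section Partials

variable {d : ℕ} {Ω₁ Ω₂ : Opens (Euc d)}

/-- Iterated partial derivatives of a function. -/
def partials : List (Fin d) → (Euc d → ℝ) → Euc d → ℝ
  | [], η => η
  | i :: L, η => fun y => fderiv ℝ (partials L η) y (stdVec i)

theorem Cutoff.derivs_toFun (η : Cutoff Ω₁ Ω₂) (L : List (Fin d)) :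
    (η.derivs L).toFun = partials L η.toFun := by
  induction L with
  | nil => rfl
  | cons i L ih => simp only [Cutoff.derivs, Cutoff.deriv, partials, ih]

theorem contDiff_partials {η : Euc d → ℝ} (hη : ContDiff ℝ ∞ η) (L : List (Fin d)) :
    ContDiff ℝ ∞ (partials L η) := by
  induction L with
  | nil => exact hη
  | cons i L ih => exact (ih.fderiv_right (m := ∞) (by simp)).clm_apply contDiff_const

theorem hasCompactSupport_partials {η : Euc d → ℝ} (hη : HasCompactSupport η) (L : List (Fin d)) :
    HasCompactSupport (partials L η) := by
  induction L with
  | nil => exact hη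
  | cons i L ih => exact ih.fderiv_apply ℝ _

theorem abs_partials_le {η : Euc d → ℝ} (hη : ContDiff ℝ ∞ η) (L : List (Fin d)) (y : Euc d) :
    |partials L η y| ≤ ‖iteratedFDeriv ℝ L.length η y‖ := by
  -- The vectors are the basis vectors listed in `L`, hence of norm one, and the operator norm of
  -- the iterated derivative gives the bound.
  suffices h : ∃ v : Fin L.length → Euc d, (∀ k, ‖v k‖ ≤ 1) ∧
      ∀ y, partials L η y = iteratedFDeriv ℝ L.length η y v by
    obtain ⟨v, hv, h⟩ := h
    rw [h, ← Real.norm_eq_abs]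
    exact ((iteratedFDeriv ℝ L.length η y).le_opNorm v).trans
      (mul_le_of_le_one_right (norm_nonneg _)
        (Finset.prod_le_one (fun _ _ => norm_nonneg _) fun k _ => hv k))
  induction L with
  | nil => exact ⟨fun k => 0, by simp, fun y => by simp [partials]⟩
  | cons i L ih =>
    obtain ⟨v, hv, h⟩ := ih
    refine ⟨Fin.cons (stdVec i) v, fun k => ?_, fun y => ?_⟩
    · refine Fin.cases ?_ (fun k => ?_) k
      · simp
      · simpa using hv k
    · have hd : DifferentiableAt ℝ (iteratedFDeriv ℝ L.length η) y :=
        (hη.differentiable_iteratedFDeriv (m := L.length)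
          (by exact_mod_cast WithTop.coe_lt_coe.2 (WithTop.coe_lt_top _))) y
      have e1 : partials L η = fun y => iteratedFDeriv ℝ L.length η y v := funext h
      simp only [partials, e1, List.length_cons]
      rw [iteratedFDeriv_succ_apply_left, fderiv_continuousMultilinear_apply_const_apply hd]
      simp

theorem partials_comp_smul_sub {η : Euc d → ℝ} (hη : ContDiff ℝ ∞ η) (s : ℝ) (c : Euc d)
    (L : List (Fin d)) (y : Euc d) :
    partials L (fun y => η (s • (y - c))) y = s ^ L.length * partials L η (s • (y - c)) := by
  induction L generalizing y with
  | nil => simp [partials]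
  | cons i L ih =>
    have e : partials L (fun y => η (s • (y - c))) =
        fun y => s ^ L.length * partials L η (s • (y - c)) := funext ih
    have h1 : HasFDerivAt (fun y : Euc d => s • (y - c)) (s • ContinuousLinearMap.id ℝ (Euc d)) y :=
      ((hasFDerivAt_id y).sub_const c).const_smul s
    have h2 : HasFDerivAt (fun y => partials L η (s • (y - c))) _ y :=
      HasFDerivAt.comp (g := partials L η) y
        ((contDiff_partials hη L).differentiable (by simp) (s • (y - c))).hasFDerivAt h1
    simp only [partials, e, (h2.const_mul (s ^ L.length)).fderiv, List.length_cons]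
    simp
    ring

end Partials

/-- A partition of unity on `Ω` with functions supported in balls of radius comparable to the
weight `w` at their centers `c j`; the open set `M j` is invariant under dilations with center
`c j` and agrees with `Ω` near the support of `φ j`. -/
structure LocalCover {d : ℕ} (Ω : Opens (Euc d)) (w : Euc d → ℝ) (ι : Type*) where
  c : ι → Euc d
  σ : ι → ℝ
  φ : ι → Euc d → ℝ
  M : ι → Opens (Euc d)
  ε : ℝ
  σ₀ : ℝ
  C : ℕ → ℝ
  κ : ℕ
  lip : LipschitzWith 1 w
  pos : ∀ x ∈ Ω, 0 < w x
  center_pos : ∀ j, 0 < w (c j)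
  ε_lt_one : ε < 1
  σ₀_pos : 0 < σ₀
  le_σ : ∀ j, σ₀ ≤ σ j
  σ_le : ∀ j, σ j ≤ ε
  ε_pos : 0 < ε
  smooth : ∀ j, ContDiff ℝ ∞ (φ j)
  supp : ∀ j, tsupport (φ j) ⊆ Metric.ball (c j) (σ j * w (c j) / 2)
  sum_eq : ∀ p ∈ Ω, HasSum (fun j => φ j p) 1
  bound : ∀ k j, ∀ p ∈ Ω, w p ^ k * ‖iteratedFDeriv ℝ k (φ j) p‖ ≤ C k
  overlap : ∀ p ∈ Ω, {j | p ∈ Metric.ball (c j) (ε * w (c j))}.encard ≤ κ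
  model : ∀ j, ∀ p ∈ Metric.ball (c j) (σ j * w (c j)), p ∈ M j ↔ p ∈ Ω
  dil : ∀ j, DilationInvariant (c j) (M j)

namespace LocalCover

variable {d : ℕ} {Ω : Opens (Euc d)} {w : Euc d → ℝ} {ι : Type*} (A : LocalCover Ω w ι)

/-- The weight at the `j`-th center. -/
def r (j : ι) : ℝ := w (A.c j)

/-- A closed ball that contains the supports of the cut-off functions. -/
def Z (j : ι) : Set (Euc d) := Metric.closedBall (A.c j) (3 / 4 * (A.σ j * A.r j))

theorem r_pos (j : ι) : 0 < A.r j := A.center_pos j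

theorem σ_pos (j : ι) : 0 < A.σ j := A.σ₀_pos.trans_le (A.le_σ j)

theorem σr_pos (j : ι) : 0 < A.σ j * A.r j := mul_pos (A.σ_pos j) (A.r_pos j)

theorem Z_subset (j : ι) : A.Z j ⊆ Metric.ball (A.c j) (A.σ j * A.r j) :=
  Metric.closedBall_subset_ball (by have := A.σr_pos j; linarith)

theorem Z_subset_ball (j : ι) : A.Z j ⊆ Metric.ball (A.c j) (A.ε * A.r j) :=
  (A.Z_subset j).trans (Metric.ball_subset_ball
    (mul_le_mul_of_nonneg_right (A.σ_le j) (A.r_pos j).le))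

theorem isClosed_Z (j : ι) : IsClosed (A.Z j) := Metric.isClosed_closedBall

theorem tsupport_φ_subset (j : ι) : tsupport (A.φ j) ⊆ A.Z j :=
  (A.supp j).trans (Metric.ball_subset_closedBall.trans (Metric.closedBall_subset_closedBall
    (by have := A.σr_pos j; unfold r at *; linarith)))

theorem encard_Z_le {x : Euc d} (hx : x ∈ Ω) : {j | x ∈ A.Z j}.encard ≤ A.κ :=
  (encard_le_encard fun j hj => A.Z_subset_ball j hj).trans (A.overlap x hx)

/-- The constant of comparison of the weights. -/
def ratio : ℝ := (1 - A.ε)⁻¹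

theorem one_le_ratio : 1 ≤ A.ratio :=
  (one_le_inv₀ (by linarith [A.ε_lt_one])).2 (by linarith [A.ε_pos])

theorem abs_sub_le {x : Euc d} {j : ι} (hx : x ∈ Metric.ball (A.c j) (A.ε * A.r j)) :
    |w x - A.r j| ≤ A.ε * A.r j := by
  have h1 := A.lip.dist_le_mul x (A.c j)
  rw [NNReal.coe_one, one_mul, Real.dist_eq] at h1
  exact h1.trans (Metric.mem_ball.1 hx).le

/-- With `le_r` this is the freezing of the weight: the Lipschitz bound gives `(1 - ε) r ≤ w ≤ (1 +
ε) r`, and `1 + ε ≤ (1 - ε)⁻¹` allows one constant in both directions. -/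
theorem r_le {x : Euc d} {j : ι} (hx : x ∈ Metric.ball (A.c j) (A.ε * A.r j)) :
    A.r j ≤ A.ratio * w x := by
  have h := abs_le.1 (A.abs_sub_le hx)
  rw [ratio, ← div_eq_inv_mul, le_div_iff₀ (by linarith [A.ε_lt_one])]
  linarith

theorem le_r {x : Euc d} {j : ι} (hx : x ∈ Metric.ball (A.c j) (A.ε * A.r j)) :
    w x ≤ A.ratio * A.r j := by
  have h := abs_le.1 (A.abs_sub_le hx)
  rw [ratio, ← div_eq_inv_mul, le_div_iff₀ (by linarith [A.ε_lt_one])]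
  have h1 : w x ≤ (1 + A.ε) * A.r j := by linarith
  calc w x * (1 - A.ε) ≤ ((1 + A.ε) * A.r j) * (1 - A.ε) :=
        mul_le_mul_of_nonneg_right h1 (by linarith [A.ε_lt_one])
    _ = A.r j - A.ε ^ 2 * A.r j := by ring
    _ ≤ A.r j := by have := mul_nonneg (sq_nonneg A.ε) (A.r_pos j).le; linarith

theorem weight_pos {x : Euc d} {j : ι} (hx : x ∈ Metric.ball (A.c j) (A.ε * A.r j)) : 0 < w x := by
  have h := abs_le.1 (A.abs_sub_le hx)
  have := mul_lt_mul_of_pos_right A.ε_lt_one (A.r_pos j)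
  linarith

/-- The overlap bound is pointwise and has to be made locally uniform. There is room for this
because `Z j` has radius at most `3/4 · ε r j`: if it meets the ball of radius `ε w p / 16` about
`p`, then `w p ≤ 2 r j`, so `p` is within `(3/4 + 1/8) ε r j` of the center and `j` is among the
finitely many indices counted at `p`. -/
theorem finite_meets {K : Set (Euc d)} (hK : K ⊆ Ω) (hKc : IsCompact K) :
    {j | (A.Z j ∩ K).Nonempty}.Finite := by
  refine hKc.induction_on (p := fun K => {j | (A.Z j ∩ K).Nonempty}.Finite) (by simp)
    (fun s t hst ht => ht.subset fun j hj => hj.mono (inter_subset_inter_right _ hst))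
    (fun s t hs ht => (hs.union ht).subset fun j hj => ?_) fun p hp => ?_
  · obtain ⟨x, hx, hx' | hx'⟩ := hj
    · exact Or.inl ⟨x, hx, hx'⟩
    · exact Or.inr ⟨x, hx, hx'⟩
  · have hwp := A.pos p (hK hp)
    have hε := A.ε_pos
    refine ⟨Metric.ball p (A.ε * w p / 16), mem_nhdsWithin_of_mem_nhds
      (Metric.ball_mem_nhds p (by positivity)), ?_⟩
    refine (finite_of_encard_le_coe (A.overlap p (hK hp))).subset ?_
    rintro j ⟨q, hq, hqp⟩
    have hr := A.r_pos j
    have h1 : dist q (A.c j) ≤ 3 / 4 * (A.ε * A.r j) := (Metric.mem_closedBall.1 hq).trans (by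
      have := mul_le_mul_of_nonneg_right (A.σ_le j) hr.le; linarith)
    have h2 : dist q p < A.ε * w p / 16 := hqp
    have h3 : dist p (A.c j) ≤ dist q p + dist q (A.c j) := by
      rw [dist_comm q p]; exact dist_triangle _ _ _
    have h4 := A.lip.dist_le_mul p (A.c j)
    rw [NNReal.coe_one, one_mul, Real.dist_eq] at h4
    have h5 : w p ≤ A.r j + dist p (A.c j) := by
      have := (abs_le.1 h4).2; unfold r; linarith
    have h6 : A.ε * w p ≤ w p := by nlinarith [A.ε_lt_one]
    have h7 : A.ε * A.r j ≤ A.r j := by nlinarith [A.ε_lt_one]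
    have h8 : w p ≤ 2 * A.r j := by linarith
    have h9 : A.ε * w p ≤ A.ε * (2 * A.r j) := mul_le_mul_of_nonneg_left h8 hε.le
    change dist p (A.c j) < A.ε * A.r j
    have h10 : 0 < A.ε * A.r j := mul_pos hε hr
    linarith

theorem sum_φ_eq {p : Euc d} (hp : p ∈ Ω) {s : Finset ι} (hs : ∀ j, p ∈ A.Z j → j ∈ s) :
    ∑ j ∈ s, A.φ j p = 1 := by
  refine (hasSum_sum_of_ne_finset_zero fun j hj => ?_).unique (A.sum_eq p hp)
  exact image_eq_zero_of_notMem_tsupport fun h => hj (hs j (A.tsupport_φ_subset j h))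

/-- A smooth function supported near `c j` as a cut-off function from `Ω` to `M j`. -/
def toModel (j : ι) (η : Euc d → ℝ) (hη : ContDiff ℝ ∞ η) (hs : tsupport η ⊆ A.Z j) :
    Cutoff Ω (A.M j) where
  toFun := η
  smooth := hη
  supp y hy h := (A.model j y (A.Z_subset j (hs hy))).2 h

/-- A smooth function supported near `c j` as a cut-off function from `M j` to `Ω`. -/
def ofModel (j : ι) (η : Euc d → ℝ) (hη : ContDiff ℝ ∞ η) (hs : tsupport η ⊆ A.Z j) :
    Cutoff (A.M j) Ω where
  toFun := η
  smooth := hη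
  supp y hy h := (A.model j y (A.Z_subset j (hs hy))).1 h

/-- A fixed bump function. -/
def bump (d : ℕ) : ContDiffBump (0 : Euc d) := ⟨1 / 2, 3 / 4, by norm_num, by norm_num⟩

/-- A cut-off function that equals one near the support of `φ j`. -/
def ψ (j : ι) (y : Euc d) : ℝ := bump d ((A.σ j * A.r j)⁻¹ • (y - A.c j))

theorem smooth_ψ (j : ι) : ContDiff ℝ ∞ (A.ψ j) := (bump d).contDiff.comp (by fun_prop)

theorem tsupport_ψ_subset (j : ι) : tsupport (A.ψ j) ⊆ A.Z j := by
  refine closure_minimal (fun y hy => ?_) (A.isClosed_Z j)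
  have h : (A.σ j * A.r j)⁻¹ • (y - A.c j) ∈ Function.support (bump d) := hy
  rw [(bump d).support_eq, mem_ball_zero_iff, norm_smul, norm_inv, Real.norm_of_nonneg (A.σr_pos j).le,
    inv_mul_lt_iff₀ (A.σr_pos j)] at h
  rw [Z, Metric.mem_closedBall, dist_eq_norm]
  refine h.le.trans_eq ?_
  simp only [bump]
  ring

theorem ψ_eq_one (j : ι) {y : Euc d} (hy : y ∈ tsupport (A.φ j)) : A.ψ j y = 1 := by
  refine (bump d).one_of_mem_closedBall ?_
  have h := A.supp j hy
  rw [Metric.mem_ball, dist_eq_norm] at h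
  rw [mem_closedBall_zero_iff, norm_smul, norm_inv, Real.norm_of_nonneg (A.σr_pos j).le,
    inv_mul_le_iff₀ (A.σr_pos j)]
  refine h.le.trans_eq ?_
  simp only [bump, r]
  ring

theorem φ_mul_ψ (j : ι) (y : Euc d) : A.φ j y * A.ψ j y = A.φ j y := by
  by_cases hy : y ∈ tsupport (A.φ j)
  · rw [A.ψ_eq_one j hy, mul_one]
  · rw [image_eq_zero_of_notMem_tsupport hy, zero_mul]

theorem exists_bump_bound (L : List (Fin d)) : ∃ B : ℝ, ∀ y, |partials L (bump d) y| ≤ B := by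
  obtain ⟨B, hB⟩ := (contDiff_partials (bump d).contDiff L).continuous.bounded_above_of_compact_support
    (hasCompactSupport_partials (bump d).hasCompactSupport L)
  exact ⟨B, hB⟩

/-- Bounds for the derivatives of the cut-off functions. -/
def bd (L : List (Fin d)) : ℝ :=
  max (A.ratio ^ L.length * A.C L.length) (A.σ₀⁻¹ ^ L.length * (exists_bump_bound L).choose)

theorem bound_φ (j : ι) (L : List (Fin d)) {y : Euc d} (hy : y ∈ tsupport (A.φ j)) (hy' : y ∈ Ω) :
    A.r j ^ L.length * |partials L (A.φ j) y| ≤ A.bd L := by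
  refine le_max_of_le_left ?_
  have hb := A.Z_subset_ball j (A.tsupport_φ_subset j hy)
  calc A.r j ^ L.length * |partials L (A.φ j) y|
      ≤ (A.ratio * w y) ^ L.length * ‖iteratedFDeriv ℝ L.length (A.φ j) y‖ := by
        have h0 : 0 ≤ A.ratio * w y :=
          mul_nonneg (zero_le_one.trans A.one_le_ratio) (A.weight_pos hb).le
        gcongr
        · exact (A.r_pos j).le
        · exact A.r_le hb
        · exact abs_partials_le (A.smooth j) L y
    _ = A.ratio ^ L.length * (w y ^ L.length * ‖iteratedFDeriv ℝ L.length (A.φ j) y‖) := by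
        rw [mul_pow]; ring
    _ ≤ _ := by
        gcongr
        · exact pow_nonneg (by linarith [A.one_le_ratio]) _
        · exact A.bound _ j y hy'

theorem bound_ψ (j : ι) (L : List (Fin d)) (y : Euc d) :
    A.r j ^ L.length * |partials L (A.ψ j) y| ≤ A.bd L := by
  refine le_max_of_le_right ?_
  have h1 := partials_comp_smul_sub (bump d).contDiff (A.σ j * A.r j)⁻¹ (A.c j) L y
  have h2 : partials L (A.ψ j) y = _ := h1
  have hr := A.r_pos j
  have hσ := A.σ_pos j
  have h3 := (exists_bump_bound L).choose_spec ((A.σ j * A.r j)⁻¹ • (y - A.c j))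
  rw [h2, abs_mul, abs_of_nonneg (by positivity), mul_inv, mul_pow, inv_pow (A.r j)]
  calc A.r j ^ L.length * ((A.σ j)⁻¹ ^ L.length * (A.r j ^ L.length)⁻¹ * |_|)
      = (A.σ j)⁻¹ ^ L.length * |partials L (bump d) ((A.σ j * A.r j)⁻¹ • (y - A.c j))| := by
        field_simp
    _ ≤ _ := by
        have h0 := A.σ₀_pos
        gcongr
        · exact A.le_σ j

/-- The admissible cut-off functions near `c j`. -/
structure IsAdmissible (j : ι) (η : Euc d → ℝ) : Prop where
  supp : tsupport η ⊆ A.Z j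
  bound : ∀ L, ∀ y ∈ tsupport η, y ∈ Ω → A.r j ^ L.length * |partials L η y| ≤ A.bd L

theorem isAdmissible_φ (j : ι) : A.IsAdmissible j (A.φ j) :=
  ⟨A.tsupport_φ_subset j, fun L _ => A.bound_φ j L⟩

theorem isAdmissible_ψ (j : ι) : A.IsAdmissible j (A.ψ j) :=
  ⟨A.tsupport_ψ_subset j, fun L y _ _ => A.bound_ψ j L y⟩

theorem bd_nonneg (j : ι) (L : List (Fin d)) : 0 ≤ A.bd L :=
  (mul_nonneg (pow_nonneg (A.r_pos j).le _) (abs_nonneg _)).trans (A.bound_ψ j L 0)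

/-- The square of the constant in the localization estimates. -/
def K (m : ℕ) (a : ℝ) : ℝ≥0 :=
  A.κ * leibnizConst d m A.bd * weightConst A.ratio m a + 1

/-- The summand `1` in `K` ensures that `K · ∞ = ∞`, which disposes of infinite norms, and that `K ≤
K²`. -/
theorem K_ne_zero (m : ℕ) (a : ℝ) : ((A.K m a : ℝ≥0) : ℝ≥0∞) ≠ 0 := by
  simp [K]

/-- The derivatives of `φ j` are only controlled on `Ω`. This suffices on a model set too, since
there the support of the cut-off function lies in `Ω` and elsewhere all derivatives vanish. -/
theorem derivs_bound {Ω₁ Ω₂ : Opens (Euc d)} {j : ι} {η : Cutoff Ω₁ Ω₂}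
    (hη : A.IsAdmissible j η.toFun) (hΩ : ∀ y ∈ tsupport η.toFun, y ∈ Ω₁ → y ∈ Ω)
    (L : List (Fin d)) (y : Euc d) (hy : y ∈ Ω₁) :
    A.r j ^ L.length * |(η.derivs L).toFun y| ≤ A.bd L := by
  by_cases h : y ∈ tsupport η.toFun
  · rw [Cutoff.derivs_toFun]
    exact hη.bound L y h (hΩ y h hy)
  · rw [η.derivs_apply_eq_zero L h]
    simpa using A.bd_nonneg j L

theorem measurable_w (A : LocalCover Ω w ι) : Measurable w := A.lip.continuous.measurable

/-- By Tonelli's theorem the sum becomes an integral in which each point is counted at most `κ`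
times. -/
theorem tsum_energy_ball_le [Countable ι] {m : ℕ} {a : ℝ} {T : 𝓓(Ω, ℝ) → ℂ}
    {f : (Fin d → ℕ) → Euc d → ℂ} (hf : HasWeakDerivs m T f) :
    ∑' j, energy w m a (Ω ∩ A.Z j) f ≤ A.κ * energy w m a Ω f := by
  simp only [energy]
  rw [Summable.tsum_finsetSum fun _ _ => ENNReal.summable, Finset.mul_sum]
  refine Finset.sum_le_sum fun α hα => ?_
  set F := fun x => ‖((w x ^ (((∑ i, α i : ℕ) : ℝ) - a) : ℝ) : ℂ) * f α x‖ₑ ^ 2 with hF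
  have hm : AEMeasurable F (volume.restrict (Ω : Set (Euc d))) :=
    aemeasurable_weighted A.measurable_w _ (hf.aemeasurable hα)
  have e : ∀ j, ∫⁻ x in (Ω : Set (Euc d)) ∩ A.Z j, F x =
      ∫⁻ x in (Ω : Set (Euc d)), (A.Z j).indicator F x := fun j => by
    rw [lintegral_indicator (A.isClosed_Z j).measurableSet,
      Measure.restrict_restrict (A.isClosed_Z j).measurableSet, inter_comm]
  simp only [e]
  rw [← lintegral_tsum fun j => hm.indicator (A.isClosed_Z j).measurableSet,
    ← lintegral_const_mul' _ _ (by simp)]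
  refine setLIntegral_mono' Ω.isOpen.measurableSet fun x hx => ?_
  have hfin : {j | x ∈ A.Z j}.Finite := finite_of_encard_le_coe (A.encard_Z_le hx)
  have hcard : (hfin.toFinset.card : ℝ≥0∞) ≤ A.κ := by
    have := A.encard_Z_le hx
    rw [hfin.encard_eq_coe_toFinset_card] at this
    exact_mod_cast this
  rw [tsum_eq_sum (f := fun j => (A.Z j).indicator F x) (s := hfin.toFinset) fun j hj =>
    indicator_of_notMem (show x ∉ A.Z j from fun h => hj (hfin.mem_toFinset.2 h)) F]
  calc _ ≤ ∑ j ∈ hfin.toFinset, F x :=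
        Finset.sum_le_sum fun j _ => indicator_le_self' (fun _ _ => zero_le) x
    _ = hfin.toFinset.card * F x := by rw [Finset.sum_const, nsmul_eq_mul]
    _ ≤ _ := by gcongr

/-- The local norms are controlled by the global one. -/
theorem tsum_pull_le [Countable ι] (m : ℕ) (a : ℝ) (η : ∀ j, Cutoff (A.M j) Ω)
    (hη : ∀ j, A.IsAdmissible j (η j).toFun) (T : 𝓓(Ω, ℝ) →ₗ[ℝ] ℂ) :
    ∑' j, weightedSobolevSq (fun _ => A.r j) m a ((η j).pull T) ≤
      A.K m a * weightedSobolevSq w m a T := by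
  by_cases hT : weightedSobolevSq w m a T < ⊤
  swap
  · rw [not_lt_top_iff] at hT
    rw [hT, ENNReal.mul_top (A.K_ne_zero m a)]
    exact le_top
  obtain ⟨f, hf⟩ := exists_hasWeakDerivs hT
  rw [hf.weightedSobolevSq_eq]
  have key : ∀ j, weightedSobolevSq (fun _ => A.r j) m a ((η j).pull T) ≤
      leibnizConst d m A.bd * (weightConst A.ratio m a * energy w m a (Ω ∩ A.Z j) f) := by
    intro j
    rw [(hf.pull (η j)).weightedSobolevSq_eq]
    refine (energy_leibniz_le m a A.bd (A.r_pos j) (η j)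
      (A.derivs_bound (hη j) (η j).supp) hf).trans ?_
    have hsub : ((A.M j : Set (Euc d)) ∩ tsupport (η j).toFun) ⊆ Ω ∩ A.Z j :=
      fun y hy => ⟨(η j).supp y hy.2 hy.1, (hη j).supp hy.2⟩
    gcongr
    refine (energy_mono hsub f).trans ?_
    refine energy_le_of_comparable A.one_le_ratio m a
      (Ω.isOpen.measurableSet.inter (A.isClosed_Z j).measurableSet) (fun _ _ => A.r_pos j)
      (fun x hx => A.pos x hx.1) (fun x hx => A.r_le (A.Z_subset_ball j hx.2))
      (fun x hx => A.le_r (A.Z_subset_ball j hx.2)) f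
  calc _ ≤ ∑' j, leibnizConst d m A.bd * (weightConst A.ratio m a * energy w m a (Ω ∩ A.Z j) f) :=
        ENNReal.tsum_le_tsum key
    _ = leibnizConst d m A.bd * (weightConst A.ratio m a * ∑' j, energy w m a (Ω ∩ A.Z j) f) := by
        rw [ENNReal.tsum_mul_left, ENNReal.tsum_mul_left]
    _ ≤ leibnizConst d m A.bd * (weightConst A.ratio m a * (A.κ * energy w m a Ω f)) := by
        gcongr; exact A.tsum_energy_ball_le hf
    _ = (A.κ * leibnizConst d m A.bd * weightConst A.ratio m a) * energy w m a Ω f := by ring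
    _ ≤ _ := by
        gcongr
        rw [K]; push_cast
        exact le_self_add

/-- The global norm is controlled by the local ones. -/
theorem le_tsum_pull [Countable ι] (m : ℕ) (a : ℝ) (η : ∀ j, Cutoff Ω (A.M j))
    (hη : ∀ j, A.IsAdmissible j (η j).toFun) (T : 𝓓(Ω, ℝ) → ℂ) (S : ∀ j, 𝓓(A.M j, ℝ) →ₗ[ℝ] ℂ)
    (hT : IsLocallyFiniteSum A.Z T fun j => (η j).pull (S j)) :
    weightedSobolevSq w m a T ≤
      A.K m a * ∑' j, weightedSobolevSq (fun _ => A.r j) m a (S j) := by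
  by_cases hS : ∀ j, weightedSobolevSq (fun _ => A.r j) m a (S j) < ⊤
  swap
  · push Not at hS
    obtain ⟨j, hj⟩ := hS
    rw [ENNReal.tsum_eq_top_of_eq_top ⟨j, top_le_iff.1 hj⟩, ENNReal.mul_top (A.K_ne_zero m a)]
    exact le_top
  choose f hf using fun j => exists_hasWeakDerivs (hS j)
  have hp : ∀ j, HasWeakDerivs m ((η j).pull (S j)) ((η j).leibniz (f j)) := fun j =>
    (hf j).pull (η j)
  have hz : ∀ j α, ∀ x ∉ A.Z j, (η j).leibniz (f j) α x = 0 := fun j α x hx =>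
    (η j).leibniz_eq_zero _ _ fun h => hx ((hη j).supp h)
  rw [(hT.hasWeakDerivs hp hz).weightedSobolevSq_eq]
  have key : ∀ j, energy w m a Ω ((η j).leibniz (f j)) ≤
      leibnizConst d m A.bd * (weightConst A.ratio m a *
        weightedSobolevSq (fun _ => A.r j) m a (S j)) := by
    intro j
    have hmeas := (A.isClosed_Z j).measurableSet
    -- The weights `w` and `r j` are comparable only near the center, so the integral is first
    -- restricted to `Z j`, outside of which the piece vanishes.
    rw [energy_eq_of_subset hmeas Ω.isOpen.measurableSet fun α x hx => hz j α x hx.2,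
      (hf j).weightedSobolevSq_eq]
    refine (energy_le_of_comparable (v := fun _ => A.r j) A.one_le_ratio m a
      (Ω.isOpen.measurableSet.inter hmeas)
      (fun x hx => A.pos x hx.1) (fun _ _ => A.r_pos j) (fun x hx => A.le_r (A.Z_subset_ball j hx.2))
      (fun x hx => A.r_le (A.Z_subset_ball j hx.2)) _).trans ?_
    rw [mul_left_comm]
    gcongr
    refine (energy_mono inter_subset_left _).trans ?_
    refine (energy_leibniz_le m a A.bd (A.r_pos j) (η j)
      (A.derivs_bound (hη j) fun _ _ h => h) (hf j)).trans ?_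
    gcongr
    exact energy_mono (fun y hy => (η j).supp y hy.2 hy.1) _
  calc _ ≤ A.κ * ∑' j, energy w m a Ω ((η j).leibniz (f j)) :=
        energy_tsum_le A.measurable_w hp hz fun x hx => A.encard_Z_le hx
    _ ≤ A.κ * ∑' j, leibnizConst d m A.bd * (weightConst A.ratio m a *
        weightedSobolevSq (fun _ => A.r j) m a (S j)) := by
        gcongr with j; exact key j
    _ = (A.κ * leibnizConst d m A.bd * weightConst A.ratio m a) *
        ∑' j, weightedSobolevSq (fun _ => A.r j) m a (S j) := by
        rw [ENNReal.tsum_mul_left, ENNReal.tsum_mul_left]; ring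
    _ ≤ _ := by
        gcongr
        rw [K]; push_cast
        exact le_self_add

/-- Multiplication with `φ j`, from `M j` to `Ω`. -/
def φM (j : ι) : Cutoff (A.M j) Ω := A.ofModel j (A.φ j) (A.smooth j) (A.tsupport_φ_subset j)

/-- Multiplication with `φ j`, from `Ω` to `M j`. -/
def φΩ (j : ι) : Cutoff Ω (A.M j) := A.toModel j (A.φ j) (A.smooth j) (A.tsupport_φ_subset j)

/-- Multiplication with `ψ j`, from `M j` to `Ω`. -/
def ψM (j : ι) : Cutoff (A.M j) Ω := A.ofModel j (A.ψ j) (A.smooth_ψ j) (A.tsupport_ψ_subset j)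

/-- Multiplication with `ψ j`, from `Ω` to `M j`. -/
def ψΩ (j : ι) : Cutoff Ω (A.M j) := A.toModel j (A.ψ j) (A.smooth_ψ j) (A.tsupport_ψ_subset j)

/-- The functional `φ j T` on the model set `M j`. -/
def loc (j : ι) (T : 𝓓(Ω, ℝ) →ₗ[ℝ] ℂ) : 𝓓(A.M j, ℝ) →ₗ[ℝ] ℂ := (A.φM j).pull T

/-- The norm defined by the localizations. -/
def locNorm (m : ℤ) (a : ℝ) (T : 𝓓(Ω, ℝ) →ₗ[ℝ] ℂ) : ℝ≥0∞ :=
  (∑' j, kondNorm (fun _ => A.r j) m a (A.loc j T) ^ 2) ^ (1 / 2 : ℝ)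

/-- Inserting `ψ j` is harmless because `φ j ψ j = φ j`. It makes `ψ j g` a test function on the
model set, to which `φ j T` can be applied. -/
theorem eq_sum_φ_mul {F : Type*} [NormedAddCommGroup F] [NormedSpace ℝ F] (g : 𝓓(Ω, F))
    (s : Finset ι) (hs : ∀ j, (A.Z j ∩ tsupport g).Nonempty → j ∈ s) :
    g = ∑ j ∈ s, (A.φM j).mul ((A.ψΩ j).mul g) := by
  ext y
  have h1 : ∀ j, (A.φM j).mul ((A.ψΩ j).mul g) y = A.φ j y • g y := by
    intro j
    rw [Cutoff.mul_apply, Cutoff.mul_apply, smul_smul]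
    congr 1
    exact A.φ_mul_ψ j y
  have h2 : (∑ j ∈ s, (A.φM j).mul ((A.ψΩ j).mul g)) y =
      ∑ j ∈ s, (A.φM j).mul ((A.ψΩ j).mul g) y := by
    simp
  rw [h2, Finset.sum_congr rfl fun j _ => h1 j, ← Finset.sum_smul]
  by_cases hy : y ∈ tsupport g
  · rw [A.sum_φ_eq (g.tsupport_subset hy) fun j hj => hs j ⟨y, hj, hy⟩, one_smul]
  · rw [image_eq_zero_of_notMem_tsupport hy, smul_zero]

theorem isLocallyFiniteSum_loc (T : 𝓓(Ω, ℝ) →ₗ[ℝ] ℂ) :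
    IsLocallyFiniteSum A.Z T fun j => (A.ψΩ j).pull (A.loc j T) where
  finite _ hK hKc := A.finite_meets hK hKc
  eq_sum g s hs := by
    conv_lhs => rw [A.eq_sum_φ_mul g s hs, map_sum]
    rfl

theorem one_le_K (m : ℕ) (a : ℝ) : 1 ≤ A.K m a := by
  rw [K]; exact le_add_self

theorem tsum_loc_le [Countable ι] (n : ℕ) (a : ℝ) (T : 𝓓(Ω, ℝ) →ₗ[ℝ] ℂ) :
    ∑' j, weightedSobolevSq (fun _ => A.r j) n a (A.loc j T) ≤
      A.K n a * weightedSobolevSq w n a T :=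
  A.tsum_pull_le n a A.φM A.isAdmissible_φ T

theorem le_tsum_loc [Countable ι] (n : ℕ) (a : ℝ) (T : 𝓓(Ω, ℝ) →ₗ[ℝ] ℂ) :
    weightedSobolevSq w n a T ≤
      A.K n a * ∑' j, weightedSobolevSq (fun _ => A.r j) n a (A.loc j T) :=
  A.le_tsum_pull n a A.ψΩ A.isAdmissible_ψ T _ (A.isLocallyFiniteSum_loc T)

/-- Expand `T f = ∑ (φ j T)(ψ j f)`, estimate each term by duality on the model set, and apply
Cauchy-Schwarz; the norms of the `ψ j f` are square summable by the localization estimate in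
positive order. -/
theorem kondNorm_neg_le [Countable ι] (n : ℕ) (a : ℝ) (T : 𝓓(Ω, ℝ) →ₗ[ℝ] ℂ) :
    kondNorm w (Int.negSucc n) a T ≤ A.K (n + 1) (-a) * A.locNorm (Int.negSucc n) a T := by
  refine iSup_le fun f => ENNReal.div_le_of_le_mul ?_
  set s := (A.finite_meets f.tsupport_subset f.hasCompactSupport).toFinset
  have hf := A.eq_sum_φ_mul f s fun j hj =>
    (A.finite_meets f.tsupport_subset f.hasCompactSupport).mem_toFinset.2 hj
  have h1 : complexEval T f = ∑ j ∈ s, complexEval (A.loc j T) ((A.ψΩ j).mul f) := by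
    have := congrArg (complexEvalₗ T) hf
    rw [map_sum] at this
    refine this.trans (Finset.sum_congr rfl fun j _ => ?_)
    exact (complexEval_pull T (A.φM j) _).symm
  have h2 : ∑' j, weightedSobolevSq (fun _ => A.r j) (n + 1) (-a) (ofTest ((A.ψΩ j).mul f)) ≤
      A.K (n + 1) (-a) * weightedSobolevSq w (n + 1) (-a) (ofTest f) := by
    have := A.tsum_pull_le (n + 1) (-a) A.ψM A.isAdmissible_ψ (ofTestLin f)
    simpa only [(A.ψM _).pull_ofTest (A.ψΩ _) rfl, coe_ofTestLin] using this
  calc ‖complexEval T f‖ₑ ≤ ∑ j ∈ s, ‖complexEval (A.loc j T) ((A.ψΩ j).mul f)‖ₑ := by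
        rw [h1]; exact enorm_sum_le _ _
    _ ≤ ∑ j ∈ s, kondNorm (fun _ => A.r j) (Int.negSucc n) a (A.loc j T) *
        weightedSobolevSq (fun _ => A.r j) (n + 1) (-a) (ofTest ((A.ψΩ j).mul f)) ^ (1 / 2 : ℝ) :=
        Finset.sum_le_sum fun j _ =>
          enorm_complexEval_le continuous_const (fun _ _ => A.r_pos j) n a _ _
    _ ≤ ∑' j, kondNorm (fun _ => A.r j) (Int.negSucc n) a (A.loc j T) *
        weightedSobolevSq (fun _ => A.r j) (n + 1) (-a) (ofTest ((A.ψΩ j).mul f)) ^ (1 / 2 : ℝ) :=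
        ENNReal.sum_le_tsum s
    _ ≤ A.locNorm (Int.negSucc n) a T * (∑' j, weightedSobolevSq (fun _ => A.r j) (n + 1) (-a)
        (ofTest ((A.ψΩ j).mul f))) ^ (1 / 2 : ℝ) := by
        refine (tsum_cauchySchwarz _ _).trans_eq ?_
        simp only [rpow_half_sq, locNorm]
    _ ≤ A.locNorm (Int.negSucc n) a T *
        (A.K (n + 1) (-a) * weightedSobolevSq w (n + 1) (-a) (ofTest f) ^ (1 / 2 : ℝ)) := by
        gcongr
        rw [rpow_half_le_iff, mul_pow, rpow_half_sq]
        refine h2.trans ?_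
        gcongr
        exact_mod_cast le_self_pow₀ (A.one_le_K _ _) two_ne_zero
    _ = _ := by ring

theorem isLocallyFiniteSum_ofTest (η : ∀ j, Cutoff (A.M j) Ω)
    (hη : ∀ j, tsupport (η j).toFun ⊆ A.Z j) {s : Finset ι} {f : ∀ j, 𝓓(A.M j, ℂ)}
    (hf : ∀ j ∉ s, f j = 0) :
    IsLocallyFiniteSum A.Z (ofTest (∑ j ∈ s, (η j).mul (f j)))
      fun j => ofTest ((η j).mul (f j)) where
  finite _ hK hKc := A.finite_meets hK hKc
  eq_sum g t ht := by
    classical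
    have e1 : ofTest (∑ j ∈ s, (η j).mul (f j)) = ∑ j ∈ s, ofTest ((η j).mul (f j)) :=
      map_sum ofTestₗ _ _
    have hz : ofTest (0 : 𝓓(Ω, ℂ)) = 0 := map_zero ofTestₗ
    rw [e1, Finset.sum_apply]
    have z1 : ∀ j ∉ s, ofTest ((η j).mul (f j)) g = 0 := fun j hj => by
      rw [hf j hj, map_zero, hz]; rfl
    have z2 : ∀ j ∉ t, ofTest ((η j).mul (f j)) g = 0 := fun j hj => by
      rw [ofTest]
      refine integral_eq_zero_of_ae (Eventually.of_forall fun x => ?_)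
      by_cases hx : x ∈ tsupport g
      · have : x ∉ tsupport (η j).toFun := fun h => hj (ht j ⟨x, hη j h, hx⟩)
        simp [image_eq_zero_of_notMem_tsupport this]
      · simp [image_eq_zero_of_notMem_tsupport hx]
    -- Terms outside `s` vanish because `f j = 0`, those outside `t` because the supports do not
    -- meet; both sums reduce to `s ∩ t`.
    rw [← Finset.sum_subset (Finset.inter_subset_left (s₁ := s) (s₂ := t)),
      ← Finset.sum_subset (Finset.inter_subset_right (s₁ := s) (s₂ := t))]
    · intro j hj hj'
      exact z1 j fun h => hj' (Finset.mem_inter.2 ⟨h, hj⟩)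
    · intro j hj hj'
      exact z2 j fun h => hj' (Finset.mem_inter.2 ⟨hj, h⟩)

/-- Synthesis with `φ j` is the transpose of `loc`. This bound in positive order is what yields the
localization bound in negative order. -/
theorem weightedSobolevSq_sum_φ_mul_le [Countable ι] (n : ℕ) (a : ℝ) (s : Finset ι)
    (f : ∀ j, 𝓓(A.M j, ℂ)) :
    weightedSobolevSq w n a (ofTest (∑ j ∈ s, (A.φM j).mul (f j))) ≤
      A.K n a * ∑ j ∈ s, weightedSobolevSq (fun _ => A.r j) n a (ofTest (f j)) := by
  classical
  set f' : ∀ j, 𝓓(A.M j, ℂ) := fun j => if j ∈ s then f j else 0 with hf'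
  have h0 : ∀ j ∉ s, f' j = 0 := fun j hj => by simp [hf', hj]
  have h1 : ∀ j ∈ s, f' j = f j := fun j hj => by simp [hf', hj]
  have hpull : ∀ j, (A.φΩ j).pull (ofTestLin (f' j)) = ofTestLin ((A.φM j).mul (f' j)) :=
    fun j => (A.φΩ j).pull_ofTest (A.φM j) rfl (f' j)
  have key := A.le_tsum_pull n a A.φΩ A.isAdmissible_φ
    (ofTest (∑ j ∈ s, (A.φM j).mul (f' j))) (fun j => ofTestLin (f' j)) (by
      simp only [hpull, coe_ofTestLin]
      exact A.isLocallyFiniteSum_ofTest A.φM A.tsupport_φ_subset h0)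
  rw [Finset.sum_congr rfl fun j hj => by rw [h1 j hj]] at key
  refine key.trans ?_
  gcongr
  rw [tsum_eq_sum (s := s)]
  · exact (Finset.sum_congr rfl fun j hj => by rw [coe_ofTestLin, h1 j hj]).le
  · intro j hj
    have : ofTest (0 : 𝓓(A.M j, ℂ)) = 0 := map_zero ofTestₗ
    rw [coe_ofTestLin, h0 j hj, this, ← rpow_half_sq (weightedSobolevSq _ _ _ _)]
    exact (congrArg (· ^ 2) (isESeminorm_weightedSobolev measurable_const n a).map_zero).trans
      (by simp)

/-- The quotient that enters the norms of negative order. -/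
def dualQuot (n : ℕ) (a : ℝ) (T : 𝓓(Ω, ℝ) →ₗ[ℝ] ℂ) (j : ι) (f : 𝓓(A.M j, ℂ)) : ℝ≥0∞ :=
  ‖complexEval (A.loc j T) f‖ₑ /
    weightedSobolevSq (fun _ => A.r j) (n + 1) (-a) (ofTest f) ^ (1 / 2 : ℝ)

/-- The duality of `ℓ²` with itself. Let `Y` be the left-hand side. The test function `G = ∑ b j φ j
f j` is chosen so that `T G = Y`, while synthesis gives `‖G‖² ≤ K Y`. Then `Y² ≤ ‖T‖² K Y`, and one
divides by `Y`. -/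
theorem sum_dualQuot_le [Countable ι] (n : ℕ) (a : ℝ) (T : 𝓓(Ω, ℝ) →ₗ[ℝ] ℂ) (s : Finset ι)
    (f : ∀ j, 𝓓(A.M j, ℂ)) :
    ∑ j ∈ s, A.dualQuot n a T j (f j) ^ 2 ≤
      A.K (n + 1) (-a) * kondNorm w (Int.negSucc n) a T ^ 2 := by
  set q : ι → ℝ≥0∞ := fun j => weightedSobolevSq (fun _ => A.r j) (n + 1) (-a) (ofTest (f j))
  have hq : ∀ j, q j < ⊤ := fun j =>
    weightedSobolevSq_ofTest_lt_top continuous_const (fun _ _ => A.r_pos j) _ _ _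
  set z : ι → ℂ := fun j => complexEval (A.loc j T) (f j)
  -- Indices with vanishing denominator then contribute nothing, as `0 / 0 = 0` both in `ℝ≥0∞` and
  -- in the coefficients `b j`.
  have hz : ∀ j, q j = 0 → z j = 0 := by
    intro j hj
    have := enorm_complexEval_le continuous_const (fun _ _ => A.r_pos j) n a (A.loc j T) (f j)
    have h1 : weightedSobolevSq (fun _ => A.r j) (n + 1) (-a) (ofTest (f j)) = 0 := hj
    have h2 : ofTest (f j) = ofTest 0 := by
      rw [eq_zero_of_weightedSobolevSq_eq_zero measurable_const (fun _ _ => A.r_pos j) h1]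
      exact (map_zero ofTestₗ).symm
    have h3 := ofTest_injective h2
    change complexEval (A.loc j T) (f j) = 0
    rw [h3]; exact map_zero (complexEvalₗ (A.loc j T))
  -- The choice of equality in Cauchy-Schwarz: both `b j z j` and `|b j|² q j` equal `|z j|² / q j`.
  set b : ι → ℂ := fun j => (starRingEnd ℂ) (z j) / ((q j).toReal : ℂ)
  have ht : ∀ j, A.dualQuot n a T j (f j) ^ 2 = ‖z j‖ₑ ^ 2 / q j := by
    intro j
    rw [dualQuot, ENNReal.div_eq_inv_mul, mul_pow, ← ENNReal.inv_pow, rpow_half_sq,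
      ENNReal.div_eq_inv_mul]
  have hbz : ∀ j, ENNReal.ofReal ((b j * z j).re) = ‖z j‖ₑ ^ 2 / q j ∧ (b j * z j).im = 0 ∧
      0 ≤ (b j * z j).re := by
    intro j
    have e : b j * z j = ((‖z j‖ ^ 2 / (q j).toReal : ℝ) : ℂ) := by
      simp only [b]
      rw [div_mul_eq_mul_div, Complex.conj_mul']
      push_cast; rfl
    rw [e, Complex.ofReal_re, Complex.ofReal_im]
    refine ⟨?_, rfl, by positivity⟩
    by_cases h0 : q j = 0
    · simp [h0, hz j h0]
    · rw [ENNReal.ofReal_div_of_pos (ENNReal.toReal_pos h0 (hq j).ne),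
        ENNReal.ofReal_toReal (hq j).ne, ENNReal.ofReal_pow (norm_nonneg _), ofReal_norm]
  have hbq : ∀ j, ‖b j‖ₑ ^ 2 * q j = ‖z j‖ₑ ^ 2 / q j := by
    intro j
    by_cases h0 : q j = 0
    · simp [h0, hz j h0]
    · have hp := ENNReal.toReal_pos h0 (hq j).ne
      have e : ‖b j‖ₑ = ‖z j‖ₑ / q j := by
        rw [← ofReal_norm, norm_div, Complex.norm_real, Real.norm_of_nonneg hp.le,
          ENNReal.ofReal_div_of_pos hp, ENNReal.ofReal_toReal (hq j).ne, RCLike.norm_conj, ofReal_norm]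
      rw [e, ENNReal.div_eq_inv_mul, ENNReal.div_eq_inv_mul, mul_pow]
      calc (q j)⁻¹ ^ 2 * ‖z j‖ₑ ^ 2 * q j = (q j)⁻¹ * ‖z j‖ₑ ^ 2 * ((q j)⁻¹ * q j) := by ring
        _ = _ := by rw [ENNReal.inv_mul_cancel h0 (hq j).ne, mul_one]
  set Y : ℝ≥0∞ := ∑ j ∈ s, ‖z j‖ₑ ^ 2 / q j with hY
  have hYt : Y ≠ ⊤ := by
    refine (ENNReal.sum_lt_top.2 fun j _ => ?_).ne
    rw [← (hbz j).1]; exact ENNReal.ofReal_lt_top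
  set G : 𝓓(Ω, ℂ) := ∑ j ∈ s, (A.φM j).mul (b j • f j)
  have hG1 : ‖complexEval T G‖ₑ = Y := by
    have e1 : complexEval T G = ∑ j ∈ s, b j * z j := by
      change complexEvalₗ T G = _
      rw [map_sum]
      refine Finset.sum_congr rfl fun j _ => ?_
      rw [complexEvalₗ_apply, ← complexEval_pull]
      exact complexEval_smul _ _ _
    have e2 : ∑ j ∈ s, b j * z j = ((∑ j ∈ s, (b j * z j).re : ℝ) : ℂ) := by
      push_cast
      refine Finset.sum_congr rfl fun j _ => ?_
      apply Complex.ext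
      · simp
      · rw [(hbz j).2.1]; simp
    rw [e1, e2, enorm_ofReal_of_nonneg (Finset.sum_nonneg fun j _ => (hbz j).2.2),
      ENNReal.ofReal_sum_of_nonneg fun j _ => (hbz j).2.2, hY]
    exact Finset.sum_congr rfl fun j _ => (hbz j).1
  have hG2 : weightedSobolevSq w (n + 1) (-a) (ofTest G) ≤ A.K (n + 1) (-a) * Y := by
    refine (A.weightedSobolevSq_sum_φ_mul_le (n + 1) (-a) s fun j => b j • f j).trans ?_
    gcongr
    refine Finset.sum_le_sum fun j _ => ?_
    rw [← hbq j, ← rpow_half_sq (weightedSobolevSq _ _ _ _), ofTest_smul,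
      (isESeminorm_weightedSobolev (Ω := A.M j) (w := fun _ => A.r j) measurable_const (n + 1)
        (-a)).smul_eq, mul_pow, rpow_half_sq]
  have hmain : Y ^ 2 ≤ (A.K (n + 1) (-a) * kondNorm w (Int.negSucc n) a T ^ 2) * Y := by
    have := enorm_complexEval_le A.lip.continuous A.pos n a T G
    rw [hG1] at this
    calc Y ^ 2 ≤ (kondNorm w (Int.negSucc n) a T *
          weightedSobolevSq w (n + 1) (-a) (ofTest G) ^ (1 / 2 : ℝ)) ^ 2 := by gcongr
      _ = kondNorm w (Int.negSucc n) a T ^ 2 * weightedSobolevSq w (n + 1) (-a) (ofTest G) := by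
          rw [mul_pow, rpow_half_sq]
      _ ≤ kondNorm w (Int.negSucc n) a T ^ 2 * (A.K (n + 1) (-a) * Y) := by gcongr
      _ = _ := by ring
  rw [Finset.sum_congr rfl fun j _ => ht j, ← hY]
  by_cases hY0 : Y = 0
  · rw [hY0]; exact zero_le
  · rw [sq] at hmain
    exact (ENNReal.mul_le_mul_iff_left hY0 hYt).1 hmain

/-- Each local supremum is attained up to the factor `2` by some `f j`, and `sum_dualQuot_le` bounds
the sum of squares for all these choices at once. -/
theorem locNorm_neg_le [Countable ι] (n : ℕ) (a : ℝ) (T : 𝓓(Ω, ℝ) →ₗ[ℝ] ℂ) :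
    A.locNorm (Int.negSucc n) a T ≤
      2 * A.K (n + 1) (-a) * kondNorm w (Int.negSucc n) a T := by
  by_cases hX : kondNorm w (Int.negSucc n) a T = ⊤
  · rw [hX, ENNReal.mul_top (by simpa using A.K_ne_zero (n + 1) (-a))]; exact le_top
  have hsup : ∀ j, kondNorm (fun _ => A.r j) (Int.negSucc n) a (A.loc j T) =
      ⨆ f, A.dualQuot n a T j f := fun j => rfl
  -- Half of the supremum lies strictly below it only if it is finite and nonzero. Finiteness comes
  -- from `sum_dualQuot_le` for a single index.
  have hfin : ∀ j, kondNorm (fun _ => A.r j) (Int.negSucc n) a (A.loc j T) < ⊤ := by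
    intro j
    rw [hsup]
    refine lt_of_le_of_lt (iSup_le (a := ((A.K (n + 1) (-a) : ℝ≥0∞) *
      kondNorm w (Int.negSucc n) a T ^ 2) ^ (1 / 2 : ℝ)) fun f => ?_) ?_
    · classical
      have := A.sum_dualQuot_le n a T {j} (Function.update 0 j f)
      rw [Finset.sum_singleton, Function.update_self] at this
      rw [← sq_rpow_half (A.dualQuot n a T j f)]
      gcongr
    · exact ENNReal.rpow_lt_top_of_nonneg (by norm_num)
        (ENNReal.mul_ne_top (by simp) (by simp [hX]))
  have hex : ∀ j, ∃ f, kondNorm (fun _ => A.r j) (Int.negSucc n) a (A.loc j T) ≤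
      2 * A.dualQuot n a T j f := by
    intro j
    by_cases h0 : kondNorm (fun _ => A.r j) (Int.negSucc n) a (A.loc j T) = 0
    · exact ⟨0, by rw [h0]; exact zero_le⟩
    · have := ENNReal.half_lt_self h0 (hfin j).ne
      rw [hsup j] at this
      obtain ⟨f, hf⟩ := lt_iSup_iff.1 this
      refine ⟨f, ?_⟩
      rw [← hsup j] at hf
      have := (ENNReal.div_le_iff (by simp) (by simp)).1 hf.le
      rwa [mul_comm]
  choose f hf using hex
  rw [locNorm, rpow_half_le_iff, ENNReal.tsum_eq_iSup_sum]
  refine iSup_le fun s => ?_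
  calc ∑ j ∈ s, kondNorm (fun _ => A.r j) (Int.negSucc n) a (A.loc j T) ^ 2
      ≤ ∑ j ∈ s, (2 * A.dualQuot n a T j (f j)) ^ 2 := by
        gcongr with j; exact hf j
    _ = 4 * ∑ j ∈ s, A.dualQuot n a T j (f j) ^ 2 := by
        simp only [mul_pow, ← Finset.mul_sum]; norm_num
    _ ≤ 4 * (A.K (n + 1) (-a) * kondNorm w (Int.negSucc n) a T ^ 2) := by
        gcongr; exact A.sum_dualQuot_le n a T s f
    _ ≤ 4 * ((A.K (n + 1) (-a)) ^ 2 * kondNorm w (Int.negSucc n) a T ^ 2) := by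
        gcongr
        exact_mod_cast le_self_pow₀ (A.one_le_K _ _) two_ne_zero
    _ = _ := by ring

/-- The localized norm is equivalent to the global one. -/
theorem exists_equiv [Countable ι] (m : ℤ) (a : ℝ) :
    ∃ C : ℝ≥0, 1 ≤ C ∧ ∀ T : 𝓓(Ω, ℝ) →ₗ[ℝ] ℂ,
      A.locNorm m a T ≤ C * kondNorm w m a T ∧ kondNorm w m a T ≤ C * A.locNorm m a T := by
  cases m with
  | ofNat n =>
    refine ⟨A.K n a, A.one_le_K n a, fun T => ?_⟩
    have hK : (A.K n a : ℝ≥0∞) ≤ A.K n a ^ 2 := by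
      exact_mod_cast le_self_pow₀ (A.one_le_K n a) two_ne_zero
    have e : ∑' j, kondNorm (fun _ => A.r j) (Int.ofNat n) a (A.loc j T) ^ 2 =
        ∑' j, weightedSobolevSq (fun _ => A.r j) n a (A.loc j T) :=
      tsum_congr fun j => rpow_half_sq _
    have e' : kondNorm w (Int.ofNat n) a T = weightedSobolevSq w n a T ^ (1 / 2 : ℝ) := rfl
    rw [locNorm, e, e', rpow_half_le_iff, rpow_half_le_iff, mul_pow, mul_pow, rpow_half_sq,
      rpow_half_sq]
    exact ⟨(A.tsum_loc_le n a T).trans (by gcongr), (A.le_tsum_loc n a T).trans (by gcongr)⟩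
  | negSucc n =>
    refine ⟨2 * A.K (n + 1) (-a), ?_, fun T => ⟨?_, ?_⟩⟩
    · have := A.one_le_K (n + 1) (-a)
      calc (1 : ℝ≥0) ≤ A.K (n + 1) (-a) := this
        _ ≤ _ := by rw [two_mul]; exact le_self_add
    · push_cast; exact A.locNorm_neg_le n a T
    · push_cast
      refine (A.kondNorm_neg_le n a T).trans ?_
      gcongr
      rw [two_mul]; exact le_self_add

/-- Since the model set agrees with `Ω` near the support of `φ j`, the product in `dilatedProduct`
is always a test function on `Ω`, and the default value in `evalFun` never occurs. -/
theorem dilatedProduct_eq (u : 𝓓'(Ω, ℂ)) (j : ι) :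
    dilatedProduct u (A.φ j) (A.c j) (w (A.c j)) (A.M j) =
      dilate (A.dil j) (A.r_pos j) (A.loc j (Distribution.toLin u)) := by
  funext g
  have h := ((A.φM j).mul (dilTest (A.dil j) (A.r_pos j) g))
  have hc : (fun y => A.φ j y * g (A.c j + (w (A.c j))⁻¹ • (y - A.c j))) =
      ((A.φM j).mul (dilTest (A.dil j) (A.r_pos j) g) : Euc d → ℝ) := rfl
  have hcond : ContDiff ℝ ∞ ((A.φM j).mul (dilTest (A.dil j) (A.r_pos j) g) : Euc d → ℝ) ∧
      HasCompactSupport ((A.φM j).mul (dilTest (A.dil j) (A.r_pos j) g) : Euc d → ℝ) ∧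
      tsupport ((A.φM j).mul (dilTest (A.dil j) (A.r_pos j) g) : Euc d → ℝ) ⊆ Ω :=
    ⟨TestFunction.contDiff _, TestFunction.hasCompactSupport _, TestFunction.tsupport_subset _⟩
  rw [dilatedProduct, dilate, hc, evalFun, dif_pos hcond]
  rfl

/-- The weighted sum of the norms of the dilated products is the localized norm. -/
theorem tsum_sobolevNorm_eq (m : ℤ) (a : ℝ) (u : 𝓓'(Ω, ℂ)) :
    ∑' j, ENNReal.ofReal (w (A.c j) ^ ((d : ℝ) - 2 * a)) *
      sobolevNorm m (dilatedProduct u (A.φ j) (A.c j) (w (A.c j)) (A.M j)) ^ 2 =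
      A.locNorm m a (Distribution.toLin u) ^ 2 := by
  rw [locNorm, rpow_half_sq]
  refine tsum_congr fun j => ?_
  rw [A.dilatedProduct_eq]
  exact sobolevNorm_dilate (A.dil j) (A.r_pos j) _ m a

/-- Localization of products defines a seminorm. -/
theorem isESeminorm_dilatedProduct (m : ℤ) (j : ι) :
    IsESeminorm (fun u : 𝓓'(Ω, ℂ) => sobolevNorm m
      (dilatedProduct u (A.φ j) (A.c j) (w (A.c j)) (A.M j))) where
  add_le u v := by
    have : dilatedProduct (u + v) (A.φ j) (A.c j) (w (A.c j)) (A.M j) =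
        dilatedProduct u (A.φ j) (A.c j) (w (A.c j)) (A.M j) +
        dilatedProduct v (A.φ j) (A.c j) (w (A.c j)) (A.M j) := by
      funext g
      simp only [A.dilatedProduct_eq, Pi.add_apply, dilate, ← mul_add]
      rfl
    rw [this]
    exact (isESeminorm_kondNorm measurable_const m 0).add_le _ _
  smul_le c u := by
    have : dilatedProduct (c • u) (A.φ j) (A.c j) (w (A.c j)) (A.M j) =
        c • dilatedProduct u (A.φ j) (A.c j) (w (A.c j)) (A.M j) := by
      funext g
      simp only [A.dilatedProduct_eq, Pi.smul_apply, dilate, smul_eq_mul]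
      rw [mul_left_comm]
      rfl
    rw [this]
    exact (isESeminorm_kondNorm measurable_const m 0).smul_le _ _

end LocalCover

/-! ### Geometry of polyhedral domains -/

/-- If `κ + 1` of the open sets contained `p`, their intersection would be a neighborhood of `p` and
meet `P`. This carries the overlap bound from the domain to its faces. -/
theorem encard_le_of_mem_closure {X ι : Type*} [TopologicalSpace X] {P : Set X} {U : ι → Set X}
    (hU : ∀ j, IsOpen (U j)) {κ : ℕ} (h : ∀ p ∈ P, {j | p ∈ U j}.encard ≤ κ) {p : X}
    (hp : p ∈ closure P) : {j | p ∈ U j}.encard ≤ κ := by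
  by_contra hlt
  rw [not_le] at hlt
  have h1 : ((κ + 1 : ℕ) : ℕ∞) ≤ {j | p ∈ U j}.encard := by
    push_cast; exact Order.add_one_le_of_lt hlt
  obtain ⟨t, ht, htc⟩ := exists_subset_encard_eq h1
  have htf : t.Finite := finite_of_encard_le_coe htc.le
  have hopen : IsOpen (⋂ j ∈ t, U j) := htf.isOpen_biInter fun j _ => hU j
  obtain ⟨y, hy, hyP⟩ := mem_closure_iff.1 hp _ hopen (mem_iInter₂.2 fun j hj => ht hj)
  have h2 : t ⊆ {j | y ∈ U j} := fun j hj => mem_iInter₂.1 hy j hj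
  have h3 := (encard_le_encard h2).trans (h y hyP)
  rw [htc] at h3
  have : κ + 1 ≤ κ := by exact_mod_cast h3
  omega

theorem IsPreconnected.subset_or_disjoint {X : Type*} [TopologicalSpace X] {S U : Set X}
    (hS : IsPreconnected S) (h : Disjoint S (frontier U)) : S ⊆ U ∨ Disjoint S U := by
  have h1 : S ⊆ interior U ∪ (closure U)ᶜ := fun y hy => by
    by_contra hcon
    rw [mem_union, not_or, notMem_compl_iff] at hcon
    exact Set.disjoint_left.1 h hy ⟨hcon.2, hcon.1⟩
  rcases hS.subset_or_subset isOpen_interior isClosed_closure.isOpen_compl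
    (disjoint_compl_right.mono_left (interior_subset.trans subset_closure)) h1 with h2 | h2
  · exact Or.inl (h2.trans interior_subset)
  · exact Or.inr (Set.disjoint_left.2 fun y hy hyU => h2 hy (subset_closure hyU))

/-- A two-dimensional plane in `ℝ³` is given by a normal vector. -/
theorem exists_normal (f : Euc 2 →ᵃⁱ[ℝ] Euc 3) (c : Euc 2) :
    ∃ n : Euc 3, ‖n‖ = 1 ∧ ∀ y, y ∈ range f ↔ inner ℝ n (y - f c) = 0 := by
  set K : Submodule ℝ (Euc 3) := f.linearIsometry.toLinearMap.range with hK
  have h1 : Module.finrank ℝ K = 2 := by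
    rw [LinearMap.finrank_range_of_inj f.linearIsometry.injective]
    simp
  have h2 : Module.finrank ℝ Kᗮ = 1 := by
    have := K.finrank_add_finrank_orthogonal
    rw [h1, finrank_euclideanSpace_fin] at this
    omega
  have : Nontrivial Kᗮ := Module.nontrivial_of_finrank_pos (R := ℝ) (by omega)
  obtain ⟨⟨m, hmK⟩, hm⟩ := exists_norm_eq Kᗮ (zero_le_one (α := ℝ))
  have hm1 : ‖m‖ = 1 := hm
  have hspan : Kᗮ = Submodule.span ℝ {m} := by
    have hm0 : m ≠ 0 := by rintro rfl; simp at hm1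
    refine (Submodule.eq_of_le_of_finrank_eq ?_ ?_).symm
    · rw [Submodule.span_singleton_le_iff_mem]; exact hmK
    · rw [finrank_span_singleton hm0, h2]
  refine ⟨m, hm1, fun y => ?_⟩
  have hy : y ∈ range f ↔ y - f c ∈ K := by
    constructor
    · rintro ⟨q, rfl⟩
      exact ⟨q - c, f.linearIsometry.map_sub q c ▸ by
        simpa using (f.map_vsub q c)⟩
    · rintro ⟨v, hv⟩
      refine ⟨c + v, ?_⟩
      have := f.map_vadd c v
      rw [vadd_eq_add, vadd_eq_add] at this
      rw [add_comm, this]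
      have h3 : f.linearIsometry v = y - f c := hv
      rw [h3]; abel
  rw [hy, ← Submodule.orthogonal_orthogonal K, hspan, Submodule.mem_orthogonal_singleton_iff_inner_right]

namespace PolyhedralDomain

variable (P : PolyhedralDomain)

theorem isClosed_sing : IsClosed P.sing := by
  refine isClosed_iUnion_of_finite fun j => ?_
  refine (P.face j).finite_sides.isClosed_biUnion fun s hs => ?_
  exact (P.chart j).isometry.isClosedEmbedding.isClosedMap s ((P.face j).straight s hs).1

theorem closure_faceSet_subset (j : Fin P.N) :
    closure (P.faceSet j) ⊆ frontier (P.carrier : Set (Euc 3)) := by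
  rw [P.frontier_eq]
  exact subset_iUnion (fun j => closure (P.chart j '' ((P.face j).carrier : Set (Euc 2)))) j

theorem side_subset_frontier (j : Fin P.N) {s : Set (Euc 2)} (hs : s ∈ (P.face j).sides) :
    s ⊆ frontier ((P.face j).carrier : Set (Euc 2)) := by
  rw [(P.face j).frontier_eq]
  exact fun q hq => mem_iUnion₂.2 ⟨s, hs, hq⟩

theorem sing_subset_frontier : P.sing ⊆ frontier (P.carrier : Set (Euc 3)) := by
  refine iUnion_subset fun j => iUnion₂_subset fun s hs => ?_
  refine Subset.trans ?_ (P.closure_faceSet_subset j)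
  refine (image_mono ((P.side_subset_frontier j hs).trans frontier_subset_closure)).trans ?_
  exact image_closure_subset_closure_image (P.chart j).continuous

theorem disjoint_carrier_frontier :
    Disjoint (P.carrier : Set (Euc 3)) (frontier (P.carrier : Set (Euc 3))) := by
  rw [P.carrier.isOpen.frontier_eq]
  exact disjoint_sdiff_self_right

/-- The existence of an edge is essential: the distance to the empty set is zero by convention. -/
theorem theta_pos_iff (hP : P.sing.Nonempty) {p : Euc 3} : 0 < P.theta p ↔ p ∉ P.sing :=
  (P.isClosed_sing.notMem_iff_infDist_pos hP).symm

theorem theta_pos_of_mem (hP : P.sing.Nonempty) {p : Euc 3} (hp : p ∈ P.carrier) :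
    0 < P.theta p :=
  (P.theta_pos_iff hP).2 fun h =>
    Set.disjoint_left.1 P.disjoint_carrier_frontier hp (P.sing_subset_frontier h)

theorem lipschitz_theta : LipschitzWith 1 P.theta := Metric.lipschitz_infDist_pt _

theorem theta_pos_of_mem_ball {x y : Euc 3} {ε : ℝ} (hε : ε < 1) (hx : 0 < P.theta x)
    (hy : y ∈ Metric.ball x (ε * P.theta x)) : 0 < P.theta y := by
  have h := P.lipschitz_theta.dist_le_mul y x
  rw [NNReal.coe_one, one_mul, Real.dist_eq] at h
  have h1 := (abs_le.1 h).1
  have h2 : dist y x < ε * P.theta x := hy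
  nlinarith

/-- A ball of radius less than the distance to the edges misses the sides, which form the frontier
of the polygon; being connected, it stays in the polygon. -/
theorem ball_subset_face (hP : P.sing.Nonempty) (i : Fin P.N) {c : Euc 2}
    (hc : c ∈ (P.face i).carrier) {ε : ℝ} (hε : ε < 1) (hpos : 0 < P.theta (P.chart i c)) :
    Metric.ball c (ε * P.theta (P.chart i c)) ⊆ (P.face i).carrier := by
  by_cases h0 : 0 < ε
  swap
  · rw [Metric.ball_eq_empty.2 (by nlinarith)]; exact empty_subset _
  have hpre : IsPreconnected (Metric.ball c (ε * P.theta (P.chart i c))) :=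
    (convex_ball _ _).isPreconnected
  have hdisj : Disjoint (Metric.ball c (ε * P.theta (P.chart i c)))
      (frontier ((P.face i).carrier : Set (Euc 2))) := by
    rw [(P.face i).frontier_eq, Set.disjoint_left]
    intro q hq hq'
    obtain ⟨s, hs, hqs⟩ := mem_iUnion₂.1 hq'
    have h1 : P.chart i q ∈ P.sing := mem_iUnion.2 ⟨i, mem_iUnion₂.2 ⟨s, hs, q, hqs, rfl⟩⟩
    refine (P.theta_pos_iff hP).1 (P.theta_pos_of_mem_ball hε hpos ?_) h1
    rw [Metric.mem_ball, (P.chart i).isometry.dist_eq]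
    exact hq
  rcases hpre.subset_or_disjoint hdisj with h | h
  · exact h
  · exact absurd hc (Set.disjoint_left.1 h (Metric.mem_ball_self (mul_pos h0 hpos)))

/-- In the ball the boundary is exactly the plane of the face, so each open half-ball lies inside or
outside of the domain by connectedness. Exactly one lies inside: two would contradict `∂P =
∂(closure P)`, none would contradict that `x` is a boundary point. -/
theorem exists_innerNormal (hP : P.sing.Nonempty) {x : Euc 3} (i : Fin P.N) (hx : x ∈ P.faceSet i)
    {ε : ℝ} (h0 : 0 < ε) (hε : ε < 1) (hpos : 0 < P.theta x)
    (hdis : ∀ k, k ≠ i → Disjoint (Metric.ball x (ε * P.theta x)) (P.faceSet k)) :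
    ∃ n : Euc 3, ‖n‖ = 1 ∧
      ∀ y ∈ Metric.ball x (ε * P.theta x), y ∈ P.carrier ↔ 0 < inner ℝ n (y - x) := by
  obtain ⟨c, hc, rfl⟩ := hx
  set x := P.chart i c with hxdef
  set B := Metric.ball x (ε * P.theta x) with hB
  have hxB : x ∈ B := Metric.mem_ball_self (mul_pos h0 hpos)
  have hxfr : x ∈ frontier (P.carrier : Set (Euc 3)) :=
    P.closure_faceSet_subset i (subset_closure ⟨c, hc, rfl⟩)
  obtain ⟨n, hn, hplane⟩ := exists_normal (P.chart i) c
  have hfr : ∀ y ∈ B, y ∈ frontier (P.carrier : Set (Euc 3)) ↔ inner ℝ n (y - x) = 0 := by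
    intro y hy
    rw [← hplane]
    constructor
    · intro h
      rw [P.frontier_eq] at h
      obtain ⟨j, hj⟩ := mem_iUnion.1 h
      by_cases hji : j = i
      · subst hji
        have := (P.chart j).isometry.isClosedEmbedding.isClosedMap.closure_image_subset _ hj
        exact image_subset_range _ _ this
      · exact absurd hj (Set.disjoint_left.1 ((hdis j hji).closure_right Metric.isOpen_ball) hy)
    · rintro ⟨q, rfl⟩
      refine P.closure_faceSet_subset i (subset_closure ⟨q, ?_, rfl⟩)
      refine P.ball_subset_face hP i hc hε hpos ?_
      rw [hB, Metric.mem_ball, hxdef, (P.chart i).isometry.dist_eq] at hy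
      exact hy
  have side : ∀ m : Euc 3, (∀ y ∈ B, inner ℝ m (y - x) ≠ 0 →
      y ∉ frontier (P.carrier : Set (Euc 3))) →
      (B ∩ {y | 0 < inner ℝ m (y - x)} ⊆ P.carrier ∨
        Disjoint (B ∩ {y | 0 < inner ℝ m (y - x)}) P.carrier) := by
    intro m hm
    refine IsPreconnected.subset_or_disjoint ?_ ?_
    · refine ((convex_ball _ _).inter ?_).isPreconnected
      have h : {y | 0 < inner ℝ m (y - x)} = {y | inner ℝ m x < inner ℝ m y} := by
        ext y; simp [inner_sub_right]
      rw [h]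
      exact convex_halfSpace_gt (innerSL ℝ m).toLinearMap.isLinear _
    · rw [Set.disjoint_left]
      rintro y ⟨hyB, hy⟩
      exact hm y hyB (ne_of_gt hy)
  have hn1 : ∀ y ∈ B, inner ℝ n (y - x) ≠ 0 → y ∉ frontier (P.carrier : Set (Euc 3)) :=
    fun y hy h h' => h ((hfr y hy).1 h')
  have hn2 : ∀ y ∈ B, inner ℝ (-n) (y - x) ≠ 0 → y ∉ frontier (P.carrier : Set (Euc 3)) :=
    fun y hy h h' => h (by rw [inner_neg_left, (hfr y hy).1 h', neg_zero])
  have hnotfr : ∀ y ∈ B, y ∈ P.carrier → inner ℝ n (y - x) ≠ 0 := fun y hy hyP h =>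
    Set.disjoint_left.1 P.disjoint_carrier_frontier hyP ((hfr y hy).2 h)
  rcases side n hn1 with h1 | h1 <;> rcases side (-n) hn2 with h2 | h2
  · exfalso
    rw [← P.frontier_closure, isClosed_closure.frontier_eq] at hxfr
    refine hxfr.2 (mem_interior.2 ⟨B, fun y hy => ?_, Metric.isOpen_ball, hxB⟩)
    rcases lt_trichotomy (inner ℝ n (y - x)) 0 with h | h | h
    · exact subset_closure (h2 ⟨hy, by
        change 0 < inner ℝ (-n) (y - x); rw [inner_neg_left]; linarith⟩)
    · exact frontier_subset_closure ((hfr y hy).2 h)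
    · exact subset_closure (h1 ⟨hy, h⟩)
  · refine ⟨n, hn, fun y hy => ⟨fun hyP => ?_, fun h => h1 ⟨hy, h⟩⟩⟩
    rcases lt_trichotomy (inner ℝ n (y - x)) 0 with h | h | h
    · exact absurd hyP (Set.disjoint_left.1 h2 ⟨hy, by
        change 0 < inner ℝ (-n) (y - x); rw [inner_neg_left]; linarith⟩)
    · exact absurd h (hnotfr y hy hyP)
    · exact h
  · refine ⟨-n, by rwa [norm_neg], fun y hy => ⟨fun hyP => ?_, fun h => h2 ⟨hy, h⟩⟩⟩
    rcases lt_trichotomy (inner ℝ n (y - x)) 0 with h | h | h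
    · rw [inner_neg_left]; linarith
    · exact absurd h (hnotfr y hy hyP)
    · exact absurd hyP (Set.disjoint_left.1 h1 ⟨hy, h⟩)
  · exfalso
    obtain ⟨y, hyB, hyP⟩ := mem_closure_iff.1 (frontier_subset_closure hxfr) B Metric.isOpen_ball hxB
    rcases lt_trichotomy (inner ℝ n (y - x)) 0 with h | h | h
    · exact absurd hyP (Set.disjoint_left.1 h2 ⟨hyB, by
        change 0 < inner ℝ (-n) (y - x); rw [inner_neg_left]; linarith⟩)
    · exact absurd h (hnotfr y hyB hyP)
    · exact absurd hyP (Set.disjoint_left.1 h1 ⟨hyB, h⟩)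

theorem model_of_mem {x : Euc 3} (hx : x ∈ P.carrier) : P.model x = ⊤ := by
  rw [model, dif_neg]
  rintro ⟨n, -, hn⟩
  have := hn.self_of_nhds
  rw [sub_self, inner_zero_right] at this
  exact lt_irrefl _ (this.1 hx)

/-- The normal selected in `model` is only known to describe the domain near `x`. Points of the ball
are shrunk towards `x`, where both half-spaces agree with the domain, and half-spaces are invariant
under this dilation. -/
theorem mem_model_iff {x : Euc 3} {r : ℝ} (hr : 0 < r)
    (h : ∃ n : Euc 3, ‖n‖ = 1 ∧ ∀ y ∈ Metric.ball x r, y ∈ P.carrier ↔ 0 < inner ℝ n (y - x)) :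
    DilationInvariant x (P.model x) ∧ ∀ y ∈ Metric.ball x r, y ∈ P.model x ↔ y ∈ P.carrier := by
  obtain ⟨n, hn, hy⟩ := h
  have hex : ∃ n, P.IsInnerNormal x n :=
    ⟨n, hn, by filter_upwards [Metric.ball_mem_nhds x hr] with y h using hy y h⟩
  have hmod : ∀ y, y ∈ P.model x ↔ 0 < inner ℝ hex.choose (y - x) := by
    intro y; rw [model, dif_pos hex]; rfl
  set m := hex.choose
  have hm : P.IsInnerNormal x m := hex.choose_spec
  refine ⟨fun p hp t ht => ?_, fun y hyB => ?_⟩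
  · rw [hmod] at hp ⊢
    rw [add_sub_cancel_left, inner_smul_right]
    exact mul_pos ht hp
  · rw [hmod, hy y hyB]
    have hlim : Tendsto (fun t : ℝ => x + t • (y - x)) (𝓝[>] 0) (𝓝 x) := by
      have : Continuous fun t : ℝ => x + t • (y - x) := by fun_prop
      have h := this.tendsto 0
      rw [zero_smul, add_zero] at h
      exact h.mono_left nhdsWithin_le_nhds
    have h1 := hlim.eventually hm.2
    have h2 := hlim.eventually (Metric.ball_mem_nhds x hr)
    obtain ⟨t, ⟨ht1, ht2⟩, ht⟩ := ((h1.and h2).and self_mem_nhdsWithin).exists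
    have ht0 : 0 < t := ht
    rw [hy _ ht2, add_sub_cancel_left, inner_smul_right, inner_smul_right,
      mul_pos_iff_of_pos_left ht0, mul_pos_iff_of_pos_left ht0] at ht1
    exact ht1.symm

section Cover

variable {P} {ε : ℝ} {x : ℕ → Euc 3} {φ : ℕ → Euc 3 → ℝ}

theorem IsAdaptedPartition.theta_pos (h : P.IsAdaptedPartition ε x φ) (hP : P.sing.Nonempty)
    (j : ℕ) : 0 < P.theta (x j) := (P.theta_pos_iff hP).2 (h.mem j).2

theorem IsAdaptedPartition.interior_case (h : P.IsAdaptedPartition ε x φ)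
    {j : ℕ} (hj : x j ∉ frontier (P.carrier : Set (Euc 3))) :
    x j ∈ P.carrier ∧ Metric.ball (x j) (ε * P.theta (x j) / 4) ⊆ P.carrier := by
  have h1 : x j ∈ P.carrier := by
    by_contra hn
    exact hj (by rw [P.carrier.isOpen.frontier_eq]; exact ⟨(h.mem j).1, hn⟩)
  exact ⟨h1, (h.balls j).resolve_right fun h' => hj h'.1⟩

theorem IsAdaptedPartition.boundary_case (h : P.IsAdaptedPartition ε x φ) (hP : P.sing.Nonempty)
    (hε : 0 < ε) {j : ℕ} (hj : x j ∈ frontier (P.carrier : Set (Euc 3))) :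
    ∃ i, x j ∈ P.faceSet i ∧
      ∀ k, k ≠ i → Disjoint (Metric.ball (x j) (ε * P.theta (x j))) (P.faceSet k) := by
  rcases h.balls j with h1 | ⟨-, -, h2⟩
  · have : x j ∈ P.carrier := h1 (Metric.mem_ball_self
      (by have := mul_pos hε (h.theta_pos hP j); linarith))
    exact absurd hj (Set.disjoint_left.1 P.disjoint_carrier_frontier this)
  · exact h2

open Classical in
/-- The partition of unity on the domain as a local cover. -/
def IsAdaptedPartition.cover (h : P.IsAdaptedPartition ε x φ) (hP : P.sing.Nonempty)
    (hε : ε ∈ Set.Ioo (0 : ℝ) 1) : LocalCover P.carrier P.theta ℕ where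
  c := x
  -- The relative radius on which the model is valid: the ball of radius `ε ϑ` at boundary centers,
  -- that of radius `ε ϑ / 4` at interior ones. In both cases `φ j` is supported in half of it.
  σ j := if x j ∈ frontier (P.carrier : Set (Euc 3)) then ε else ε / 4
  φ := φ
  M j := P.model (x j)
  ε := ε
  σ₀ := ε / 4
  C k := h.deriv_bound.choose k * (ε ^ k)⁻¹
  κ := h.overlap.choose
  lip := P.lipschitz_theta
  pos _ hp := P.theta_pos_of_mem hP hp
  center_pos := h.theta_pos hP
  ε_lt_one := hε.2
  σ₀_pos := by linarith [hε.1]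
  le_σ j := by split_ifs <;> linarith [hε.1]
  σ_le j := by split_ifs <;> linarith [hε.1]
  ε_pos := hε.1
  smooth := h.smooth
  supp j := by
    by_cases hj : x j ∈ frontier (P.carrier : Set (Euc 3))
    · rw [if_pos hj]; exact h.support_bdry j hj
    · rw [if_neg hj]
      refine (h.support_int j hj).trans_eq ?_
      congr 1; ring
  sum_eq p hp := h.sum_eq_one p ⟨subset_closure hp, (P.theta_pos_iff hP).1 (P.theta_pos_of_mem hP hp)⟩
  bound := h.deriv_bound.choose_spec
  overlap := h.overlap.choose_spec
  model j := by
    by_cases hj : x j ∈ frontier (P.carrier : Set (Euc 3))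
    · rw [if_pos hj]
      obtain ⟨i, hi, hk⟩ := h.boundary_case hP hε.1 hj
      exact (P.mem_model_iff (mul_pos hε.1 (h.theta_pos hP j))
        (P.exists_innerNormal hP i hi hε.1 hε.2 (h.theta_pos hP j) hk)).2
    · rw [if_neg hj]
      obtain ⟨h1, h2⟩ := h.interior_case hj
      rw [P.model_of_mem h1]
      intro p hp
      refine ⟨fun _ => h2 ?_, fun _ => trivial⟩
      rwa [show ε * P.theta (x j) / 4 = ε / 4 * P.theta (x j) by ring]
  dil j := by
    by_cases hj : x j ∈ frontier (P.carrier : Set (Euc 3))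
    · obtain ⟨i, hi, hk⟩ := h.boundary_case hP hε.1 hj
      exact (P.mem_model_iff (mul_pos hε.1 (h.theta_pos hP j))
        (P.exists_innerNormal hP i hi hε.1 hε.2 (h.theta_pos hP j) hk)).1
    · rw [P.model_of_mem (h.interior_case hj).1]
      exact fun _ _ _ _ => trivial

theorem faceSet_subset_frontier (k : Fin P.N) :
    P.faceSet k ⊆ frontier (P.carrier : Set (Euc 3)) :=
  subset_closure.trans (P.closure_faceSet_subset k)

theorem norm_iteratedFDeriv_comp_affineIsometry {η : Euc 3 → ℝ} (hη : ContDiff ℝ ∞ η)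
    (f : Euc 2 →ᵃⁱ[ℝ] Euc 3) (k : ℕ) (q : Euc 2) :
    ‖iteratedFDeriv ℝ k (η ∘ f) q‖ ≤ ‖iteratedFDeriv ℝ k η (f q)‖ := by
  set L : Euc 2 →L[ℝ] Euc 3 := f.linearIsometry.toContinuousLinearMap
  have hf : ∀ q, f q = L q + f 0 := fun q => by
    have := f.map_vadd 0 q
    rw [vadd_eq_add, add_zero] at this
    exact this
  have e : η ∘ f = (fun y => η (y + f 0)) ∘ L := by
    funext q; simp [hf q]
  have h1 : ContDiff ℝ k (fun y => η (y + f 0)) :=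
    (hη.of_le (by exact_mod_cast le_top)).comp (by fun_prop)
  rw [e, L.iteratedFDeriv_comp_right h1 q le_rfl]
  refine (ContinuousMultilinearMap.norm_compContinuousLinearMap_le _ _).trans ?_
  have hL : ‖L‖ ≤ 1 := f.linearIsometry.norm_toContinuousLinearMap_le
  rw [iteratedFDeriv_comp_add_right, ← hf]
  exact mul_le_of_le_one_right (norm_nonneg _)
    (Finset.prod_le_one (fun _ _ => norm_nonneg _) fun _ _ => hL)

/-- The functions of the partition of unity with center on the `k`-th face, as a local cover of
this face. -/
def IsAdaptedPartition.faceCover (h : P.IsAdaptedPartition ε x φ) (hP : P.sing.Nonempty)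
    (hε : ε ∈ Set.Ioo (0 : ℝ) 1) (k : Fin P.N) :
    LocalCover (P.faceRegion k) (P.faceTheta k)
      {j : ℕ // ∃ c ∈ (P.face k).carrier, P.chart k c = x j} where
  c j := j.2.choose
  σ _ := ε
  φ j := φ j ∘ P.chart k
  -- The ball about a center on the face avoids the sides of the face and all other edges, so within
  -- it the face is the full plane.
  M _ := ⊤
  ε := ε
  σ₀ := ε
  C k := h.deriv_bound.choose k * (ε ^ k)⁻¹
  κ := h.overlap.choose
  lip := by
    have := P.lipschitz_theta.comp (P.chart k).isometry.lipschitz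
    rw [one_mul] at this
    exact this
  pos _ hp := hp.2
  center_pos j := by
    rw [faceTheta, j.2.choose_spec.2]; exact h.theta_pos hP j
  ε_lt_one := hε.2
  σ₀_pos := hε.1
  le_σ _ := le_rfl
  σ_le _ := le_rfl
  ε_pos := hε.1
  smooth j := (h.smooth j).comp (P.chart k).toContinuousAffineMap.contDiff
  supp j := by
    intro q hq
    have h1 : P.chart k q ∈ tsupport (φ j) :=
      tsupport_comp_subset_preimage (φ j) (P.chart k).continuous hq
    have h2 := h.support_bdry j (faceSet_subset_frontier k j.2) h1
    rw [Metric.mem_ball, faceTheta, j.2.choose_spec.2]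
    rw [Metric.mem_ball] at h2
    rwa [← j.2.choose_spec.2, (P.chart k).isometry.dist_eq, j.2.choose_spec.2] at h2
  -- Only indices with center on this face contribute: the support ball of an interior center lies
  -- in `P`, and that of a center on another face is disjoint from this face.
  sum_eq p hp := by
    have hfr : P.chart k p ∈ P.faceSet k := ⟨p, hp.1, rfl⟩
    have hsum := h.sum_eq_one (P.chart k p)
      ⟨frontier_subset_closure (faceSet_subset_frontier k hfr), (P.theta_pos_iff hP).1 hp.2⟩
    refine (hasSum_subtype_iff_of_support_subset
      (s := {j : ℕ | ∃ c ∈ (P.face k).carrier, P.chart k c = x j}) ?_).2 hsum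
    intro j hj
    have hj1 : P.chart k p ∈ tsupport (φ j) := subset_tsupport _ hj
    have hpos := mul_pos hε.1 (h.theta_pos hP j)
    by_cases hx : x j ∈ frontier (P.carrier : Set (Euc 3))
    · obtain ⟨i, hi, hi'⟩ := h.boundary_case hP hε.1 hx
      by_cases hik : k = i
      · exact hik ▸ hi
      · exact absurd hfr (Set.disjoint_left.1 (hi' k hik)
          (Metric.ball_subset_ball (by linarith) (h.support_bdry j hx hj1)))
    · have := (h.interior_case hx).2
        (Metric.ball_subset_ball (by linarith) (h.support_int j hx hj1))
      exact absurd (faceSet_subset_frontier k hfr)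
        (Set.disjoint_left.1 P.disjoint_carrier_frontier this)
  -- The derivative bounds are assumed in the open domain; continuity extends them to the faces.
  bound n j p hp := by
    have hcl : P.chart k p ∈ closure (P.carrier : Set (Euc 3)) :=
      frontier_subset_closure (faceSet_subset_frontier k ⟨p, hp.1, rfl⟩)
    have hclosed : IsClosed {y | P.theta y ^ n * ‖iteratedFDeriv ℝ n (φ j) y‖ ≤
        h.deriv_bound.choose n * (ε ^ n)⁻¹} :=
      isClosed_le ((P.continuous_theta.pow n).mul
        ((h.smooth j).continuous_iteratedFDeriv (by exact_mod_cast le_top)).norm) continuous_const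
    have h1 : P.chart k p ∈ {y | P.theta y ^ n * ‖iteratedFDeriv ℝ n (φ j) y‖ ≤
        h.deriv_bound.choose n * (ε ^ n)⁻¹} :=
      closure_minimal (fun y hy => h.deriv_bound.choose_spec n j y hy) hclosed hcl
    refine le_trans ?_ h1
    exact mul_le_mul_of_nonneg_left
      (norm_iteratedFDeriv_comp_affineIsometry (h.smooth j) (P.chart k) n p)
      (pow_nonneg Metric.infDist_nonneg n)
  overlap p hp := by
    have hcl : P.chart k p ∈ closure (P.carrier : Set (Euc 3)) :=
      frontier_subset_closure (faceSet_subset_frontier k ⟨p, hp.1, rfl⟩)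
    have h1 := encard_le_of_mem_closure (fun _ => Metric.isOpen_ball) h.overlap.choose_spec hcl
    refine le_trans ?_ h1
    rw [← Subtype.val_injective.encard_image]
    refine encard_le_encard ?_
    rintro _ ⟨j, hj, rfl⟩
    have hj' : dist p j.2.choose < ε * P.theta (P.chart k j.2.choose) := hj
    change dist (P.chart k p) (x j) < ε * P.theta (x j)
    rwa [← j.2.choose_spec.2, (P.chart k).isometry.dist_eq]
  model j p hp := by
    refine ⟨fun _ => ?_, fun _ => trivial⟩
    have hpos : 0 < P.theta (P.chart k j.2.choose) := by
      rw [j.2.choose_spec.2]; exact h.theta_pos hP j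
    refine ⟨P.ball_subset_face hP k j.2.choose_spec.1 hε.2 hpos hp, ?_⟩
    refine P.theta_pos_of_mem_ball hε.2 hpos (y := P.chart k p) ?_
    rw [Metric.mem_ball, (P.chart k).isometry.dist_eq]
    exact hp
  dil _ := fun _ _ _ _ => trivial

end Cover

end PolyhedralDomain

/-! ### Norm equivalence on the domain and on the individual faces -/

theorem DescribesNorm.of_equiv {V : Type*} [AddCommGroup V] [Module ℂ V] {N₀ N : V → ℝ≥0∞}
    (hN : IsESeminorm N) (h0 : ∀ u, N u = 0 → u = 0) (C : ℝ≥0)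
    (h1 : ∀ u, N u ≤ C * N₀ u) (h2 : ∀ u, N₀ u ≤ C * N u) : DescribesNorm N₀ N where
  lt_top_iff u := ⟨fun h => (h1 u).trans_lt (ENNReal.mul_lt_top ENNReal.coe_lt_top h),
    fun h => (h2 u).trans_lt (ENNReal.mul_lt_top ENNReal.coe_lt_top h)⟩
  eq_zero_iff u := ⟨h0 u, by rintro rfl; exact hN.map_zero⟩
  add_le := hN.add_le
  smul_eq := hN.smul_eq
  equiv := ⟨C, fun u => ⟨h1 u, h2 u⟩⟩

theorem LocalCover.isESeminorm_locNorm {d : ℕ} {Ω : Opens (Euc d)} {w : Euc d → ℝ} {ι : Type*}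
    (A : LocalCover Ω w ι) (m : ℤ) (a : ℝ) :
    IsESeminorm (fun u : 𝓓'(Ω, ℂ) => A.locNorm m a (Distribution.toLin u)) := by
  have e : (fun u : 𝓓'(Ω, ℂ) => A.locNorm m a (Distribution.toLin u)) = fun u =>
      (∑' j, ENNReal.ofReal (w (A.c j) ^ ((d : ℝ) - 2 * a)) *
        sobolevNorm m (dilatedProduct u (A.φ j) (A.c j) (w (A.c j)) (A.M j)) ^ 2) ^ (1 / 2 : ℝ) := by
    funext u
    rw [A.tsum_sobolevNorm_eq, sq_rpow_half]
  rw [e]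
  exact IsESeminorm.l2 (fun j => A.isESeminorm_dilatedProduct m j) _

theorem LocalCover.eq_zero_of_locNorm_eq_zero {d : ℕ} {Ω : Opens (Euc d)} {w : Euc d → ℝ}
    {ι : Type*} [Countable ι] (A : LocalCover Ω w ι) {m : ℤ} {a : ℝ} {u : 𝓓'(Ω, ℂ)}
    (h : A.locNorm m a (Distribution.toLin u) = 0) : u = 0 := by
  obtain ⟨C, -, hC⟩ := A.exists_equiv m a
  have h1 := (hC (Distribution.toLin u)).2
  rw [h, mul_zero] at h1
  have h2 := eq_zero_of_kondNorm_eq_zero A.lip.continuous A.pos (nonpos_iff_eq_zero.1 h1)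
  ext g
  exact DFunLike.congr_fun h2 g

namespace PolyhedralDomain

variable {P : PolyhedralDomain} {ε : ℝ} {x : ℕ → Euc 3} {φ : ℕ → Euc 3 → ℝ}

theorem IsAdaptedPartition.nu_eq (h : P.IsAdaptedPartition ε x φ) (hP : P.sing.Nonempty)
    (hε : ε ∈ Set.Ioo (0 : ℝ) 1) (m : ℤ) (a : ℝ) (u : 𝓓'(P.carrier, ℂ)) :
    P.nu x φ m a u = (h.cover hP hε).locNorm m a (Distribution.toLin u) := by
  rw [nu, ← sq_rpow_half (LocalCover.locNorm _ _ _ _), ← LocalCover.tsum_sobolevNorm_eq]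
  rfl

theorem IsAdaptedPartition.describesNorm_nu (h : P.IsAdaptedPartition ε x φ)
    (hP : P.sing.Nonempty) (hε : ε ∈ Set.Ioo (0 : ℝ) 1) (m : ℤ) (a : ℝ) :
    DescribesNorm (P.domainNorm m a) (P.nu x φ m a) := by
  obtain ⟨C, -, hC⟩ := (h.cover hP hε).exists_equiv m a
  have e : P.nu x φ m a = fun u => (h.cover hP hε).locNorm m a (Distribution.toLin u) :=
    funext (h.nu_eq hP hε m a)
  rw [e]
  exact DescribesNorm.of_equiv ((h.cover hP hε).isESeminorm_locNorm m a)
    (fun u hu => (h.cover hP hε).eq_zero_of_locNorm_eq_zero hu) C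
    (fun u => (hC (Distribution.toLin u)).1) (fun u => (hC (Distribution.toLin u)).2)

/-- The square root of the sum of the squares of the norms on the faces. -/
def facesNorm (P : PolyhedralDomain) (s : ℤ) (a : ℝ) (u : P.BdryDistr) : ℝ≥0∞ :=
  (∑ k, kondNorm (P.faceTheta k) s a (u k) ^ 2) ^ (1 / 2 : ℝ)

theorem IsAdaptedPartition.mu_eq (h : P.IsAdaptedPartition ε x φ) (hP : P.sing.Nonempty)
    (hε : ε ∈ Set.Ioo (0 : ℝ) 1) (s : ℤ) (a : ℝ) (u : P.BdryDistr) :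
    P.mu x φ s a u =
      (∑ k, (h.faceCover hP hε k).locNorm s a (Distribution.toLin (u k)) ^ 2) ^ (1 / 2 : ℝ) := by
  classical
  rw [mu, Summable.tsum_finsetSum fun _ _ => ENNReal.summable]
  congr 1
  refine Finset.sum_congr rfl fun k _ => ?_
  rw [← LocalCover.tsum_sobolevNorm_eq]
  -- For a fixed face, the terms whose center is not on it are zero, so the sum over all `j` is the
  -- one over the index type of `faceCover`.
  refine ((tsum_subtype_eq_of_support_subset (s := {j : ℕ | ∃ c ∈ (P.face k).carrier,
    P.chart k c = x j}) ?_).symm).trans (tsum_congr fun j => ?_)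
  · intro j hj
    by_contra hn
    exact hj (dif_neg hn)
  · have hj : ∃ c ∈ (P.face k).carrier, P.chart k c = x j := j.2
    have e : P.faceTheta k ((h.faceCover hP hε k).c j) = P.theta (x j) :=
      congrArg P.theta hj.choose_spec.2
    rw [dif_pos hj, e]
    rfl

theorem IsAdaptedPartition.describesNorm_mu_facesNorm (h : P.IsAdaptedPartition ε x φ)
    (hP : P.sing.Nonempty) (hε : ε ∈ Set.Ioo (0 : ℝ) 1) (s : ℤ) (a : ℝ) :
    DescribesNorm (P.facesNorm s a) (P.mu x φ s a) := by
  choose C hC1 hC using fun k => (h.faceCover hP hε k).exists_equiv s a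
  have hCle : ∀ k, C k ≤ ∑ k, C k := fun k =>
    Finset.single_le_sum (f := C) (fun _ _ => zero_le) (Finset.mem_univ k)
  have e : P.mu x φ s a = fun u : P.BdryDistr =>
      (∑ k, (h.faceCover hP hε k).locNorm s a (Distribution.toLin (u k)) ^ 2) ^ (1 / 2 : ℝ) :=
    funext (h.mu_eq hP hε s a)
  rw [e]
  refine DescribesNorm.of_equiv ?_ ?_ (∑ k, C k) ?_ ?_
  · exact IsESeminorm.l2_finset (fun k => IsESeminorm.comp (W := P.BdryDistr)
      ((h.faceCover hP hε k).isESeminorm_locNorm s a) (LinearMap.proj k)) Finset.univ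
  · intro u hu
    have h1 := (rpow_half_le_iff (b := 0)).1 hu.le
    simp only [ne_eq, OfNat.ofNat_ne_zero, not_false_eq_true, zero_pow, nonpos_iff_eq_zero,
      Finset.sum_eq_zero_iff,
      Finset.mem_univ, true_imp_iff, pow_eq_zero_iff] at h1
    exact funext fun k => (h.faceCover hP hε k).eq_zero_of_locNorm_eq_zero (h1 k)
  · intro u
    rw [rpow_half_le_iff, mul_pow, facesNorm, rpow_half_sq, Finset.mul_sum]
    refine Finset.sum_le_sum fun k _ => ?_
    rw [← mul_pow]
    gcongr
    exact (hC k _).1.trans (by gcongr; exacts [hCle k, le_rfl])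
  · intro u
    rw [facesNorm, rpow_half_le_iff, mul_pow, rpow_half_sq, Finset.mul_sum]
    refine Finset.sum_le_sum fun k _ => ?_
    rw [← mul_pow]
    gcongr
    exact (hC k (Distribution.toLin (u k))).2.trans (by gcongr; exact hCle k)

theorem bdryNormNat_eq_facesNorm (n : ℕ) (a : ℝ) (u : P.BdryDistr) :
    P.bdryNormNat n a u = P.facesNorm n a u := by
  rw [bdryNormNat, facesNorm]
  congr 1
  exact Finset.sum_congr rfl fun k _ => (rpow_half_sq _).symm

/-- Equivalent norms are described by the same norms. -/
theorem _root_.DescribesNorm.congr {V : Type*} [AddCommGroup V] [Module ℂ V] {N₀ N₁ N : V → ℝ≥0∞}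
    (h : DescribesNorm N₀ N) (C : ℝ≥0) (h1 : ∀ u, N₁ u ≤ C * N₀ u) (h2 : ∀ u, N₀ u ≤ C * N₁ u) :
    DescribesNorm N₁ N where
  lt_top_iff u := by
    rw [← h.lt_top_iff]
    exact ⟨fun h => (h2 u).trans_lt (ENNReal.mul_lt_top ENNReal.coe_lt_top h),
      fun h => (h1 u).trans_lt (ENNReal.mul_lt_top ENNReal.coe_lt_top h)⟩
  eq_zero_iff := h.eq_zero_iff
  add_le := h.add_le
  smul_eq := h.smul_eq
  equiv := by
    obtain ⟨D, hD⟩ := h.equiv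
    refine ⟨C * D, fun u => ⟨(hD u).1.trans ?_, (h1 u).trans ?_⟩⟩
    · calc (D : ℝ≥0∞) * N₀ u ≤ D * (C * N₁ u) := by gcongr; exact h2 u
        _ = _ := by push_cast; ring
    · calc (C : ℝ≥0∞) * N₀ u ≤ C * (D * N u) := by gcongr; exact (hD u).2
        _ = _ := by push_cast; ring

end PolyhedralDomain

/-- A finite extended seminorm as a seminorm. -/
def IsESeminorm.toSeminorm {V : Type*} [AddCommGroup V] [Module ℂ V] {N : V → ℝ≥0∞}
    (h : IsESeminorm N) (hN : ∀ v, N v ≠ ⊤) : Seminorm ℂ V :=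
  Seminorm.of (fun v => (N v).toReal)
    (fun v w => by
      rw [← ENNReal.toReal_add (hN v) (hN w)]
      exact ENNReal.toReal_mono (ENNReal.add_ne_top.2 ⟨hN v, hN w⟩) (h.add_le v w))
    (fun c v => by rw [h.smul_eq, ENNReal.toReal_mul, toReal_enorm])

/-- The Hahn-Banach theorem for functionals on the domain of an injective linear map. -/
theorem IsESeminorm.exists_extension {V W : Type*} [AddCommGroup V] [Module ℂ V] [AddCommGroup W]
    [Module ℂ W] {N : V → ℝ≥0∞} (h : IsESeminorm N) (hN : ∀ v, N v ≠ ⊤) {A : W →ₗ[ℂ] V}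
    (hA : Function.Injective A) (L : W →ₗ[ℂ] ℂ) {M : ℝ≥0∞} (hM : M ≠ ⊤)
    (hL : ∀ f, ‖L f‖ₑ ≤ M * N (A f)) :
    ∃ l : V →ₗ[ℂ] ℂ, (∀ f, l (A f) = L f) ∧ ∀ v, ‖l v‖ₑ ≤ M * N v := by
  let e := LinearEquiv.ofInjective A hA
  have he : ∀ f, e.symm ⟨A f, f, rfl⟩ = f := fun f => (LinearEquiv.symm_apply_eq e).2 rfl
  obtain ⟨l, hl, hlM⟩ := Module.Dual.exists_extension_of_le_seminorm (LinearMap.range A)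
    (L.comp e.symm.toLinearMap) (p := M.toNNReal • h.toSeminorm hN) (by
      rintro ⟨_, f, rfl⟩
      change ‖L (e.symm _)‖ ≤ M.toReal * (N _).toReal
      rw [he, ← ENNReal.toReal_mul, ← toReal_enorm]
      exact ENNReal.toReal_mono (ENNReal.mul_ne_top hM (hN _)) (hL f))
  refine ⟨l, fun f => ?_, fun v => ?_⟩
  · refine (hl ⟨A f, f, rfl⟩).trans ?_
    change L (e.symm _) = _
    rw [he]
  · have h1 : ‖l v‖ ≤ M.toReal * (N v).toReal := hlM v
    rw [← ENNReal.toReal_mul, ← toReal_enorm] at h1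
    exact (ENNReal.toReal_le_toReal (by simp) (ENNReal.mul_ne_top hM (hN v))).1 h1

/-- `ofTestDistr` as a linear map. -/
def ofTestDistrₗ {d : ℕ} (Ω : Opens (Euc d)) : 𝓓(Ω, ℂ) →ₗ[ℂ] 𝓓'(Ω, ℂ) where
  toFun := ofTestDistr
  map_add' f g := by
    ext h
    have := congrFun (ofTest_add f g) h
    rw [← coe_ofTestDistr, ← coe_ofTestDistr f, ← coe_ofTestDistr g] at this
    exact this
  map_smul' c f := by
    ext h
    have := congrFun (ofTest_smul c f) h
    rw [← coe_ofTestDistr, ← coe_ofTestDistr f] at this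
    exact this

theorem coe_ofTestDistrₗ {d : ℕ} {Ω : Opens (Euc d)} (f : 𝓓(Ω, ℂ)) :
    (ofTestDistrₗ Ω f : 𝓓(Ω, ℝ) → ℂ) = ofTest f := coe_ofTestDistr f

theorem ofReal_re_add_im {d : ℕ} {Ω : Opens (Euc d)} (f : 𝓓(Ω, ℂ)) :
    f = TestFunction.postcompCLM (𝕜 := ℝ) Complex.ofRealCLM
        (TestFunction.postcompCLM (𝕜 := ℝ) Complex.reCLM f) +
      Complex.I • TestFunction.postcompCLM (𝕜 := ℝ) Complex.ofRealCLM
        (TestFunction.postcompCLM (𝕜 := ℝ) Complex.imCLM f) := by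
  ext x
  have := (Complex.re_add_im (f x)).symm
  rw [mul_comm] at this
  exact this

/-! ### Negative order on the boundary: linear forms and their restrictions to test functions -/

namespace PolyhedralDomain

variable {P : PolyhedralDomain}

theorem faceTheta_pos {k : Fin P.N} : ∀ q ∈ P.faceRegion k, 0 < P.faceTheta k q := fun _ h => h.2

theorem isESeminorm_bdryNormNat (n : ℕ) (a : ℝ) : IsESeminorm (P.bdryNormNat n a) := by
  have e : P.bdryNormNat n a = P.facesNorm n a := funext (bdryNormNat_eq_facesNorm n a)
  rw [e]
  refine IsESeminorm.l2_finset (V := P.BdryDistr)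
    (N := fun k u => kondNorm (P.faceTheta k) n a (u k)) (fun k => ?_) Finset.univ
  have h := isESeminorm_kondNorm (Ω := P.faceRegion k) (P.continuous_faceTheta k).measurable n a
  exact ⟨fun u v => h.add_le (u k) (v k), fun c u => h.smul_le c (u k)⟩

/-- Families of test functions on the faces, as elements of `𝒦^n_a(∂P; ϑ)`. -/
def ofTests (P : PolyhedralDomain) (n : ℕ) (a : ℝ) :
    (∀ k : Fin P.N, 𝓓(P.faceRegion k, ℂ)) →ₗ[ℂ] P.bdrySpace n a :=
  (LinearMap.pi fun k => (ofTestDistrₗ (P.faceRegion k)).comp (LinearMap.proj k)).codRestrict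
    (P.bdrySpace n a) fun f => P.bdryNormNat_lt_top.2 fun k => by
      change weightedSobolevSq (P.faceTheta k) n a (ofTestDistrₗ _ (f k)) < ⊤
      rw [coe_ofTestDistrₗ]
      exact weightedSobolevSq_ofTest_lt_top (P.continuous_faceTheta k) faceTheta_pos n a (f k)

theorem ofTests_apply (n : ℕ) (a : ℝ) (f : ∀ k : Fin P.N, 𝓓(P.faceRegion k, ℂ)) (k : Fin P.N) :
    ((P.ofTests n a f : P.BdryDistr) k : 𝓓(P.faceRegion k, ℝ) → ℂ) = ofTest (f k) :=
  coe_ofTestDistrₗ (f k)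

theorem ofTests_injective (n : ℕ) (a : ℝ) : Function.Injective (P.ofTests n a) := by
  intro f g h
  funext k
  apply ofTest_injective
  rw [← ofTests_apply n a, h, ofTests_apply]

theorem bdryNormNat_ofTests (n : ℕ) (a : ℝ) (f : ∀ k : Fin P.N, 𝓓(P.faceRegion k, ℂ)) :
    P.bdryNormNat n a (P.ofTests n a f) =
      (∑ k, weightedSobolevSq (P.faceTheta k) n a (ofTest (f k))) ^ (1 / 2 : ℝ) := by
  simp only [bdryNormNat, ofTests_apply]

theorem bdryNormNat_ofTests_single (n : ℕ) (a : ℝ) (k : Fin P.N) (f : 𝓓(P.faceRegion k, ℂ)) :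
    P.bdryNormNat n a (P.ofTests n a (Pi.single k f)) =
      weightedSobolevSq (P.faceTheta k) n a (ofTest f) ^ (1 / 2 : ℝ) := by
  rw [bdryNormNat_ofTests, Finset.sum_eq_single k]
  · rw [Pi.single_eq_same]
  · intro l _ hl
    rw [Pi.single_eq_of_ne hl, ← rpow_half_sq (weightedSobolevSq _ _ _ _)]
    have h0 : ofTest (0 : 𝓓(P.faceRegion l, ℂ)) = 0 := map_zero ofTestₗ
    rw [h0]
    exact (congrArg (· ^ 2) (isESeminorm_weightedSobolev
      (P.continuous_faceTheta l).measurable n a).map_zero).trans (by simp)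
  · simp

theorem bdryNormNat_ne_top {n : ℕ} {a : ℝ} (v : P.bdrySpace n a) : P.bdryNormNat n a v ≠ ⊤ :=
  LT.lt.ne v.2

theorem apply_le_dualNorm {n : ℕ} {a : ℝ} (l : P.bdrySpace n a →ₗ[ℂ] ℂ) (hl : P.dualNorm l < ⊤)
    (v : P.bdrySpace n a) : ‖l v‖ₑ ≤ P.dualNorm l * P.bdryNormNat n a v := by
  have h1 : ‖l v‖ₑ / P.bdryNormNat n a v ≤ P.dualNorm l :=
    le_iSup (fun v : P.bdrySpace n a => ‖l v‖ₑ / P.bdryNormNat n a v) v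
  by_cases h0 : P.bdryNormNat n a v = 0
  · by_cases hz : ‖l v‖ₑ = 0
    · rw [hz]; exact zero_le
    · rw [h0, ENNReal.div_zero hz, top_le_iff] at h1
      exact absurd h1 hl.ne
  · exact (ENNReal.div_le_iff h0 (bdryNormNat_ne_top v)).1 h1

/-- `RestrictsTo` speaks of real test functions only; real and imaginary parts and complex linearity
give the rest. -/
theorem RestrictsTo.apply_single {n : ℕ} {a : ℝ} {l : P.bdrySpace n a →ₗ[ℂ] ℂ} {u : P.BdryDistr}
    (h : P.RestrictsTo l u) (k : Fin P.N) (f : 𝓓(P.faceRegion k, ℂ)) :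
    l (P.ofTests n a (Pi.single k f)) = complexEval (u k) f := by
  have key : ∀ g : 𝓓(P.faceRegion k, ℝ), l (P.ofTests n a (Pi.single k
      (TestFunction.postcompCLM (𝕜 := ℝ) Complex.ofRealCLM g))) = u k g := by
    intro g
    refine h k g _ (fun h => ?_) fun j hj => ?_
    · rw [ofTests_apply, Pi.single_eq_same]; rfl
    · change ofTestDistrₗ (P.faceRegion j) _ = 0
      rw [LinearMap.proj_apply, Pi.single_eq_of_ne hj, map_zero]
  have hl : ∀ f, l (P.ofTests n a (Pi.single k f)) = (l.comp ((P.ofTests n a).comp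
      (LinearMap.single ℂ (fun k : Fin P.N => 𝓓(P.faceRegion k, ℂ)) k))) f := fun _ => rfl
  conv_lhs => rw [ofReal_re_add_im f]
  rw [hl, map_add, map_smul, ← hl, ← hl, key, key]
  rfl

theorem RestrictsTo.apply_ofTests {n : ℕ} {a : ℝ} {l : P.bdrySpace n a →ₗ[ℂ] ℂ} {u : P.BdryDistr}
    (h : P.RestrictsTo l u) (f : ∀ k : Fin P.N, 𝓓(P.faceRegion k, ℂ)) :
    l (P.ofTests n a f) = ∑ k, complexEval (u k) (f k) := by
  conv_lhs => rw [← Finset.univ_sum_single f, map_sum, map_sum]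
  exact Finset.sum_congr rfl fun k _ => h.apply_single k (f k)

/-- The supremum over test functions on one face is part of the supremum over the whole space. -/
theorem RestrictsTo.kondNorm_le_dualNorm {n : ℕ} {a : ℝ} {l : P.bdrySpace (n + 1) (-a) →ₗ[ℂ] ℂ}
    {u : P.BdryDistr} (h : P.RestrictsTo l u) (k : Fin P.N) :
    kondNorm (P.faceTheta k) (Int.negSucc n) a (u k) ≤ P.dualNorm l := by
  refine iSup_le fun f => ?_
  rw [← h.apply_single k f, ← bdryNormNat_ofTests_single]
  exact le_iSup (fun v : P.bdrySpace (n + 1) (-a) => ‖l v‖ₑ / P.bdryNormNat (n + 1) (-a) v) _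

theorem isESeminorm_bdrySpace (n : ℕ) (a : ℝ) :
    IsESeminorm (fun v : P.bdrySpace n a => P.bdryNormNat n a v) where
  add_le u v := (isESeminorm_bdryNormNat n a).add_le u.1 v.1
  smul_le c v := (isESeminorm_bdryNormNat n a).smul_le c v.1

theorem restrictsTo_of_apply_single {n : ℕ} {a : ℝ} {l : P.bdrySpace n a →ₗ[ℂ] ℂ}
    {u : P.BdryDistr} (h : ∀ (k : Fin P.N) (f : 𝓓(P.faceRegion k, ℂ)),
      l (P.ofTests n a (Pi.single k f)) = complexEval (u k) f) : P.RestrictsTo l u := by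
  intro j g v hv hv0
  have hvf : v = P.ofTests n a
      (Pi.single j (TestFunction.postcompCLM (𝕜 := ℝ) Complex.ofRealCLM g)) := by
    ext k h
    rw [ofTests_apply]
    by_cases hk : k = j
    · subst hk
      rw [hv, Pi.single_eq_same]; rfl
    · rw [hv0 k hk, Pi.single_eq_of_ne hk]
      exact (congrFun (map_zero ofTestₗ) h).symm
  rw [hvf, h]
  exact complexEval_ofReal (Distribution.toLin (u j)) g

/-- The functional on families of test functions that is given by a distribution. -/
def evalTests (u : P.BdryDistr) : (∀ k : Fin P.N, 𝓓(P.faceRegion k, ℂ)) →ₗ[ℂ] ℂ :=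
  ∑ k, (complexEvalₗ (Distribution.toLin (u k))).comp (LinearMap.proj k)

theorem evalTests_apply (u : P.BdryDistr) (f : ∀ k : Fin P.N, 𝓓(P.faceRegion k, ℂ)) :
    evalTests u f = ∑ k, complexEval (u k) (f k) := by
  simp only [evalTests, LinearMap.sum_apply]; rfl

theorem evalTests_single (u : P.BdryDistr) (k : Fin P.N) (f : 𝓓(P.faceRegion k, ℂ)) :
    evalTests u (Pi.single k f) = complexEval (u k) f := by
  rw [evalTests_apply, Finset.sum_eq_single k]
  · rw [Pi.single_eq_same]
  · intro j _ hj
    rw [Pi.single_eq_of_ne hj]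
    exact map_zero (complexEvalₗ (Distribution.toLin (u j)))
  · simp

theorem enorm_evalTests_le (n : ℕ) (a : ℝ) (u : P.BdryDistr)
    (f : ∀ k : Fin P.N, 𝓓(P.faceRegion k, ℂ)) :
    ‖evalTests u f‖ₑ ≤ (∑ k, kondNorm (P.faceTheta k) (Int.negSucc n) a (u k)) *
      P.bdryNormNat (n + 1) (-a) (P.ofTests (n + 1) (-a) f) := by
  rw [evalTests_apply, Finset.sum_mul]
  refine (enorm_sum_le _ _).trans (Finset.sum_le_sum fun k _ => ?_)
  refine (enorm_complexEval_le (P.continuous_faceTheta k) faceTheta_pos n a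
    (Distribution.toLin (u k)) (f k)).trans ?_
  rw [bdryNormNat_ofTests, Distribution.coe_toLin]
  gcongr
  exact Finset.single_le_sum (f := fun k => weightedSobolevSq (P.faceTheta k) (n + 1) (-a)
    (ofTest (f k))) (fun _ _ => zero_le) (Finset.mem_univ k)

/-- The functional `u` on families of test functions extends to the whole space with the same bound
by the Hahn-Banach theorem, and the extension competes in the infimum. -/
theorem bdryNorm_neg_le (n : ℕ) (a : ℝ) (u : P.BdryDistr) :
    P.bdryNorm (Int.negSucc n) a u ≤ ∑ k, kondNorm (P.faceTheta k) (Int.negSucc n) a (u k) := by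
  by_cases hMt : ∑ k, kondNorm (P.faceTheta k) (Int.negSucc n) a (u k) = ⊤
  · rw [hMt]; exact le_top
  obtain ⟨l, hl, hlM⟩ := (isESeminorm_bdrySpace (n + 1) (-a)).exists_extension bdryNormNat_ne_top
    (ofTests_injective (n + 1) (-a)) (evalTests u) hMt (enorm_evalTests_le n a u)
  refine (iInf₂_le l (restrictsTo_of_apply_single fun k f => ?_)).trans
    (iSup_le fun v => ENNReal.div_le_of_le_mul (hlM v))
  rw [hl, evalTests_single]

theorem IsAdaptedPartition.describesNorm_mu {ε : ℝ} {x : ℕ → Euc 3} {φ : ℕ → Euc 3 → ℝ}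
    (h : P.IsAdaptedPartition ε x φ) (hP : P.sing.Nonempty) (hε : ε ∈ Set.Ioo (0 : ℝ) 1)
    (s : ℤ) (a : ℝ) : DescribesNorm (P.bdryNorm s a) (P.mu x φ s a) := by
  have H := h.describesNorm_mu_facesNorm hP hε s a
  cases s with
  | ofNat n =>
    have e : P.bdryNorm (Int.ofNat n) a = P.facesNorm (Int.ofNat n) a :=
      funext (bdryNormNat_eq_facesNorm n a)
    rwa [e]
  | negSucc n =>
    -- With `N` faces, a sum of `N` terms is at most `N` times their `ℓ²` norm, and the `ℓ²` norm of
    -- `N` terms is at most `√N ≤ N` times a common bound.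
    refine H.congr (P.N : ℝ≥0) (fun u => ?_) fun u => ?_
    · refine (bdryNorm_neg_le n a u).trans ?_
      calc ∑ k, kondNorm (P.faceTheta k) (Int.negSucc n) a (u k)
          ≤ ∑ _k : Fin P.N, P.facesNorm (Int.negSucc n) a u := by
            refine Finset.sum_le_sum fun k _ => ?_
            rw [← sq_rpow_half (kondNorm _ _ _ _), facesNorm]
            gcongr
            exact Finset.single_le_sum (f := fun k =>
              kondNorm (P.faceTheta k) (Int.negSucc n) a (u k) ^ 2) (fun _ _ => zero_le)
              (Finset.mem_univ k)
        _ = _ := by simp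
    · refine le_trans (b := (P.N : ℝ≥0∞) * P.bdryNorm (Int.negSucc n) a u) ?_ (by simp)
      rw [facesNorm, rpow_half_le_iff]
      have hk : ∀ k, kondNorm (P.faceTheta k) (Int.negSucc n) a (u k) ≤
          P.bdryNorm (Int.negSucc n) a u := fun k =>
        le_iInf₂ fun l hl => hl.kondNorm_le_dualNorm k
      calc ∑ k, kondNorm (P.faceTheta k) (Int.negSucc n) a (u k) ^ 2
          ≤ ∑ _k : Fin P.N, P.bdryNorm (Int.negSucc n) a u ^ 2 := by
            gcongr with k; exact hk k
        _ = P.N * P.bdryNorm (Int.negSucc n) a u ^ 2 := by simp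
        _ ≤ (P.N : ℝ≥0∞) ^ 2 * P.bdryNorm (Int.negSucc n) a u ^ 2 := by
            gcongr
            exact_mod_cast Nat.le_self_pow two_ne_zero P.N
        _ = _ := (mul_pow _ _ _).symm

end PolyhedralDomain

/-! ### Mollification -/

section Mollification

open scoped Convolution

variable {d : ℕ}

/-- The integral of `|f|²` as a power of the norm in `L²`. -/
theorem lintegral_enorm_sq (f : Euc d → ℂ) : ∫⁻ x, ‖f x‖ₑ ^ 2 = eLpNorm f 2 volume ^ 2 := by
  rw [eLpNorm_eq_lintegral_rpow_enorm_toReal (by norm_num) (by norm_num)]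
  simp only [ENNReal.toReal_ofNat, ENNReal.rpow_ofNat]
  exact (rpow_half_sq _).symm

/-- Translations are continuous in `L²`. -/
theorem tendsto_lintegral_translate {h : Euc d → ℂ} (hm : MemLp h 2 volume) :
    Tendsto (fun t : Euc d => ∫⁻ x, ‖h (x - t) - h x‖ₑ ^ 2) (𝓝 0) (𝓝 0) := by
  let g : C(Euc d, C(Euc d, Euc d)) :=
    (ContinuousMap.mk (fun a : Euc d × Euc d => a.2 - a.1) (by fun_prop)).curry
  have hg : ∀ t, MeasurePreserving (g t) volume volume := fun t =>
    measurePreserving_sub_right volume t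
  have hc : Continuous fun t => Lp.compMeasurePreserving (g t) (hg t) (hm.toLp h) :=
    Continuous.compMeasurePreservingLp (p := 2) continuous_const g.continuous hg (by norm_num)
  have h1 := tendsto_iff_edist_tendsto_0.1 (hc.tendsto 0)
  have h2 : ∀ t, edist (Lp.compMeasurePreserving (g t) (hg t) (hm.toLp h))
      (Lp.compMeasurePreserving (g 0) (hg 0) (hm.toLp h)) ^ 2 = ∫⁻ x, ‖h (x - t) - h x‖ₑ ^ 2 := by
    intro t
    rw [Lp.toLp_compMeasurePreserving, Lp.toLp_compMeasurePreserving, Lp.edist_toLp_toLp,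
      lintegral_enorm_sq]
    congr 2
    funext x
    change h (x - t) - h (x - 0) = _
    rw [sub_zero]
  have h3 := ENNReal.Tendsto.pow (n := 2) h1
  simp only [h2] at h3
  simpa using h3

/-- Jensen's inequality for the square. -/
theorem sq_lintegral_mul_le {X : Type*} [MeasurableSpace X] {μ : Measure X} {ρ F : X → ℝ≥0∞}
    (hρ : Measurable ρ) (hF : AEMeasurable F μ) (h1 : ∫⁻ x, ρ x ∂μ ≤ 1) :
    (∫⁻ x, ρ x * F x ∂μ) ^ 2 ≤ ∫⁻ x, ρ x * F x ^ 2 ∂μ := by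
  have h := ENNReal.lintegral_mul_le_Lp_mul_Lq μ (p := 2) (q := 2)
    ⟨by norm_num, by norm_num, by norm_num⟩ (f := fun x => ρ x ^ (1 / 2 : ℝ))
    (g := fun x => ρ x ^ (1 / 2 : ℝ) * F x) (hρ.pow_const _).aemeasurable
    ((hρ.pow_const _).aemeasurable.mul hF)
  simp only [Pi.mul_apply, ENNReal.rpow_ofNat, mul_pow, rpow_half_sq, ← mul_assoc, ← sq] at h
  calc _ ≤ ((∫⁻ x, ρ x ∂μ) ^ (1 / 2 : ℝ) * (∫⁻ x, ρ x * F x ^ 2 ∂μ) ^ (1 / 2 : ℝ)) ^ 2 := by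
        gcongr
    _ ≤ (1 ^ (1 / 2 : ℝ) * (∫⁻ x, ρ x * F x ^ 2 ∂μ) ^ (1 / 2 : ℝ)) ^ 2 := by gcongr
    _ = _ := by rw [ENNReal.one_rpow, one_mul, rpow_half_sq]

/-- The convolution `x ↦ ∫ ρ (x - t) h t`. -/
def mollify (ρ : Euc d → ℝ) (h : Euc d → ℂ) : Euc d → ℂ :=
  h ⋆[(ContinuousLinearMap.lsmul ℝ ℝ).flip, volume] ρ

theorem mollify_apply (ρ : Euc d → ℝ) (h : Euc d → ℂ) (x : Euc d) :
    mollify ρ h x = ∫ t, ρ (x - t) • h t := rfl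

theorem mollify_apply' (ρ : Euc d → ℝ) (h : Euc d → ℂ) (x : Euc d) :
    mollify ρ h x = ∫ t, ρ t • h (x - t) := by
  rw [mollify, convolution_eq_swap]; rfl

/-- The error of mollification is an average of the differences `h(x - t) - h(x)` over small `t`;
Jensen's inequality and Tonelli's theorem bound it by the worst translation error. -/
theorem lintegral_mollify_sub_le {ρ : ContDiffBump (0 : Euc d)} {h : Euc d → ℂ}
    (hm : Measurable h) (hl : LocallyIntegrable h volume) {δ : ℝ≥0∞}
    (hδ : ∀ t ∈ Metric.ball (0 : Euc d) ρ.rOut, ∫⁻ x, ‖h (x - t) - h x‖ₑ ^ 2 ≤ δ) :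
    ∫⁻ x, ‖mollify (ρ.normed volume) h x - h x‖ₑ ^ 2 ≤ δ := by
  set r := ρ.normed volume with hr
  set ρ' : Euc d → ℝ≥0∞ := fun t => ENNReal.ofReal (r t) with hρ'
  have hrm : Measurable ρ' := (ρ.continuous_normed.measurable).ennreal_ofReal
  have hr1 : ∫⁻ t, ρ' t = 1 := by
    rw [← ofReal_integral_eq_lintegral_ofReal ρ.integrable_normed
      (Eventually.of_forall ρ.nonneg_normed), ρ.integral_normed, ENNReal.ofReal_one]
  have hpt : ∀ x, ‖mollify r h x - h x‖ₑ ^ 2 ≤ ∫⁻ t, ρ' t * ‖h (x - t) - h x‖ₑ ^ 2 := by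
    intro x
    have hi : Integrable fun t => r t • h (x - t) :=
      ρ.hasCompactSupport_normed.convolutionExists_left (ContinuousLinearMap.lsmul ℝ ℝ)
        ρ.continuous_normed hl x
    have hi2 : Integrable fun t => r t • h x := ρ.integrable_normed.smul_const (h x)
    have e : mollify r h x - h x = ∫ t, r t • (h (x - t) - h x) := by
      rw [mollify_apply']
      simp only [smul_sub]
      rw [integral_sub hi hi2, integral_smul_const, ρ.integral_normed, one_smul]
    rw [e]
    refine le_trans ?_ (sq_lintegral_mul_le hrm ?_ hr1.le)
    · gcongr
      refine (enorm_integral_le_lintegral_enorm _).trans_eq (lintegral_congr fun t => ?_)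
      rw [enorm_smul, Real.enorm_of_nonneg (ρ.nonneg_normed t)]
    · exact (((hm.comp (measurable_const.sub measurable_id)).sub measurable_const).enorm).aemeasurable
  calc _ ≤ ∫⁻ x, ∫⁻ t, ρ' t * ‖h (x - t) - h x‖ₑ ^ 2 := lintegral_mono hpt
    _ = ∫⁻ t, ∫⁻ x, ρ' t * ‖h (x - t) - h x‖ₑ ^ 2 := by
        refine lintegral_lintegral_swap (Measurable.aemeasurable ?_)
        refine (hrm.comp measurable_snd).mul (Measurable.pow_const (Measurable.enorm ?_) 2)
        exact (hm.comp (measurable_fst.sub measurable_snd)).sub (hm.comp measurable_fst)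
    _ ≤ ∫⁻ t, ρ' t * δ := by
        refine lintegral_mono fun t => ?_
        rw [lintegral_const_mul' _ _ (by simp [hρ'])]
        by_cases ht : t ∈ Metric.ball (0 : Euc d) ρ.rOut
        · gcongr; exact hδ t ht
        · have : r t = 0 := by
            rw [← ρ.support_normed_eq (μ := volume)] at ht
            exact Function.notMem_support.1 ht
          simp [hρ', this]
    _ = δ := by rw [lintegral_mul_const _ hrm, hr1, one_mul]

/-- Finitely many functions in `L²` can be approximated by convolution with the same mollifier. -/
theorem exists_mollifier {ι : Type*} (s : Finset ι) {h : ι → Euc d → ℂ}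
    (hm : ∀ i ∈ s, Measurable (h i)) (hl : ∀ i ∈ s, MemLp (h i) 2 volume) {δ : ℝ≥0∞} (hδ : 0 < δ) :
    ∃ ρ : ContDiffBump (0 : Euc d), ∀ i ∈ s,
      ∫⁻ x, ‖mollify (ρ.normed volume) (h i) x - h i x‖ₑ ^ 2 ≤ δ := by
  have h1 : ∀ᶠ t in 𝓝 (0 : Euc d), ∀ i ∈ s, ∫⁻ x, ‖h i (x - t) - h i x‖ₑ ^ 2 < δ :=
    (Filter.eventually_all_finset s).2 fun i hi =>
      (tendsto_lintegral_translate (hl i hi)).eventually (gt_mem_nhds hδ)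
  obtain ⟨r, hr, hball⟩ := Metric.eventually_nhds_iff_ball.1 h1
  refine ⟨⟨r / 2, r, half_pos hr, half_lt_self hr⟩, fun i hi => ?_⟩
  exact lintegral_mollify_sub_le (hm i hi) ((hl i hi).locallyIntegrable (by norm_num))
    fun t ht => (hball t ht i hi).le

end Mollification

/-! ### Density of test functions -/

section Density

open scoped Convolution

variable {d : ℕ}

theorem IsRepBy.sub {Ω : Opens (Euc d)} {T S : 𝓓(Ω, ℝ) → ℂ} {f g : Euc d → ℂ} (hT : IsRepBy T f)
    (hS : IsRepBy S g) : IsRepBy (T - S) (f - g) := by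
  have := hT.add (hS.smul (-1))
  simpa [sub_eq_add_neg] using this

theorem HasWeakDerivs.sub {Ω : Opens (Euc d)} {m : ℕ} {T S : 𝓓(Ω, ℝ) → ℂ}
    {f g : (Fin d → ℕ) → Euc d → ℂ} (hT : HasWeakDerivs m T f) (hS : HasWeakDerivs m S g) :
    HasWeakDerivs m (T - S) fun α => f α - g α := fun α hα => by
  have e : weakDeriv α (T - S) = weakDeriv α T - weakDeriv α S := map_sub (weakDerivₗ α) T S
  rw [e]
  exact (hT α hα).sub (hS α hα)

theorem mem_multiIndices_of_add_single {n : ℕ} {α : Fin d → ℕ} {i : Fin d}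
    (h : α + Pi.single i 1 ∈ multiIndices d n) : α ∈ multiIndices d n := by
  rw [mem_multiIndices, sum_add_single] at h
  rw [mem_multiIndices]
  omega

/-- Convolution with a test function commutes with weak derivatives. -/
theorem HasWeakDerivs.multiDeriv_eq_mollify {n : ℕ} {T : 𝓓((⊤ : Opens (Euc d)), ℝ) → ℂ}
    {h : (Fin d → ℕ) → Euc d → ℂ} (hT : HasWeakDerivs n T h) {ρ : Euc d → ℝ}
    (hρ : ContDiff ℝ ∞ ρ) (hρc : HasCompactSupport ρ) {f : 𝓓((⊤ : Opens (Euc d)), ℂ)}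
    (hf : (f : Euc d → ℂ) = mollify ρ (h 0)) (α : Fin d → ℕ) (hα : α ∈ multiIndices d n) :
    (multiDeriv α f : Euc d → ℂ) = mollify ρ (h α) := by
  induction α using multiIndex_induction with
  | zero => rw [multiDeriv_zero, hf]
  | step α i ih =>
    have hα' := mem_multiIndices_of_add_single hα
    have hloc : LocallyIntegrable (h α) volume := locallyIntegrableOn_univ.1 (hT α hα').1
    rw [multiDeriv_add_single, multiDeriv_lineDeriv, coe_lineDeriv, ih hα']
    funext x
    have h1 := hρc.hasFDerivAt_convolution_right (ContinuousLinearMap.lsmul ℝ ℝ).flip hloc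
      (hρ.of_le (by simp)) x
    rw [mollify, h1.fderiv, convolution_precompR_apply _ hloc (hρc.fderiv ℝ)
      (hρ.continuous_fderiv (by simp))]
    -- The reflected kernel is used as a test function; the sign from the reflection cancels the
    -- sign in the weak derivative.
    let g : 𝓓((⊤ : Opens (Euc d)), ℝ) := ⟨fun t => ρ (x - t), hρ.comp (by fun_prop),
      hρc.comp_homeomorph (Homeomorph.subLeft x), fun _ _ => trivial⟩
    have hg : ∀ t, fderiv ℝ g t (stdVec i) = -fderiv ℝ ρ (x - t) (stdVec i) := by
      intro t
      have h2 : HasFDerivAt (fun t => ρ (x - t))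
          ((fderiv ℝ ρ (x - t)).comp (-ContinuousLinearMap.id ℝ (Euc d))) t :=
        ((hρ.differentiable (by simp)) (x - t)).hasFDerivAt.comp t
          ((hasFDerivAt_id t).const_sub x)
      have h3 : fderiv ℝ g t = _ := h2.fderiv
      rw [h3]
      simp
    have e1 := (hT _ hα).2 g
    rw [weakDeriv_add_single, (hT α hα').2, setIntegral_test_mul, setIntegral_test_mul,
      ← integral_neg] at e1
    calc _ = ∫ t, -(((∂_{stdVec i} g : 𝓓((⊤ : Opens (Euc d)), ℝ)) t : ℝ) : ℂ) * h α t := by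
          rw [convolution_def]
          refine integral_congr_ae (Eventually.of_forall fun t => ?_)
          simp only [coe_lineDeriv, hg]
          simp
      _ = ∫ t, ((g t : ℝ) : ℂ) * h (α + Pi.single i 1) t := by
          simpa only [neg_mul] using e1
      _ = _ := by
          rw [mollify_apply]
          refine integral_congr_ae (Eventually.of_forall fun t => ?_)
          exact (Complex.real_smul).symm

/-- Functionals in a Sobolev space on `ℝᵈ` that are supported in a compact set can be approximated
by test functions. -/
theorem HasWeakDerivs.exists_test_approx {n : ℕ} {a r : ℝ} (hr : 0 < r)
    {Ω : Opens (Euc d)} (hΩ : Ω = ⊤) {T : 𝓓(Ω, ℝ) → ℂ} {h : (Fin d → ℕ) → Euc d → ℂ}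
    (hT : HasWeakDerivs n T h) (hfin : weightedSobolevSq (fun _ => r) n a T < ⊤) {K : Set (Euc d)}
    (hK : IsCompact K)
    (hh : ∀ α, ∀ x ∉ K, h α x = 0) {δ : ℝ≥0∞} (hδ : 0 < δ) :
    ∃ f : 𝓓(Ω, ℂ), weightedSobolevSq (fun _ => r) n a (T - ofTest f) ≤ δ := by
  subst hΩ
  have hae : ∀ α ∈ multiIndices d n, AEMeasurable (h α) volume := fun α hα =>
    (locallyIntegrableOn_univ.1 (hT α hα).1).aestronglyMeasurable.aemeasurable
  classical
  -- Measurable representatives that still vanish everywhere outside `K`, so that the mollified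
  -- function has compact support.
  set g : (Fin d → ℕ) → Euc d → ℂ := fun α =>
    if hα : α ∈ multiIndices d n then K.indicator ((hae α hα).mk (h α)) else 0 with hg
  have hgm : ∀ α ∈ multiIndices d n, Measurable (g α) := fun α hα => by
    simp only [hg, dif_pos hα]
    exact (hae α hα).measurable_mk.indicator hK.measurableSet
  have hgK : ∀ α, ∀ x ∉ K, g α x = 0 := fun α x hx => by
    simp only [hg]
    split_ifs
    · exact indicator_of_notMem hx _
    · rfl
  have hgh : ∀ α ∈ multiIndices d n, h α =ᵐ[volume] g α := fun α hα => by
    filter_upwards [(hae α hα).ae_eq_mk] with x hx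
    simp only [hg, dif_pos hα]
    by_cases hxK : x ∈ K
    · rw [indicator_of_mem hxK, hx]
    · rw [indicator_of_notMem hxK, hh α x hxK]
  have hTg : HasWeakDerivs n T g := fun α hα =>
    (hT α hα).congr_ae (ae_restrict_of_ae (hgh α hα))
  set c : (Fin d → ℕ) → ℝ := fun α => r ^ (((∑ i, α i : ℕ) : ℝ) - a)
  have hc : ∀ α, 0 < c α := fun α => Real.rpow_pos_of_pos hr _
  have hE : ∀ (f : (Fin d → ℕ) → Euc d → ℂ), energy (fun _ => r) n a
      ((⊤ : Opens (Euc d)) : Set (Euc d)) f =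
      ∑ α ∈ multiIndices d n, ENNReal.ofReal (c α) ^ 2 * ∫⁻ x, ‖f α x‖ₑ ^ 2 := by
    intro f
    refine Finset.sum_congr rfl fun α _ => ?_
    rw [Opens.coe_top, Measure.restrict_univ, ← lintegral_const_mul' _ _ (by simp)]
    refine lintegral_congr fun x => ?_
    rw [enorm_mul, mul_pow, enorm_ofReal_of_nonneg (hc α).le]
  have hL2 : ∀ α ∈ multiIndices d n, MemLp (g α) 2 volume := fun α hα => by
    refine ⟨(hgm α hα).aestronglyMeasurable, ?_⟩
    rw [hTg.weightedSobolevSq_eq, hE, ENNReal.sum_lt_top] at hfin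
    have h1 := hfin α hα
    rw [lintegral_enorm_sq] at h1
    by_contra htop
    rw [not_lt_top_iff] at htop
    rw [htop, ENNReal.top_pow two_ne_zero, ENNReal.mul_top] at h1
    · exact lt_irrefl _ h1
    · simpa using hc α
  set C : ℝ≥0∞ := ∑ α ∈ multiIndices d n, ENNReal.ofReal (c α) ^ 2 with hC
  have hCt : C ≠ ⊤ := (ENNReal.sum_lt_top.2 fun α _ => by simp).ne
  -- `C` is the sum of the squared constant weights; dividing by `C + 1` avoids a separate case `C =
  -- 0`.
  obtain ⟨ρ, hρ⟩ := exists_mollifier (multiIndices d n) hgm hL2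
    (δ := δ / (C + 1)) (ENNReal.div_pos hδ.ne' (by simp [hCt]))
  have h0 : (0 : Fin d → ℕ) ∈ multiIndices d n := mem_multiIndices.2 (by simp)
  have hρs : ContDiff ℝ ∞ (ρ.normed volume) := ρ.contDiff_normed
  have hl0 : LocallyIntegrable (g 0) volume := locallyIntegrableOn_univ.1 (hTg 0 h0).1
  let f : 𝓓((⊤ : Opens (Euc d)), ℂ) := ⟨mollify (ρ.normed volume) (g 0),
    ρ.hasCompactSupport_normed.contDiff_convolution_right _ hl0 hρs,
    HasCompactSupport.convolution _ (HasCompactSupport.intro hK (hgK 0))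
      ρ.hasCompactSupport_normed, fun _ _ => trivial⟩
  have hf := hTg.multiDeriv_eq_mollify hρs ρ.hasCompactSupport_normed (f := f) rfl
  refine ⟨f, ?_⟩
  rw [(hTg.sub (hasWeakDerivs_ofTest n f)).weightedSobolevSq_eq, hE]
  calc _ ≤ ∑ α ∈ multiIndices d n, ENNReal.ofReal (c α) ^ 2 * (δ / (C + 1)) := by
        refine Finset.sum_le_sum fun α hα => ?_
        gcongr
        refine le_trans (le_of_eq (lintegral_congr fun x => ?_)) (hρ α hα)
        rw [Pi.sub_apply, hf α hα, ← enorm_neg, neg_sub]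
    _ = C * (δ / (C + 1)) := by rw [← Finset.sum_mul]
    _ ≤ (C + 1) * (δ / (C + 1)) := by gcongr; exact le_self_add
    _ ≤ δ := ENNReal.mul_div_le

end Density

theorem IsLocallyFiniteSum.sub {d : ℕ} {Ω : Opens (Euc d)} {ι : Type*} {Z : ι → Set (Euc d)}
    {T T' : 𝓓(Ω, ℝ) → ℂ} {S S' : ι → 𝓓(Ω, ℝ) → ℂ} (h : IsLocallyFiniteSum Z T S)
    (h' : IsLocallyFiniteSum Z T' S') : IsLocallyFiniteSum Z (T - T') fun j => S j - S' j where
  finite := h.finite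
  eq_sum g s hs := by
    simp only [Pi.sub_apply, Finset.sum_sub_distrib, h.eq_sum g s hs, h'.eq_sum g s hs]

/-- Test functions are dense in weighted Sobolev spaces, if all model sets are `ℝᵈ`. -/
theorem LocalCover.exists_test_approx {d : ℕ} {Ω : Opens (Euc d)} {w : Euc d → ℝ} {ι : Type*}
    [Countable ι] (A : LocalCover Ω w ι) (hM : ∀ j, A.M j = ⊤) (n : ℕ) (a : ℝ)
    (T : 𝓓(Ω, ℝ) →ₗ[ℝ] ℂ) (hT : weightedSobolevSq w n a T < ⊤) {δ : ℝ≥0∞} (hδ : 0 < δ) :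
    ∃ f : 𝓓(Ω, ℂ), weightedSobolevSq w n a (⇑T - ofTest f) ≤ δ := by
  classical
  set c : ι → ℝ≥0∞ := fun j => weightedSobolevSq (fun _ => A.r j) n a (A.loc j T)
  have hK0 : (A.K n a : ℝ≥0∞) ≠ 0 := by exact_mod_cast (zero_lt_one.trans_le (A.one_le_K n a)).ne'
  have hc : ∑' j, c j ≠ ⊤ :=
    ((A.tsum_loc_le n a T).trans_lt (ENNReal.mul_lt_top ENNReal.coe_lt_top hT)).ne
  -- Half of the admissible error is for the tail outside a finite set `s`, half for the
  -- approximations `f j` with `j ∈ s`; the factor `K` is lost in the synthesis.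
  set η : ℝ≥0∞ := δ / A.K n a / 2
  have hη : 0 < η := ENNReal.half_pos (ENNReal.div_pos hδ.ne' ENNReal.coe_ne_top).ne'
  obtain ⟨s, hs⟩ := ((ENNReal.tendsto_tsum_compl_atTop_zero hc).eventually (gt_mem_nhds hη)).exists
  obtain ⟨δ', hδ', hsum⟩ := ENNReal.exists_pos_sum_of_countable' hη.ne' ι
  obtain ⟨h, hh⟩ := exists_hasWeakDerivs hT
  have happ : ∀ j, ∃ f : 𝓓(A.M j, ℂ),
      weightedSobolevSq (fun _ => A.r j) n a (⇑(A.loc j T) - ofTest f) ≤ δ' j := fun j =>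
    (hh.pull (A.φM j)).exists_test_approx (A.r_pos j) (hM j)
      ((ENNReal.le_tsum j).trans_lt hc.lt_top) (isCompact_closedBall _ _)
      (fun α x hx => (A.φM j).leibniz_eq_zero h α fun hx' => hx (A.tsupport_φ_subset j hx')) (hδ' j)
  choose f hf using happ
  set f' : ∀ j, 𝓓(A.M j, ℂ) := fun j => if j ∈ s then f j else 0 with hf'
  have h0 : ∀ j ∉ s, f' j = 0 := fun j hj => by simp [hf', hj]
  have h1 : ∀ j ∈ s, f' j = f j := fun j hj => by simp [hf', hj]
  have hcoe : ∀ j, ⇑(A.loc j T - ofTestLin (f' j)) = ⇑(A.loc j T) - ofTest (f' j) := fun j => by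
    rw [← coe_ofTestLin]; rfl
  have hpull : ∀ j, ⇑((A.ψΩ j).pull (A.loc j T - ofTestLin (f' j))) =
      ⇑((A.ψΩ j).pull (A.loc j T)) - ofTest ((A.ψM j).mul (f' j)) := fun j => by
    rw [← coe_ofTestLin, ← (A.ψΩ j).pull_ofTest (A.ψM j) rfl]; rfl
  -- As `f j` approximates `φ j T` and `T = ∑ ψ j (φ j T)`, the pieces are glued with `ψ j`, which
  -- also brings their supports back into `Ω`.
  refine ⟨∑ j ∈ s, (A.ψM j).mul (f' j), ?_⟩
  have key := A.le_tsum_pull n a A.ψΩ A.isAdmissible_ψ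
    (⇑T - ofTest (∑ j ∈ s, (A.ψM j).mul (f' j))) (fun j => A.loc j T - ofTestLin (f' j)) (by
      simp only [hpull]
      exact (A.isLocallyFiniteSum_loc T).sub
        (A.isLocallyFiniteSum_ofTest A.ψM A.tsupport_ψ_subset h0))
  have htail : ∑' j, weightedSobolevSq (fun _ => A.r j) n a
      (⇑(A.loc j T - ofTestLin (f' j))) ≤ η + η := by
    calc _ ≤ ∑' j, (δ' j + ({j | j ∉ s} : Set ι).indicator c j) := by
          refine ENNReal.tsum_le_tsum fun j => ?_
          rw [hcoe]
          by_cases hj : j ∈ s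
          · rw [h1 j hj]
            exact (hf j).trans le_self_add
          · have hz : ofTest (0 : 𝓓(A.M j, ℂ)) = 0 := map_zero ofTestₗ
            rw [h0 j hj, hz, sub_zero, indicator_of_mem (show j ∈ {j | j ∉ s} from hj)]
            exact le_add_self
      _ = ∑' j, δ' j + ∑' j : {j // j ∉ s}, c j := by
          rw [ENNReal.tsum_add]
          congr 1
          exact (tsum_subtype {j | j ∉ s} c).symm
      _ ≤ η + η := add_le_add hsum.le hs.le
  refine key.trans ?_
  calc _ ≤ (A.K n a : ℝ≥0∞) * (η + η) := by gcongr
    _ = A.K n a * (δ / A.K n a) := by rw [ENNReal.add_halves]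
    _ ≤ δ := ENNReal.mul_div_le

theorem ENNReal.eq_zero_of_forall_pos_le_mul {y c : ℝ≥0∞} (hc : c ≠ ⊤)
    (h : ∀ δ, 0 < δ → y ≤ c * δ) : y = 0 := by
  by_contra hy
  have h1 := h (y / 2 / (c + 1)) (ENNReal.div_pos (ENNReal.half_pos hy).ne' (by simp [hc]))
  have hyt : y ≠ ⊤ := fun htop => by
    have := h 1 one_pos
    rw [htop, mul_one, top_le_iff] at this
    exact hc this
  refine absurd (h1.trans ?_) (not_le.2 (ENNReal.half_lt_self hy hyt))
  calc c * (y / 2 / (c + 1)) ≤ (c + 1) * (y / 2 / (c + 1)) := by gcongr; exact le_self_add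
    _ ≤ y / 2 := ENNReal.mul_div_le

namespace PolyhedralDomain

variable {P : PolyhedralDomain}

/-- A continuous linear form that vanishes on test functions is zero. -/
theorem IsAdaptedPartition.eq_zero_of_restrictsTo_zero {ε : ℝ} {x : ℕ → Euc 3}
    {φ : ℕ → Euc 3 → ℝ} (h : P.IsAdaptedPartition ε x φ) (hP : P.sing.Nonempty)
    (hε : ε ∈ Set.Ioo (0 : ℝ) 1) {n : ℕ} {a : ℝ} {l : P.bdrySpace n a →ₗ[ℂ] ℂ}
    (hl : P.dualNorm l < ⊤) (h0 : P.RestrictsTo l 0) : l = 0 := by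
  ext v
  rw [LinearMap.zero_apply, ← enorm_eq_zero, ← pow_eq_zero_iff two_ne_zero]
  refine ENNReal.eq_zero_of_forall_pos_le_mul (c := P.dualNorm l ^ 2 * P.N)
    (ENNReal.mul_ne_top (ENNReal.pow_ne_top hl.ne) (by simp)) fun δ hδ => ?_
  have hv := P.bdryNormNat_lt_top.1 v.2
  choose f hf using fun k => (h.faceCover hP hε k).exists_test_approx (fun _ => rfl) n a
    (Distribution.toLin ((v : P.BdryDistr) k)) (hv k) hδ
  have hlf : l (P.ofTests n a f) = 0 := by
    rw [h0.apply_ofTests]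
    refine Finset.sum_eq_zero fun k _ => ?_
    simp [complexEval]
  -- The form vanishes on the approximating test functions, so only the arbitrarily small difference
  -- matters.
  have hlv : l v = l (v - P.ofTests n a f) := by
    have := l.map_sub v (P.ofTests n a f)
    rw [hlf, sub_zero] at this
    exact this.symm
  have hnorm : P.bdryNormNat n a (v - P.ofTests n a f : P.bdrySpace n a) ^ 2 ≤ P.N * δ := by
    rw [bdryNormNat, rpow_half_sq]
    calc _ ≤ ∑ _k : Fin P.N, δ := by
          refine Finset.sum_le_sum fun k _ => le_trans (le_of_eq ?_) (hf k)
          rw [← ofTests_apply n a]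
          rfl
      _ = _ := by simp
  calc ‖l v‖ₑ ^ 2 ≤ (P.dualNorm l * P.bdryNormNat n a (v - P.ofTests n a f : P.bdrySpace n a)) ^ 2 := by
        rw [hlv]
        gcongr
        exact apply_le_dualNorm l hl _
    _ = P.dualNorm l ^ 2 * P.bdryNormNat n a (v - P.ofTests n a f : P.bdrySpace n a) ^ 2 :=
        mul_pow _ _ _
    _ ≤ P.dualNorm l ^ 2 * (P.N * δ) := by gcongr
    _ = _ := (mul_assoc _ _ _).symm

end PolyhedralDomain

end

theorem mainTheorem3 (P : PolyhedralDomain) (hP : P.sing.Nonempty) (ε : ℝ)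
    (hε : ε ∈ Set.Ioo (0 : ℝ) 1)
    (x : ℕ → Euc 3) (φ : ℕ → Euc 3 → ℝ) (h : P.IsAdaptedPartition ε x φ) :
    (∀ (m : ℤ) (a : ℝ), DescribesNorm (P.domainNorm m a) (P.nu x φ m a)) ∧
    (∀ (s : ℤ) (a : ℝ), DescribesNorm (P.bdryNorm s a) (P.mu x φ s a)) ∧
    (∀ (n : ℕ) (a : ℝ) (l : P.bdrySpace n a →ₗ[ℂ] ℂ),
      P.dualNorm l < ⊤ → P.RestrictsTo l 0 → l = 0) := by
  exact ⟨h.describesNorm_nu hP hε, h.describesNorm_mu hP hε,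
    fun _ _ _ hl h0 => h.eq_zero_of_restrictsTo_zero hP hε hl h0⟩
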